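/- Let $\xi$ be a random variable with values in $\{0,1,2,\dots\}$, with $\mathbb E\xi=1$ and $0<\operatorname{Var}\xi<\infty$. Let $\mathcal T$ be the Galton--Watson tree with offspring distribution $\xi$, regarded as a random finite rooted ordered tree, write $|T|$ for the number of nodes of a tree $T$, and let $K=\{k\ge 1:\mathbb P(|\mathcal T|=k)>0\}$. For $k\in K$ let $\mathcal T_k$ be $\mathcal T$ conditioned on $|\mathcal T|=k$. For a real-valued functional $f$ on finite rooted ordered trees put $F(T)=\sum_{v\in T}f(T_v)$, where $T_v$ is the subtree of $T$ consisting of the node $v$ and all its descendants. For an integer $M\ge 0$, call $f$ weakly local with cut-off $M$ if $f(T)$ depends only on $|T|$ and on $T^{(M)}$, the tree $T$ truncated at height $M$ (keeping exactly the nodes at depth at most $M$). Theorem. For every $M$ there is a constant $C_M>0$, depending only on $M$ and on the distribution of $\xi$, such that for every bounded functional $f$ that is weakly local with cut-off $M$ and every $n\in K$, $$\operatorname{Var}\bigl(F(\mathcal T_n)\bigr)^{1/2}\le C_M\, n^{1/2}\Bigl(\bigl(\sup_{k\in K}A_k\cdot\sup_{k\in K}k^{-1/4}A_k\bigr)^{1/2}+\sup_{k\in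 K}|\mu_k|+\sum_{k\in K}\frac{|\mu_k|}{k}\Bigr),$$ where $A_k=\sup\{|f(T)|:|T|=k\}$ and $\mu_k=\mathbb E f(\mathcal T_k)$. (The right-hand side may be $+\infty$.) -/

import Mathlib

open MeasureTheory ProbabilityTheory
open scoped NNReal ENNReal

/-- Finite rooted ordered (plane) trees: a root with `d` ordered branches `c 0, …, c (d - 1)`. -/
inductive PlaneTree : Type
  | node (d : ℕ) (c : Fin d → PlaneTree) : PlaneTree

namespace PlaneTree

/-- The set of nodes of a tree: the root (`none`), and the nodes of each of its branches. -/
def Node : PlaneTree → Type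
  | node d c => Option (Σ i : Fin d, Node (c i))

/-- A plane tree has finitely many nodes. -/
instance instFintypeNode : (T : PlaneTree) → Fintype T.Node
  | node d c =>
    letI : ∀ i : Fin d, Fintype (Node (c i)) := fun i => instFintypeNode (c i)
    inferInstanceAs (Fintype (Option (Σ i : Fin d, Node (c i))))

/-- The size `|T|`: the number of nodes. -/
def size (T : PlaneTree) : ℕ := Fintype.card T.Node

/-- The fringe subtree `T_v`: the node `v` together with all its descendants. -/
def fringe : (T : PlaneTree) → T.Node → PlaneTree
  | node d c, none => node d c
  | node _ c, some ⟨i, v⟩ => fringe (c i) v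

/-- The outdegree of the root. -/
def rootDegree : PlaneTree → ℕ
  | node d _ => d

/-- The outdegree (number of children) of a node `v`. -/
def outdegree (T : PlaneTree) (v : T.Node) : ℕ := (T.fringe v).rootDegree

/-- `trunc M T` is `T` truncated at height `M`: exactly the nodes at depth at most `M` are kept. -/
def trunc : ℕ → PlaneTree → PlaneTree
  | 0, _ => node 0 (fun i => i.elim0)
  | M + 1, node d c => node d (fun i => trunc M (c i))

/-- The additive functional `F(T) = ∑_{v ∈ T} f(T_v)` with toll function `f`. -/
def additive (f : PlaneTree → ℝ) (T : PlaneTree) : ℝ := ∑ v : T.Node, f (T.fringe v)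

/-- `f` is weakly local with cut-off `M`: `f(T)` is determined by `|T|` and by `T` truncated at
height `M`. -/
def IsWeaklyLocal (f : PlaneTree → ℝ) (M : ℕ) : Prop :=
  ∀ T T' : PlaneTree, T.size = T'.size → trunc M T = trunc M T' → f T = f T'

theorem size_node (d : ℕ) (c : Fin d → PlaneTree) :
    (node d c).size = 1 + ∑ i, (c i).size := by
  have h : (node d c).size = Fintype.card (Option (Σ i : Fin d, Node (c i))) :=
    Fintype.card_congr (Equiv.refl _)
  rw [h, Fintype.card_option, Fintype.card_sigma, add_comm]
  rfl

theorem additive_node (f : PlaneTree → ℝ) (d : ℕ) (c : Fin d → PlaneTree) :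
    additive f (node d c) = f (node d c) + ∑ i, additive f (c i) := by
  have h : additive f (node d c) =
      ∑ v : Option (Σ i : Fin d, Node (c i)), f (fringe (node d c) v) := rfl
  rw [h, Fintype.sum_option, Fintype.sum_sigma]
  rfl

/-- The set of all plane trees is discrete. -/
instance instMeasurableSpace : MeasurableSpace PlaneTree := ⊤

instance instDiscreteMeasurableSpace : DiscreteMeasurableSpace PlaneTree :=
  ⟨fun _ => trivial⟩

/-- The probability `∏_{v ∈ T} p (outdegree of v)` that a Galton–Watson tree with offspring
distribution `p` equals the finite tree `T`. -/
noncomputable def gwProb (p : PMF ℕ) (T : PlaneTree) : ℝ≥0∞ := ∏ v : T.Node, p (T.outdegree v)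

/-- The recursive description of the Galton–Watson tree: the root has `d` children with
probability `p d`, and the `d` branches are independent copies of the whole tree. -/
theorem gwProb_node (p : PMF ℕ) (d : ℕ) (c : Fin d → PlaneTree) :
    gwProb p (node d c) = p d * ∏ i, gwProb p (c i) := by
  have h : gwProb p (node d c) =
      ∏ v : Option (Σ i : Fin d, Node (c i)), p (outdegree (node d c) v) := rfl
  rw [h, Fintype.prod_option, Fintype.prod_sigma]
  rfl

/-- The law of the Galton–Watson tree `𝒯` with offspring distribution `p`, as a measure on the
countable set of finite plane trees (its total mass is the probability that `𝒯` is finite). -/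
noncomputable def gwLaw (p : PMF ℕ) : Measure PlaneTree :=
  Measure.sum fun T => gwProb p T • Measure.dirac T

/-- The possible sizes of `𝒯`: those `n` with `ℙ(|𝒯| = n) > 0`. -/
def possibleSizes (p : PMF ℕ) : Set ℕ := {n | 0 < gwLaw p {T | T.size = n}}

/-- The law of the conditioned Galton–Watson tree `𝒯_n`: the law of `𝒯` conditioned on
`|𝒯| = n`. -/
noncomputable def condGWLaw (p : PMF ℕ) (n : ℕ) : Measure PlaneTree :=
  ProbabilityTheory.cond (gwLaw p) {T | T.size = n}

/-- `A_k = sup {|f(T)| : |T| = k}`, as an extended nonnegative number. -/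
noncomputable def supOfSize (f : PlaneTree → ℝ) (k : ℕ) : ℝ≥0∞ :=
  ⨆ T : {T : PlaneTree // T.size = k}, ENNReal.ofReal |f T|

/-- `μ_k = 𝔼 f(𝒯_k)`. -/
noncomputable def condMean (p : PMF ℕ) (f : PlaneTree → ℝ) (k : ℕ) : ℝ :=
  ∫ T, f T ∂(condGWLaw p k)

end PlaneTree

/-! ### Trees of given size and weighted sums over them -/

namespace PlaneTree

/-! Split $f(T)=g(T)+\mu_{|T|}$, so that $g$ has mean zero given the size, and bound the second
moments of the two additive functionals separately. Expectations are kept as finite sums `treeSum`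
weighted by Galton–Watson probabilities; division by $\mathbb P(|\mathcal T|=n)$ is left to the end.

Centred part. Given their sizes, disjoint fringe subtrees are independent conditioned trees, so in
$\mathbb E F_g^2$ only ancestor–descendant pairs survive (`treeSum_additive_sq_of_centered`). In
$\mathbb E\,g(\mathcal T_k)F_g(\mathcal T_k)$ the factor $g$ sees only the size and the first $M$
levels, and conditioning on the sizes of the subtrees at depth $M$ removes every node at depth at
least $M$ (`treeSum_mul_additive_of_isWeaklyLocal`). The mean number of nodes at depth less than $M$
is bounded, so this expectation is $O(A_1A_2k^{1/4})$, with $A_1,A_2$ the two suprema. Up to a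
boundary factor for $k$ near $n$, $\mathcal T_n$ has on average $O(nk^{-3/2})$ fringe subtrees of
size $k$; as $\sum k^{-5/4}<\infty$, the total is $O(nA_1A_2)$.

Size part. Encode a tree by its outdegrees in depth-first order. By the cycle lemma, the uniformly
rotated word of $\mathcal T_n$ consists of independent letters conditioned on their sum. Cut it into
two halves: by local limit bounds each half is dominated, up to a constant, by unconditioned letters
(`LocalBounds.treeSum_sq_le`). The error comes from trees that cross one of two cuts; averaged over
rotations its second moment is $O(n(s+S)^2)$ (`LocalBounds.treeSum_cutSum_sq_le`), where
$s=\sup|\mu_k|$ and $S=\sum|\mu_k|/k$.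

It remains to see that the variance $V$ for independent letters grows linearly
(`LocalBounds.wordVar_le`). With $e$ the mean, one more letter adds to $V$ at most twice
$\sum_k\mu_k\mathbb P(|\mathcal T|=k)\bigl(\mathbb E F(\mathcal T_k)-(e_n-e_{n+1-k})\bigr)$, where
$k$ is the size of the first tree. Here $e$ is additive up to $O(\sqrt k)$, and $\mathbb E
F(\mathcal T_k)$ is $e_{\lfloor k/2\rfloor}+e_{\lceil k/2\rceil}$ up to $O(\sqrt k)$, by the same
halving and the bound on $V$ for shorter words. Since $\mathbb P(|\mathcal T|=k)=O(k^{-3/2})$, the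
increment is $O((y+X)X)$ when $V(j)\le jy^2$ is known for smaller $j$ and $X=s+S$; taking $y$ a
large multiple of $X$ closes the induction.

What is needed of the offspring law is collected in `LocalBounds`, and follows from the Otter–Dwass
formula and local limit bounds proved by Fourier inversion. -/

theorem one_le_size (T : PlaneTree) : 1 ≤ T.size := by
  cases T with
  | node d c => rw [size_node]; omega

theorem size_lt_size_node {d : ℕ} (c : Fin d → PlaneTree) (i : Fin d) :
    (c i).size < (node d c).size := by
  rw [size_node]
  have := Finset.single_le_sum (f := fun i => (c i).size) (fun _ _ => Nat.zero_le _)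
    (Finset.mem_univ i)
  omega

theorem degree_lt_size_node {d : ℕ} (c : Fin d → PlaneTree) : d < (node d c).size := by
  rw [size_node]
  have : ∑ _i : Fin d, 1 ≤ ∑ i, (c i).size := Finset.sum_le_sum fun i _ => one_le_size _
  simp at this
  omega

theorem finite_size_le (n : ℕ) : {T : PlaneTree | T.size ≤ n}.Finite := by
  induction n with
  | zero =>
    refine Set.Finite.subset Set.finite_empty fun T hT => ?_
    have := one_le_size T
    simp only [Set.mem_ofPred_eq] at hT
    omega
  | succ n ih =>
    have : Finite {T : PlaneTree | T.size ≤ n} := ih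
    refine (Set.finite_range (fun x : (Σ d : Fin (n + 1), Fin d → {T : PlaneTree | T.size ≤ n}) =>
      node x.1 fun i => (x.2 i : PlaneTree))).subset fun T hT => ?_
    cases T with
    | node d c =>
      simp only [Set.mem_ofPred_eq] at hT
      refine ⟨⟨⟨d, (degree_lt_size_node c).trans_le hT⟩,
        fun i => ⟨c i, Nat.le_of_lt_succ ((size_lt_size_node c i).trans_le hT)⟩⟩, rfl⟩

/-- The finite set of plane trees with at most `n` nodes. -/
noncomputable def treesLE (n : ℕ) : Finset PlaneTree := (finite_size_le n).toFinset

@[simp] theorem mem_treesLE {n : ℕ} {T : PlaneTree} : T ∈ treesLE n ↔ T.size ≤ n := by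
  simp [treesLE]

open Classical in
/-- The finite set of plane trees with exactly `n` nodes. -/
noncomputable def trees (n : ℕ) : Finset PlaneTree := (treesLE n).filter fun T => T.size = n

@[simp] theorem mem_trees {n : ℕ} {T : PlaneTree} : T ∈ trees n ↔ T.size = n := by
  simp only [trees, Finset.mem_filter, mem_treesLE, and_iff_right_iff_imp]
  exact fun h => h.le

theorem gwProb_ne_top (p : PMF ℕ) (T : PlaneTree) : gwProb p T ≠ ∞ :=
  ENNReal.prod_ne_top fun _ _ => p.apply_ne_top _

/-- The Galton–Watson probability of a tree, as a real number. -/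
noncomputable def wt (p : PMF ℕ) (T : PlaneTree) : ℝ := (gwProb p T).toReal

theorem wt_nonneg (p : PMF ℕ) (T : PlaneTree) : 0 ≤ wt p T := ENNReal.toReal_nonneg

theorem wt_node (p : PMF ℕ) (d : ℕ) (c : Fin d → PlaneTree) :
    wt p (node d c) = (p d).toReal * ∏ i, wt p (c i) := by
  rw [wt, gwProb_node, ENNReal.toReal_mul, ENNReal.toReal_prod]
  rfl

/-- The sum of `Φ` over all trees with `n` nodes, weighted by their probabilities. -/
noncomputable def treeSum (p : PMF ℕ) (n : ℕ) (Φ : PlaneTree → ℝ) : ℝ :=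
  ∑ T ∈ trees n, wt p T * Φ T

section treeSum
variable {p : PMF ℕ} {n : ℕ} {Φ Ψ : PlaneTree → ℝ}

theorem treeSum_congr (h : ∀ T, T.size = n → Φ T = Ψ T) : treeSum p n Φ = treeSum p n Ψ :=
  Finset.sum_congr rfl fun T hT => by rw [h T (mem_trees.1 hT)]

theorem treeSum_mono (h : ∀ T, T.size = n → Φ T ≤ Ψ T) : treeSum p n Φ ≤ treeSum p n Ψ :=
  Finset.sum_le_sum fun T hT =>
    mul_le_mul_of_nonneg_left (h T (mem_trees.1 hT)) (wt_nonneg p T)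

/-- The suprema in the main theorem run over possible sizes only, so pointwise bounds on `f` are
available just for trees of positive weight. -/
theorem treeSum_mono_of_pos (h : ∀ T, T.size = n → 0 < wt p T → Φ T ≤ Ψ T) :
    treeSum p n Φ ≤ treeSum p n Ψ :=
  Finset.sum_le_sum fun T hT => by
    rcases (wt_nonneg p T).eq_or_lt with h0 | h0
    · simp [← h0]
    · exact mul_le_mul_of_nonneg_left (h T (mem_trees.1 hT) h0) h0.le

theorem treeSum_nonneg (h : ∀ T, T.size = n → 0 ≤ Φ T) : 0 ≤ treeSum p n Φ :=
  Finset.sum_nonneg fun T hT => mul_nonneg (wt_nonneg p T) (h T (mem_trees.1 hT))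

theorem treeSum_add : treeSum p n (fun T => Φ T + Ψ T) = treeSum p n Φ + treeSum p n Ψ := by
  simp only [treeSum, mul_add, Finset.sum_add_distrib]

theorem treeSum_sub : treeSum p n (fun T => Φ T - Ψ T) = treeSum p n Φ - treeSum p n Ψ := by
  simp only [treeSum, mul_sub, Finset.sum_sub_distrib]

theorem treeSum_const_mul (a : ℝ) : treeSum p n (fun T => a * Φ T) = a * treeSum p n Φ := by
  simp only [treeSum, Finset.mul_sum]
  exact Finset.sum_congr rfl fun T _ => by ring

theorem treeSum_mul_const (a : ℝ) : treeSum p n (fun T => Φ T * a) = treeSum p n Φ * a := by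
  simp only [treeSum, Finset.sum_mul, mul_assoc]

theorem treeSum_const (a : ℝ) : treeSum p n (fun _ => a) = a * treeSum p n fun _ => 1 := by
  rw [← treeSum_const_mul]; simp

theorem treeSum_zero : treeSum p n (fun _ => 0) = 0 := by simp [treeSum]

theorem abs_treeSum_le : |treeSum p n Φ| ≤ treeSum p n fun T => |Φ T| :=
  (Finset.abs_sum_le_sum_abs _ _).trans_eq <| Finset.sum_congr rfl fun T _ => by
    rw [abs_mul, abs_of_nonneg (wt_nonneg p T)]

theorem treeSum_zero_size : treeSum p 0 Φ = 0 :=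
  Finset.sum_eq_zero fun T hT => by
    have := one_le_size T
    rw [mem_trees] at hT
    omega

/-- Cauchy–Schwarz. -/
theorem sq_treeSum_le : treeSum p n Φ ^ 2 ≤
    treeSum p n (fun _ => 1) * treeSum p n (fun T => Φ T ^ 2) := by
  have h := Finset.sum_sq_le_sum_mul_sum_of_sq_le_mul (trees n) (r := fun T => wt p T * Φ T)
    (f := fun T => wt p T * 1) (g := fun T => wt p T * Φ T ^ 2)
    (fun T _ => mul_nonneg (wt_nonneg p T) zero_le_one)
    (fun T _ => mul_nonneg (wt_nonneg p T) (sq_nonneg _)) (fun T _ => le_of_eq (by ring))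
  exact h

end treeSum

/-! ### Weighted sums over forests -/

open Classical in
/-- The weighted sum over all `d`-tuples of trees with total size `n`. -/
noncomputable def forestSum (p : PMF ℕ) (d n : ℕ) (A : (Fin d → PlaneTree) → ℝ) : ℝ :=
  ∑ c ∈ Fintype.piFinset fun _ : Fin d => treesLE n,
    if ∑ i, (c i).size = n then (∏ i, wt p (c i)) * A c else 0

section forestSum
variable {p : PMF ℕ} {d n : ℕ} {A B : (Fin d → PlaneTree) → ℝ}

theorem forestSum_add : forestSum p d n (fun c => A c + B c) =
    forestSum p d n A + forestSum p d n B := by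
  simp only [forestSum, ← Finset.sum_add_distrib]
  exact Finset.sum_congr rfl fun c _ => by split_ifs <;> ring

theorem forestSum_finsetSum {ι : Type*} (s : Finset ι) (A : ι → (Fin d → PlaneTree) → ℝ) :
    forestSum p d n (fun c => ∑ j ∈ s, A j c) = ∑ j ∈ s, forestSum p d n (A j) := by
  classical
  induction s using Finset.induction_on with
  | empty => simp [forestSum]
  | insert a s ha ih => simp only [Finset.sum_insert ha, forestSum_add, ih]

theorem forestSum_congr (h : ∀ c : Fin d → PlaneTree, ∑ i, (c i).size = n → A c = B c) :
    forestSum p d n A = forestSum p d n B :=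
  Finset.sum_congr rfl fun c _ => by
    split_ifs with hc
    · rw [h c hc]
    · rfl

/-- The decomposition of a tree at its root. -/
theorem treeSum_succ (p : PMF ℕ) (n : ℕ) (Φ : PlaneTree → ℝ) :
    treeSum p (n + 1) Φ = ∑ d ∈ Finset.range (n + 1),
      (p d).toReal * forestSum p d n fun c => Φ (node d c) := by
  classical
  have h1 : ∀ d, (p d).toReal * forestSum p d n (fun c => Φ (node d c)) =
      ∑ c ∈ (Fintype.piFinset fun _ : Fin d => treesLE n).filter (fun c => ∑ i, (c i).size = n),
        wt p (node d c) * Φ (node d c) := by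
    intro d
    rw [Finset.sum_filter, forestSum, Finset.mul_sum]
    refine Finset.sum_congr rfl fun c _ => ?_
    split_ifs
    · rw [wt_node]; ring
    · simp
  simp only [h1]
  rw [Finset.sum_sigma', treeSum]
  symm
  refine Finset.sum_bij (fun x _ => node x.1 x.2) ?_ ?_ ?_ ?_
  · rintro ⟨d, c⟩ h
    simp only [Finset.mem_sigma, Finset.mem_filter] at h
    simp only [mem_trees, size_node, h.2.2]
    omega
  · rintro ⟨d, c⟩ _ ⟨d', c'⟩ _ h
    simp only [node.injEq] at h
    obtain ⟨rfl, h⟩ := h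
    rw [eq_of_heq h]
  · rintro ⟨d, c⟩ hT
    rw [mem_trees] at hT
    have hd := degree_lt_size_node c
    refine ⟨⟨d, c⟩, ?_, rfl⟩
    simp only [Finset.mem_sigma, Finset.mem_range, Finset.mem_filter, Fintype.mem_piFinset,
      mem_treesLE]
    refine ⟨by omega, fun i => ?_, ?_⟩
    · have := size_lt_size_node c i
      omega
    · rw [size_node] at hT
      omega
  · intros; rfl

/-- Once all branches but the `i`-th are fixed, the total size determines the size `k` of that
branch, so it suffices to compare its weighted sums for each `k`. This takes the place of
conditioning on the branch sizes. -/
theorem forestSum_le_of_update (i : Fin d)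
    (h : ∀ c k, treeSum p k (fun t => A (Function.update c i t)) ≤
      treeSum p k fun t => B (Function.update c i t)) :
    forestSum p d n A ≤ forestSum p d n B := by
  classical
  cases d with
  | zero => exact i.elim0
  | succ d =>
    have key : ∀ A : (Fin (d + 1) → PlaneTree) → ℝ, forestSum p (d + 1) n A =
        ∑ c ∈ Fintype.piFinset fun _ : Fin d => treesLE n,
          if ∑ j, (c j).size ≤ n then (∏ j, wt p (c j)) *
            treeSum p (n - ∑ j, (c j).size) (fun t => A (i.insertNth t c)) else 0 := by
      intro A
      rw [forestSum]
      rw [← Finset.sum_bij (s := treesLE n ×ˢ Fintype.piFinset fun _ : Fin d => treesLE n)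
        (i := fun x _ => (i.insertNth x.1 x.2 : Fin (d + 1) → PlaneTree))
        (f := fun x => if x.1.size + ∑ j, (x.2 j).size = n then
          (wt p x.1 * ∏ j, wt p (x.2 j)) * A (i.insertNth x.1 x.2) else 0)]
      · rw [Finset.sum_product_right]
        refine Finset.sum_congr rfl fun c _ => ?_
        split_ifs with hc
        · rw [treeSum, Finset.mul_sum, ← Finset.sum_filter]
          refine Finset.sum_congr ?_ fun t _ => by ring
          ext t
          simp only [Finset.mem_filter, mem_treesLE, mem_trees]
          omega
        · refine Finset.sum_eq_zero fun t _ => if_neg ?_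
          simp only
          omega
      · rintro ⟨t, c⟩ h
        simp only [Finset.mem_product, Fintype.mem_piFinset] at h ⊢
        exact (Fin.forall_iff_succAbove i).2 (by simpa using h)
      · rintro ⟨t, c⟩ _ ⟨t', c'⟩ _ h
        simp only at h
        have h1 := congrFun h i
        have h2 : c = c' := by
          ext1 j
          have := congrFun h (i.succAbove j)
          simpa using this
        simp only [Fin.insertNth_apply_same] at h1
        rw [h1, h2]
      · intro c hc
        simp only [Fintype.mem_piFinset] at hc
        refine ⟨(c i, fun j => c (i.succAbove j)), ?_, ?_⟩
        · simp only [Finset.mem_product, Fintype.mem_piFinset]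
          exact ⟨hc i, fun j => hc _⟩
        · exact i.insertNth_self_removeNth c
      · rintro ⟨t, c⟩ _
        simp only [Fin.sum_univ_succAbove _ i, Fin.prod_univ_succAbove _ i,
          Fin.insertNth_apply_same, Fin.insertNth_apply_succAbove]
    rw [key A, key B]
    refine Finset.sum_le_sum fun c _ => ?_
    split_ifs
    · refine mul_le_mul_of_nonneg_left ?_ (Finset.prod_nonneg fun i _ => wt_nonneg _ _)
      -- The one-node tree only fills the slot that `Function.update` overwrites.
      have := h (i.insertNth (node 0 Fin.elim0) c) (n - ∑ j, (c j).size)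
      simpa only [Fin.update_insertNth] using this
    · rfl

theorem forestSum_eq_of_update (i : Fin d)
    (h : ∀ c k, treeSum p k (fun t => A (Function.update c i t)) =
      treeSum p k fun t => B (Function.update c i t)) :
    forestSum p d n A = forestSum p d n B :=
  le_antisymm (forestSum_le_of_update i fun c k => (h c k).le)
    (forestSum_le_of_update i fun c k => (h c k).ge)

end forestSum

/-! ### Moments of additive functionals with centred toll -/

section additive
variable {p : PMF ℕ} {f g h : PlaneTree → ℝ}

theorem treeSum_additive_succ (n : ℕ) : treeSum p (n + 1) (additive g) =
    treeSum p (n + 1) g + ∑ d ∈ Finset.range (n + 1),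
      (p d).toReal * ∑ i : Fin d, forestSum p d n fun c => additive g (c i) := by
  simp only [treeSum_succ, additive_node, forestSum_add, mul_add, Finset.sum_add_distrib,
    forestSum_finsetSum]

/-- The mean of an additive functional depends only on the conditional means of its toll. -/
theorem treeSum_additive_le (hgh : ∀ k, treeSum p k g ≤ treeSum p k h) (n : ℕ) :
    treeSum p n (additive g) ≤ treeSum p n (additive h) := by
  induction n using Nat.strong_induction_on with
  | _ n ih =>
    cases n with
    | zero => simp [treeSum_zero_size]
    | succ n =>
      -- `forestSum_le_of_update` asks for every `k`, the induction hypothesis gives `k ≤ n`.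
      -- Cutting the functional off above size `n` is harmless, since no branch is larger.
      have key : ∀ k, treeSum p k (fun t => if k ≤ n then additive g t else 0) ≤
          treeSum p k (fun t => if k ≤ n then additive h t else 0) := by
        intro k
        split_ifs with hk
        · exact ih k (by omega)
        · exact le_rfl
      rw [treeSum_additive_succ, treeSum_additive_succ]
      refine add_le_add (hgh _) (Finset.sum_le_sum fun d _ =>
        mul_le_mul_of_nonneg_left (Finset.sum_le_sum fun i _ => ?_) ENNReal.toReal_nonneg)
      have e : ∀ g : PlaneTree → ℝ, forestSum p d n (fun c => additive g (c i)) =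
          forestSum p d n (fun c => if (c i).size ≤ n then additive g (c i) else 0) := by
        intro g
        refine forestSum_congr fun c hc => (if_pos ?_).symm
        rw [← hc]
        exact Finset.single_le_sum (f := fun i => (c i).size) (fun _ _ => Nat.zero_le _)
          (Finset.mem_univ i)
      rw [e g, e h]
      refine forestSum_le_of_update i fun c k => ?_
      simp only [Function.update_self]
      refine le_trans (le_of_eq ?_) ((key k).trans (le_of_eq ?_)) <;>
      exact treeSum_congr fun T hT => by rw [hT]

theorem treeSum_additive_eq (hgh : ∀ k, treeSum p k g = treeSum p k h) (n : ℕ) :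
    treeSum p n (additive g) = treeSum p n (additive h) :=
  le_antisymm (treeSum_additive_le (fun k => (hgh k).le) n)
    (treeSum_additive_le (fun k => (hgh k).ge) n)

theorem additive_zero (T : PlaneTree) : additive (fun _ => 0) T = 0 := by simp [additive]

theorem additive_add (T : PlaneTree) :
    additive (fun T => g T + h T) T = additive g T + additive h T := by
  simp [additive, Finset.sum_add_distrib]

theorem treeSum_additive_of_centered (hg : ∀ k, treeSum p k g = 0) (n : ℕ) :
    treeSum p n (additive g) = 0 := by
  rw [treeSum_additive_eq (h := fun _ => 0) (fun k => by rw [hg, treeSum_zero])]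
  exact (treeSum_congr fun T _ => additive_zero T).trans treeSum_zero

/-- The second moment of a centred additive functional only involves pairs of nodes one of which
is a descendant of the other. -/
theorem treeSum_additive_sq_of_centered (hg : ∀ k, treeSum p k g = 0) (n : ℕ) :
    treeSum p n (fun T => additive g T ^ 2) =
      treeSum p n (additive fun T => 2 * (g T * additive g T) - g T ^ 2) := by
  induction n using Nat.strong_induction_on with
  | _ n ih =>
    cases n with
    | zero => simp [treeSum_zero_size]
    | succ n =>
      rw [treeSum_additive_succ]
      have e1 : treeSum p (n + 1) (fun T => additive g T ^ 2) =
          treeSum p (n + 1) (fun T => 2 * (g T * additive g T) - g T ^ 2) +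
            treeSum p (n + 1) (fun T => (additive g T - g T) ^ 2) := by
        rw [← treeSum_add]
        exact treeSum_congr fun T _ => by ring
      rw [e1, treeSum_succ p n (fun T => (additive g T - g T) ^ 2)]
      congr 1
      refine Finset.sum_congr rfl fun d _ => ?_
      congr 1
      have e2 : forestSum p d n (fun c => (additive g (node d c) - g (node d c)) ^ 2) =
          ∑ i : Fin d, ∑ j : Fin d, forestSum p d n fun c => additive g (c i) * additive g (c j) := by
        simp only [← forestSum_finsetSum]
        refine forestSum_congr fun c _ => ?_
        rw [additive_node, add_sub_cancel_left, sq, Finset.sum_mul_sum]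
      rw [e2]
      refine Finset.sum_congr rfl fun i _ => ?_
      -- Off the diagonal, branch `i` is centred given its size and the other branches; on it, the
      -- induction hypothesis applies.
      rw [Finset.sum_eq_single i]
      · have e : ∀ F : PlaneTree → ℝ, forestSum p d n (fun c => F (c i)) =
            forestSum p d n (fun c => if (c i).size ≤ n then F (c i) else 0) := by
          intro g
          refine forestSum_congr fun c hc => (if_pos ?_).symm
          rw [← hc]
          exact Finset.single_le_sum (f := fun i => (c i).size) (fun _ _ => Nat.zero_le _)
            (Finset.mem_univ i)
        rw [e (fun t => additive g t * additive g t), e]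
        refine forestSum_eq_of_update i fun c k => ?_
        simp only [Function.update_self]
        by_cases hk : k ≤ n
        · have := ih k (by omega)
          simp only [sq] at this
          refine Eq.trans (treeSum_congr fun T hT => ?_) (this.trans (treeSum_congr fun T hT => ?_))
          · rw [if_pos (by omega)]
          · rw [if_pos (by omega)]; simp only [sq]
        · exact treeSum_congr fun T hT => by rw [if_neg (by omega), if_neg (by omega)]
      · intro j _ hji
        have h0 : forestSum p d n (fun c => additive g (c i) * additive g (c j)) =
            forestSum p d n fun _ => 0 := by
          refine forestSum_eq_of_update i fun c k => ?_
          simp only [Function.update_self, Function.update_of_ne hji]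
          rw [treeSum_mul_const, treeSum_additive_of_centered hg, zero_mul, treeSum_zero]
        rw [h0]
        simp [forestSum]
      · simp

/-- The contribution to the additive functional with toll `g` of the nodes at depth less
than `M`. -/
noncomputable def additiveLT (g : PlaneTree → ℝ) : ℕ → PlaneTree → ℝ
  | 0, _ => 0
  | M + 1, node d c => g (node d c) + ∑ i, additiveLT g M (c i)

/-- Going down to a branch, with its siblings frozen, uses up one level of the cut-off; this drives
the induction on `M`. -/
theorem isWeaklyLocal_branch {M d : ℕ} (hh : IsWeaklyLocal h (M + 1)) (c : Fin d → PlaneTree)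
    (i : Fin d) : IsWeaklyLocal (fun t => h (node d (Function.update c i t))) M := by
  intro T T' h1 h2
  refine hh _ _ ?_ ?_
  · rw [size_node, size_node]
    congr 1
    refine Finset.sum_congr rfl fun j _ => ?_
    by_cases hj : j = i
    · subst hj; simpa using h1
    · simp [Function.update_of_ne hj]
  · simp only [trunc]
    congr 1
    funext j
    by_cases hj : j = i
    · subst hj; simpa using h2
    · simp [Function.update_of_ne hj]

/-- Against a weakly local functional with cut-off `M`, only the nodes at depth less than `M`
of a centred additive functional count. -/
theorem treeSum_mul_additive_of_isWeaklyLocal (hg : ∀ k, treeSum p k g = 0) (M : ℕ) :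
    ∀ (h : PlaneTree → ℝ), IsWeaklyLocal h M → ∀ n,
    treeSum p n (fun T => h T * additive g T) = treeSum p n fun T => h T * additiveLT g M T := by
  induction M with
  | zero =>
    intro h hh n
    -- All trees truncated at height `0` coincide, so `h` is a function of the size alone.
    have h0 : ∃ a, ∀ T : PlaneTree, T.size = n → h T = a := by
      by_cases hex : ∃ T : PlaneTree, T.size = n
      · obtain ⟨T0, hT0⟩ := hex
        exact ⟨h T0, fun T hT => hh T T0 (hT.trans hT0.symm) rfl⟩
      · exact ⟨0, fun T hT => (hex ⟨T, hT⟩).elim⟩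
    obtain ⟨a, ha⟩ := h0
    rw [treeSum_congr (Ψ := fun T => a * additive g T) (fun T hT => by rw [ha T hT]),
      treeSum_const_mul, treeSum_additive_of_centered hg]
    simp [additiveLT, treeSum_zero]
  | succ M ih =>
    intro h hh n
    cases n with
    | zero => simp [treeSum_zero_size]
    | succ n =>
      rw [treeSum_succ, treeSum_succ]
      refine Finset.sum_congr rfl fun d _ => ?_
      congr 1
      simp only [additive_node, additiveLT, mul_add, forestSum_add, Finset.mul_sum,
        forestSum_finsetSum]
      congr 1
      refine Finset.sum_congr rfl fun i _ => ?_
      refine forestSum_eq_of_update i fun c k => ?_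
      simp only [Function.update_self]
      exact ih _ (isWeaklyLocal_branch hh c i) k

theorem wt_branch_pos {d : ℕ} {c : Fin d → PlaneTree} (h : 0 < wt p (node d c)) (i : Fin d) :
    0 < wt p (c i) := by
  refine (wt_nonneg p _).lt_of_ne fun h0 => ?_
  rw [wt_node, Finset.prod_eq_zero (Finset.mem_univ i) h0.symm, mul_zero] at h
  exact lt_irrefl _ h

theorem abs_additiveLT_le {a : ℝ} (hg : ∀ T, 0 < wt p T → |g T| ≤ a) (M : ℕ) (T : PlaneTree)
    (hT : 0 < wt p T) : |additiveLT g M T| ≤ a * additiveLT (fun _ => 1) M T := by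
  induction M generalizing T with
  | zero => simp [additiveLT]
  | succ M ih =>
    cases T with
    | node d c =>
      simp only [additiveLT, mul_add, mul_one, Finset.mul_sum]
      refine (abs_add_le _ _).trans (add_le_add (hg _ hT) ?_)
      exact (Finset.abs_sum_le_sum_abs _ _).trans
        (Finset.sum_le_sum fun i _ => ih _ (wt_branch_pos hT i))

/-- If the root degree of conditioned trees has bounded mean, then so has the number of nodes at
depth less than `M`. -/
theorem exists_treeSum_additiveLT_one_le {K : ℝ} (hK0 : 0 ≤ K)
    (hK : ∀ n, treeSum p n (fun T => (T.rootDegree : ℝ)) ≤ K * treeSum p n fun _ => 1) (M : ℕ) :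
    ∃ C : ℝ, 0 ≤ C ∧ ∀ n, treeSum p n (additiveLT (fun _ => 1) M) ≤
      C * treeSum p n fun _ => 1 := by
  induction M with
  | zero => exact ⟨0, le_rfl, fun n => by simp [additiveLT, treeSum_zero]⟩
  | succ M ih =>
    obtain ⟨C, hC0, hC⟩ := ih
    refine ⟨1 + C * K, by positivity, fun n => ?_⟩
    cases n with
    | zero => simp [treeSum_zero_size]
    | succ n =>
      have h1 : treeSum p (n + 1) (additiveLT (fun _ => 1) (M + 1)) ≤
          treeSum p (n + 1) fun T => 1 + C * T.rootDegree := by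
        rw [treeSum_succ, treeSum_succ]
        refine Finset.sum_le_sum fun d _ =>
          mul_le_mul_of_nonneg_left ?_ ENNReal.toReal_nonneg
        have h2 : forestSum p d n (fun c => 1 + C * ((node d c).rootDegree : ℝ)) =
            forestSum p d n fun _ => 1 + ∑ _i : Fin d, C :=
          forestSum_congr fun c _ => by simp [rootDegree, mul_comm]
        rw [h2]
        simp only [additiveLT, forestSum_add, forestSum_finsetSum]
        refine add_le_add le_rfl (Finset.sum_le_sum fun i _ => ?_)
        refine forestSum_le_of_update i fun c k => ?_
        simp only [Function.update_self]
        exact (hC k).trans_eq (treeSum_const C).symm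
      refine h1.trans ?_
      rw [treeSum_add, treeSum_const_mul, add_mul, one_mul, mul_assoc]
      exact add_le_add le_rfl (mul_le_mul_of_nonneg_left (hK _) hC0)

end additive

end PlaneTree

/-! ### Depth-first words and the cycle lemma -/

namespace PlaneTree

/-- The outdegrees of the nodes of a tree in depth-first order. -/
def word : PlaneTree → List ℕ
  | node d c => d :: (List.ofFn fun i => word (c i)).flatten

theorem word_node (d : ℕ) (c : Fin d → PlaneTree) :
    word (node d c) = d :: ((List.ofFn c).map word).flatten := by
  rw [word, List.map_ofFn]; rfl

/-- `pass d l` is the number of letters of `l` needed to read off `d` trees in depth-first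
order, if `l` is long enough. -/
def pass : ℕ → List ℕ → Option ℕ
  | 0, _ => some 0
  | _ + 1, [] => none
  | d + 1, a :: l => (pass (d + a) l).map (· + 1)

@[simp] theorem pass_zero (l : List ℕ) : pass 0 l = some 0 := by cases l <;> rfl
@[simp] theorem pass_succ_nil (d : ℕ) : pass (d + 1) [] = none := rfl

theorem pass_succ_cons (d a : ℕ) (l : List ℕ) :
    pass (d + 1) (a :: l) = (pass (d + a) l).map (· + 1) := rfl

/-- `pass d l` is a first passage time: the walk that starts at `d` and steps by `a - 1` for each
letter `a` reaches zero at time `k` and is positive before. -/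
theorem pass_spec {d k : ℕ} {l : List ℕ} (h : pass d l = some k) :
    k ≤ l.length ∧ (l.take k).sum + d = k ∧ ∀ i < k, i < (l.take i).sum + d := by
  induction l generalizing d k with
  | nil =>
    cases d with
    | zero => simp at h; subst h; simp
    | succ d => simp at h
  | cons a l ih =>
    cases d with
    | zero => simp at h; subst h; simp
    | succ d =>
      rw [pass_succ_cons, Option.map_eq_some_iff] at h
      obtain ⟨k, hk, rfl⟩ := h
      obtain ⟨h1, h2, h3⟩ := ih hk
      refine ⟨by simpa using h1, by simp; omega, fun i hi => ?_⟩
      cases i with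
      | zero => simp
      | succ i =>
        have := h3 i (by omega)
        simp; omega

theorem pass_append_of_some {d k : ℕ} {u : List ℕ} (v : List ℕ) (h : pass d u = some k) :
    pass d (u ++ v) = some k := by
  induction u generalizing d k with
  | nil =>
    cases d with
    | zero => simpa using h
    | succ d => simp at h
  | cons a u ih =>
    cases d with
    | zero => simpa using h
    | succ d =>
      rw [pass_succ_cons, Option.map_eq_some_iff] at h
      obtain ⟨k, hk, rfl⟩ := h
      rw [List.cons_append, pass_succ_cons, ih hk]
      rfl

theorem pass_of_append {d k : ℕ} {u v : List ℕ} (h : pass d (u ++ v) = some k)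
    (hk : k ≤ u.length) : pass d u = some k := by
  induction u generalizing d k with
  | nil =>
    obtain rfl : k = 0 := by simpa using hk
    have := (pass_spec h).2.1
    simp at this
    subst this
    simp
  | cons a u ih =>
    cases d with
    | zero => simpa using h
    | succ d =>
      rw [List.cons_append, pass_succ_cons, Option.map_eq_some_iff] at h
      obtain ⟨k, hk', rfl⟩ := h
      rw [pass_succ_cons, ih hk' (by simpa using hk)]
      rfl

theorem pass_append_iff {d : ℕ} {u v : List ℕ} :
    pass d (u ++ v) = some u.length ↔ pass d u = some u.length :=
  ⟨fun h => pass_of_append h le_rfl, pass_append_of_some v⟩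

theorem pass_exists_of_le {d e k : ℕ} {l : List ℕ} (h : pass e l = some k) (hde : d ≤ e) :
    ∃ j, pass d l = some j := by
  induction l generalizing d e k with
  | nil =>
    cases e with
    | zero => exact ⟨0, by simp [Nat.le_zero.1 hde]⟩
    | succ e => simp at h
  | cons a l ih =>
    cases d with
    | zero => exact ⟨0, by simp⟩
    | succ d =>
      cases e with
      | zero => omega
      | succ e =>
        rw [pass_succ_cons, Option.map_eq_some_iff] at h
        obtain ⟨k, hk, rfl⟩ := h
        obtain ⟨j, hj⟩ := ih hk (show d + a ≤ e + a by omega)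
        exact ⟨j + 1, by rw [pass_succ_cons, hj]; rfl⟩

/-- In a word that consists of complete trees, every letter starts a complete tree. -/
theorem pass_drop_of_pass {d c : ℕ} {l : List ℕ} (h : pass d l = some l.length)
    (hc : c < l.length) : ∃ j, pass 1 (l.drop c) = some j := by
  induction l generalizing d c with
  | nil => simp at hc
  | cons a l ih =>
    cases d with
    | zero => simp at h
    | succ d =>
      cases c with
      | zero => exact pass_exists_of_le h (by omega)
      | succ c =>
        rw [pass_succ_cons, Option.map_eq_some_iff] at h
        obtain ⟨k, hk, hk'⟩ := h
        obtain rfl : k = l.length := by simpa using hk'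
        exact ih hk (by simpa using hc)

theorem pass_forest_append (ts : List PlaneTree)
    (h : ∀ T ∈ ts, ∀ d l, pass (d + 1) (word T ++ l) = (pass d l).map (· + T.size))
    (d : ℕ) (l : List ℕ) : pass (d + ts.length) ((ts.map word).flatten ++ l) =
      (pass d l).map (· + (ts.map size).sum) := by
  induction ts with
  | nil => simp
  | cons T ts ih =>
    rw [List.map_cons, List.flatten_cons, List.append_assoc, List.length_cons, ← add_assoc,
      h T (by simp), ih fun T hT => h T (by simp [hT])]
    simp only [Option.map_map, List.map_cons, List.sum_cons]
    congr 1
    funext x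
    simp only [Function.comp]
    ring

theorem pass_word_append (T : PlaneTree) (d : ℕ) (l : List ℕ) :
    pass (d + 1) (word T ++ l) = (pass d l).map (· + T.size) := by
  induction T generalizing d l with
  | node a c ih =>
    have := pass_forest_append (List.ofFn c) (fun T hT => by
      obtain ⟨i, rfl⟩ := List.mem_ofFn.1 hT
      exact ih i) d l
    rw [List.length_ofFn] at this
    rw [word_node, List.cons_append, pass_succ_cons, this, Option.map_map, size_node,
      List.map_ofFn, List.sum_ofFn]
    congr 1
    funext x
    simp only [Function.comp]
    ring

theorem pass_one_word_append (T : PlaneTree) (l : List ℕ) :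
    pass 1 (word T ++ l) = some T.size := by
  simpa using pass_word_append T 0 l

theorem pass_one_word (T : PlaneTree) : pass 1 (word T) = some T.size := by
  simpa using pass_one_word_append T []

@[simp] theorem length_word (T : PlaneTree) : (word T).length = T.size := by
  induction T with
  | node d c ih =>
    rw [word_node, size_node, List.length_cons, List.length_flatten, List.map_map, List.map_ofFn,
      List.sum_ofFn, add_comm]
    congr 1
    exact Finset.sum_congr rfl fun i _ => ih i

theorem sum_word (T : PlaneTree) : (word T).sum + 1 = T.size := by
  have := (pass_spec (pass_one_word T)).2.1
  rwa [List.take_of_length_le (by simp)] at this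

theorem word_append_inj_left {T T' : PlaneTree} {l l' : List ℕ}
    (h : word T ++ l = word T' ++ l') : word T = word T' ∧ l = l' := by
  have h1 := pass_one_word_append T l
  rw [h, pass_one_word_append, Option.some_inj] at h1
  exact List.append_inj h (by simp [h1])

theorem word_injective : Function.Injective word := by
  intro T
  induction T with
  | node d c ih =>
    have key : ∀ ts ts' : List PlaneTree, (∀ T ∈ ts, ∀ T', word T = word T' → T = T') →
        ts.length = ts'.length → (ts.map word).flatten = (ts'.map word).flatten → ts = ts' := by
      intro ts
      induction ts with
      | nil => intro ts' _ hl _; simpa using hl.symm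
      | cons T ts ih =>
        intro ts' h hl hw
        cases ts' with
        | nil => simp at hl
        | cons T' ts' =>
          simp only [List.map_cons, List.flatten_cons] at hw
          obtain ⟨h1, h2⟩ := word_append_inj_left hw
          rw [h T (by simp) T' h1, ih ts' (fun T hT => h T (by simp [hT])) (by simpa using hl) h2]
    rintro ⟨d', c'⟩ h
    rw [word_node, word_node, List.cons.injEq] at h
    obtain ⟨rfl, h⟩ := h
    have := key (List.ofFn c) (List.ofFn c') (fun T hT T' hTT' => by
      obtain ⟨i, rfl⟩ := List.mem_ofFn.1 hT
      exact ih i hTT') (by simp) h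
    rw [List.ofFn_inj.1 this]

/-- By induction the letters after the first letter `a` split into trees; the first `a` of them
become the branches of the first tree. -/
theorem exists_forest_of_pass {d : ℕ} {u : List ℕ} (h : pass d u = some u.length) :
    ∃ ts : List PlaneTree, ts.length = d ∧ (ts.map word).flatten = u := by
  induction u generalizing d with
  | nil =>
    cases d with
    | zero => exact ⟨[], rfl, rfl⟩
    | succ d => simp at h
  | cons a l ih =>
    cases d with
    | zero => simp at h
    | succ d =>
      rw [pass_succ_cons, Option.map_eq_some_iff] at h
      obtain ⟨k, hk, hk'⟩ := h
      obtain rfl : k = l.length := by simpa using hk'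
      obtain ⟨ts, h1, h2⟩ := ih hk
      refine ⟨node a (fun i => ts[(i : ℕ)]) :: ts.drop a, by simp [h1], ?_⟩
      have : List.ofFn (fun i : Fin a => ts[(i : ℕ)]) = ts.take a := by
        apply List.ext_getElem
        · simp; omega
        · intro i _ _
          simp
      rw [List.map_cons, word_node, this, List.flatten_cons, List.cons_append,
        ← List.flatten_append, ← List.map_append, List.take_append_drop, h2]

theorem exists_word_eq {u : List ℕ} (h : pass 1 u = some u.length) : ∃ T, word T = u := by
  obtain ⟨ts, h1, h2⟩ := exists_forest_of_pass h
  obtain ⟨T, rfl⟩ := List.length_eq_one_iff.1 h1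
  exact ⟨T, by simpa using h2⟩

/-- Two different rotations of a word are not both words of trees. -/
theorem word_rotate_inj {T T' : PlaneTree} {c c' : ℕ} (hc : c < T.size) (hc' : c' < T'.size)
    (h : (word T).rotate c = (word T').rotate c') : T = T' ∧ c = c' := by
  wlog hcc : c ≤ c' generalizing T T' c c'
  · obtain ⟨h1, h2⟩ := this hc' hc h.symm (by omega)
    exact ⟨h1.symm, h2.symm⟩
  obtain ⟨e, rfl⟩ := Nat.exists_eq_add_of_le' hcc
  rw [← List.rotate_rotate, List.rotate_eq_rotate] at h
  rcases Nat.eq_zero_or_pos e with rfl | he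
  · rw [List.rotate_zero] at h
    exact ⟨word_injective h, by simp⟩
  -- The first `e` letters of `word T'` are a proper prefix, so they sum to at least `e`. The other
  -- `T'.size - e` letters are a proper prefix of `word T`, so they sum to at least their number.
  -- But `word T'` sums to `T'.size - 1`.
  exfalso
  rw [List.rotate_eq_drop_append_take (by simp; omega)] at h
  have h1 := (pass_spec (pass_one_word T')).2.2 e (by omega)
  have h2 := (pass_spec (pass_one_word T)).2.2 (T'.size - e) (by
    rw [← length_word T, h]; simp; omega)
  rw [h, List.take_left' (by simp)] at h2
  have h3 := sum_word T'
  rw [← List.take_append_drop e (word T'), List.sum_append] at h3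
  omega

/-! ### Sequences of independent letters -/

/-- The expectation of a function of `n` independent letters with law `p`. -/
noncomputable def iidMean (p : PMF ℕ) : ℕ → (List ℕ → ℝ) → ℝ
  | 0, Φ => Φ []
  | n + 1, Φ => ∫ a, iidMean p n (fun l => Φ (a :: l)) ∂p.toMeasure

section iidMean
variable {p : PMF ℕ} {n : ℕ} {Φ Ψ : List ℕ → ℝ}

/-- `Φ` is bounded on the lists of length `n`. -/
def BddOn (n : ℕ) (Φ : List ℕ → ℝ) : Prop := ∃ B, ∀ l : List ℕ, l.length = n → |Φ l| ≤ B

theorem BddOn.cons (h : BddOn (n + 1) Φ) (a : ℕ) : BddOn n fun l => Φ (a :: l) := by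
  obtain ⟨B, hB⟩ := h
  exact ⟨B, fun l hl => hB _ (by simp [hl])⟩

theorem BddOn.add (h : BddOn n Φ) (h' : BddOn n Ψ) : BddOn n fun l => Φ l + Ψ l := by
  obtain ⟨B, hB⟩ := h
  obtain ⟨B', hB'⟩ := h'
  exact ⟨B + B', fun l hl => (abs_add_le _ _).trans (add_le_add (hB l hl) (hB' l hl))⟩

theorem BddOn.mul (h : BddOn n Φ) (h' : BddOn n Ψ) : BddOn n fun l => Φ l * Ψ l := by
  obtain ⟨B, hB⟩ := h
  obtain ⟨B', hB'⟩ := h'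
  refine ⟨B * B', fun l hl => ?_⟩
  rw [abs_mul]
  exact mul_le_mul (hB l hl) (hB' l hl) (abs_nonneg _) ((abs_nonneg _).trans (hB l hl))

theorem bddOn_const (c : ℝ) : BddOn n fun _ => c := ⟨|c|, fun _ _ => le_rfl⟩

theorem BddOn.sub (h : BddOn n Φ) (h' : BddOn n Ψ) : BddOn n fun l => Φ l - Ψ l := by
  have := h.add ((bddOn_const (-1)).mul h')
  simpa [sub_eq_add_neg] using this

theorem BddOn.pow_two (h : BddOn n Φ) : BddOn n fun l => Φ l ^ 2 := by
  simp only [sq]; exact h.mul h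

theorem BddOn.ite (P : List ℕ → Prop) [DecidablePred P] (h : BddOn n Φ) (h' : BddOn n Ψ) :
    BddOn n fun l => if P l then Φ l else Ψ l := by
  obtain ⟨B, hB⟩ := h
  obtain ⟨B', hB'⟩ := h'
  refine ⟨max B B', fun l hl => ?_⟩
  dsimp only
  split_ifs
  · exact (hB l hl).trans (le_max_left _ _)
  · exact (hB' l hl).trans (le_max_right _ _)

theorem BddOn.finsetSum {ι : Type*} (s : Finset ι) {Φ : ι → List ℕ → ℝ}
    (h : ∀ i ∈ s, BddOn n (Φ i)) : BddOn n fun l => ∑ i ∈ s, Φ i l := by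
  classical
  induction s using Finset.induction_on with
  | empty => simpa using bddOn_const 0
  | insert a s ha ih =>
    simp only [Finset.sum_insert ha]
    exact (h a (by simp)).add (ih fun i hi => h i (by simp [hi]))

theorem iidMean_congr (h : ∀ l : List ℕ, l.length = n → Φ l = Ψ l) :
    iidMean p n Φ = iidMean p n Ψ := by
  induction n generalizing Φ Ψ with
  | zero => exact h [] rfl
  | succ n ih =>
    exact integral_congr_ae (.of_forall fun a => ih fun l hl => h _ (by simp [hl]))

theorem abs_iidMean_le {B : ℝ} (h : ∀ l : List ℕ, l.length = n → |Φ l| ≤ B) :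
    |iidMean p n Φ| ≤ B := by
  induction n generalizing Φ with
  | zero => exact h [] rfl
  | succ n ih =>
    have := norm_integral_le_of_norm_le_const (μ := p.toMeasure)
      (f := fun a => iidMean p n (fun l => Φ (a :: l))) (C := B)
      (.of_forall fun a => ih fun l hl => h _ (by simp [hl]))
    simpa [iidMean] using this

theorem integrable_of_abs_le {f : ℕ → ℝ} (B : ℝ) (h : ∀ a, |f a| ≤ B) :
    Integrable f p.toMeasure :=
  Integrable.of_bound (by fun_prop) B (.of_forall h)

theorem integrable_iidMean_cons (h : BddOn (n + 1) Φ) :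
    Integrable (fun a => iidMean p n fun l => Φ (a :: l)) p.toMeasure := by
  obtain ⟨B, hB⟩ := h
  exact integrable_of_abs_le B fun a => abs_iidMean_le fun l hl => hB _ (by simp [hl])

theorem iidMean_add (h : BddOn n Φ) (h' : BddOn n Ψ) :
    iidMean p n (fun l => Φ l + Ψ l) = iidMean p n Φ + iidMean p n Ψ := by
  induction n generalizing Φ Ψ with
  | zero => rfl
  | succ n ih =>
    simp only [iidMean]
    rw [← integral_add (integrable_iidMean_cons h) (integrable_iidMean_cons h')]
    exact integral_congr_ae (.of_forall fun a => ih (h.cons a) (h'.cons a))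

theorem iidMean_const_mul (c : ℝ) : iidMean p n (fun l => c * Φ l) = c * iidMean p n Φ := by
  induction n generalizing Φ with
  | zero => rfl
  | succ n ih =>
    simp only [iidMean, ih]
    exact integral_const_mul _ _

theorem iidMean_mul_const (c : ℝ) : iidMean p n (fun l => Φ l * c) = iidMean p n Φ * c := by
  simp only [mul_comm _ c]; exact iidMean_const_mul c

theorem iidMean_sub (h : BddOn n Φ) (h' : BddOn n Ψ) :
    iidMean p n (fun l => Φ l - Ψ l) = iidMean p n Φ - iidMean p n Ψ := by
  have := iidMean_add (p := p) h ((bddOn_const (-1)).mul h')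
  rw [iidMean_const_mul] at this
  simpa [sub_eq_add_neg] using this

theorem iidMean_const (c : ℝ) : iidMean p n (fun _ => c) = c := by
  induction n with
  | zero => rfl
  | succ n ih => simp [iidMean, ih]

theorem iidMean_finsetSum {ι : Type*} (s : Finset ι) {Φ : ι → List ℕ → ℝ}
    (h : ∀ i ∈ s, BddOn n (Φ i)) :
    iidMean p n (fun l => ∑ i ∈ s, Φ i l) = ∑ i ∈ s, iidMean p n (Φ i) := by
  classical
  induction s using Finset.induction_on with
  | empty => simpa using iidMean_const 0
  | insert a s ha ih =>
    simp only [Finset.sum_insert ha]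
    rw [iidMean_add (h a (by simp)) (BddOn.finsetSum s fun i hi => h i (by simp [hi])),
      ih fun i hi => h i (by simp [hi])]

theorem iidMean_nonneg (h : ∀ l : List ℕ, l.length = n → 0 ≤ Φ l) : 0 ≤ iidMean p n Φ := by
  induction n generalizing Φ with
  | zero => exact h [] rfl
  | succ n ih => exact integral_nonneg fun a => ih fun l hl => h _ (by simp [hl])

theorem iidMean_mono (h : BddOn n Φ) (h' : BddOn n Ψ)
    (hle : ∀ l : List ℕ, l.length = n → Φ l ≤ Ψ l) : iidMean p n Φ ≤ iidMean p n Ψ := by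
  rw [← sub_nonneg, ← iidMean_sub h' h]
  exact iidMean_nonneg fun l hl => sub_nonneg.2 (hle l hl)

theorem iidMean_append (m n : ℕ) (Φ : List ℕ → ℝ) :
    iidMean p (m + n) Φ = iidMean p m fun u => iidMean p n fun v => Φ (u ++ v) := by
  induction m generalizing Φ with
  | zero => simp [iidMean]
  | succ m ih =>
    rw [Nat.add_right_comm]
    simp only [iidMean, ih, List.cons_append]

/-- The probability of a word. -/
noncomputable def wordWt (p : PMF ℕ) (l : List ℕ) : ℝ := (l.map fun a => (p a).toReal).prod

theorem integral_ite_eq (b : ℕ) (c : ℝ) :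
    ∫ a, (if a = b then c else 0) ∂p.toMeasure = (p b).toReal * c := by
  rw [PMF.integral_eq_tsum _ _ (integrable_of_abs_le |c| fun a => by split_ifs <;> simp),
    tsum_eq_single b]
  · simp
  · intro a ha; simp [ha]

theorem iidMean_ite_eq (x : List ℕ) :
    iidMean p x.length (fun l => if l = x then 1 else 0) = wordWt p x := by
  induction x with
  | nil => simp [iidMean, wordWt]
  | cons b x ih =>
    rw [List.length_cons, iidMean]
    have : ∀ a, iidMean p x.length (fun l => if a :: l = b :: x then (1 : ℝ) else 0) =
        if a = b then wordWt p x else 0 := by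
      intro a
      split_ifs with hab
      · subst hab; simpa using ih
      · simpa [hab] using iidMean_const 0
    simp only [this]
    rw [integral_ite_eq]
    simp [wordWt]

theorem wt_eq_wordWt (p : PMF ℕ) (T : PlaneTree) : wt p T = wordWt p (word T) := by
  induction T with
  | node d c ih =>
    have : ∀ L : List (List ℕ), wordWt p L.flatten = (L.map (wordWt p)).prod := by
      intro L
      induction L with
      | nil => simp [wordWt]
      | cons x L ihL =>
        rw [List.flatten_cons, List.map_cons, List.prod_cons, ← ihL]
        simp [wordWt]
    rw [wt_node, word]
    rw [show ∀ l, wordWt p (d :: l) = (p d).toReal * wordWt p l from fun l => by simp [wordWt],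
      this, List.map_ofFn, List.prod_ofFn]
    simp [ih, Function.comp]

theorem wordWt_rotate (l : List ℕ) (c : ℕ) : wordWt p (l.rotate c) = wordWt p l := by
  unfold wordWt
  exact (((List.rotate_perm l c).map _).prod_eq)

/-- A Galton–Watson tree is read off from independent letters. -/
theorem iidMean_pass_eq_treeSum (k : ℕ) (Φ : List ℕ → ℝ) :
    iidMean p k (fun u => if pass 1 u = some k then Φ u else 0) =
      treeSum p k fun T => Φ (word T) := by
  classical
  have h1 : ∀ u : List ℕ, u.length = k → (if pass 1 u = some k then Φ u else 0) =
      ∑ T ∈ trees k, Φ (word T) * (if u = word T then 1 else 0) := by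
    rintro u rfl
    split_ifs with h
    · obtain ⟨T, rfl⟩ := exists_word_eq h
      rw [Finset.sum_eq_single T]
      · simp
      · intro T' _ hT'
        rw [if_neg fun h => hT' (word_injective h.symm), mul_zero]
      · simp
    · symm
      refine Finset.sum_eq_zero fun T hT => ?_
      rw [if_neg, mul_zero]
      rintro rfl
      exact h (by simp [pass_one_word])
  rw [iidMean_congr h1, iidMean_finsetSum]
  · refine Finset.sum_congr rfl fun T hT => ?_
    rw [iidMean_const_mul, wt_eq_wordWt, ← iidMean_ite_eq, length_word, mem_trees.1 hT, mul_comm]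
  · exact fun T _ => (bddOn_const _).mul (.ite _ (bddOn_const _) (bddOn_const _))

/-- Uniformly rotated words of trees are dominated by independent letters conditioned on their
sum. -/
theorem treeSum_rotate_le (hΨ : BddOn n Ψ) (h0 : ∀ l : List ℕ, l.length = n → 0 ≤ Ψ l) :
    treeSum p n (fun T => ∑ c ∈ Finset.range n, Ψ ((word T).rotate c)) ≤
      iidMean p n fun l => if l.sum + 1 = n then Ψ l else 0 := by
  classical
  have hb : ∀ x : PlaneTree × ℕ, BddOn n fun l => Ψ ((word x.1).rotate x.2) *
      (if l = (word x.1).rotate x.2 then 1 else 0) := fun x =>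
    (bddOn_const _).mul (.ite _ (bddOn_const _) (bddOn_const _))
  -- Each pair `(T, c)` contributes the indicator of one word. By `word_rotate_inj` no word is hit
  -- twice, and each word hit has letter sum `n - 1`. That all such words are hit is not needed for
  -- an upper bound.
  have h1 : treeSum p n (fun T => ∑ c ∈ Finset.range n, Ψ ((word T).rotate c)) =
      iidMean p n fun l => ∑ x ∈ trees n ×ˢ Finset.range n, Ψ ((word x.1).rotate x.2) *
      (if l = (word x.1).rotate x.2 then 1 else 0) := by
    rw [iidMean_finsetSum _ fun x _ => hb x, treeSum, Finset.sum_product]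
    refine Finset.sum_congr rfl fun T hT => ?_
    rw [Finset.mul_sum]
    refine Finset.sum_congr rfl fun c _ => ?_
    have : n = ((word T).rotate c).length := by simp [mem_trees.1 hT]
    rw [iidMean_const_mul, wt_eq_wordWt, ← wordWt_rotate _ c, ← iidMean_ite_eq, ← this, mul_comm]
  rw [h1]
  refine iidMean_mono (.finsetSum _ fun x _ => hb x) (.ite _ hΨ (bddOn_const 0)) fun l hl => ?_
  by_cases hx : ∃ x ∈ trees n ×ˢ Finset.range n, l = (word x.1).rotate x.2
  · obtain ⟨⟨T, c⟩, hx, rfl⟩ := hx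
    simp only [Finset.mem_product, mem_trees, Finset.mem_range] at hx
    rw [Finset.sum_eq_single (T, c)]
    · rw [if_pos rfl, mul_one, if_pos]
      rw [(List.rotate_perm _ _).sum_eq, sum_word, hx.1]
    · rintro ⟨T', c'⟩ hx' hne
      simp only [Finset.mem_product, mem_trees, Finset.mem_range] at hx'
      rw [if_neg, mul_zero]
      intro h
      obtain ⟨rfl, rfl⟩ := word_rotate_inj (T := T) (T' := T') (by omega) (by omega) h
      exact hne rfl
    · simp [hx]
  · rw [Finset.sum_eq_zero]
    · split_ifs
      · exact h0 l hl
      · exact le_rfl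
    · intro x hx'
      rw [if_neg fun h => hx ⟨x, hx', h⟩, mul_zero]

end iidMean

end PlaneTree

/-! ### Sums of independent letters and the Otter–Dwass formula -/

namespace PlaneTree

section sums
variable {p : PMF ℕ}

/-- The probability that the sum of `n` independent letters equals `j`. -/
noncomputable def sumProb (p : PMF ℕ) (n : ℕ) (j : ℤ) : ℝ :=
  iidMean p n fun l => if (l.sum : ℤ) = j then 1 else 0

/-- The probability that `n` independent letters are the outdegrees of `d` trees. -/
noncomputable def forestProb (p : PMF ℕ) (d n : ℕ) : ℝ :=
  iidMean p n fun l => if pass d l = some n then 1 else 0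

theorem bddOn_ite_one (n : ℕ) (P : List ℕ → Prop) [DecidablePred P] :
    BddOn n fun l => if P l then (1 : ℝ) else 0 := .ite _ (bddOn_const _) (bddOn_const _)

theorem sumProb_nonneg (n : ℕ) (j : ℤ) : 0 ≤ sumProb p n j :=
  iidMean_nonneg fun l _ => by split_ifs <;> norm_num

theorem sumProb_le_one (n : ℕ) (j : ℤ) : sumProb p n j ≤ 1 :=
  (le_abs_self _).trans (abs_iidMean_le fun l _ => by split_ifs <;> norm_num)

theorem abs_sumProb_le_one (n : ℕ) (j : ℤ) : |sumProb p n j| ≤ 1 := by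
  rw [abs_of_nonneg (sumProb_nonneg n j)]; exact sumProb_le_one n j

theorem sumProb_zero (j : ℤ) : sumProb p 0 j = if j = 0 then 1 else 0 := by
  simp [sumProb, iidMean, eq_comm]

theorem sumProb_succ (n : ℕ) (j : ℤ) :
    sumProb p (n + 1) j = ∫ a : ℕ, sumProb p n (j - a) ∂p.toMeasure := by
  rw [sumProb, iidMean]
  refine integral_congr_ae (.of_forall fun a => iidMean_congr fun l _ => ?_)
  simp only [List.sum_cons, Nat.cast_add]
  congr 1
  rw [eq_iff_iff]
  omega

theorem integrable_mul_sumProb (hp : Integrable (fun a : ℕ => (a : ℝ)) p.toMeasure) (n : ℕ)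
    (g : ℕ → ℤ) : Integrable (fun a : ℕ => (a : ℝ) * sumProb p n (g a)) p.toMeasure :=
  hp.mono (by fun_prop) (.of_forall fun a => by
    rw [norm_mul]
    exact mul_le_of_le_one_right (norm_nonneg _) (abs_sumProb_le_one _ _))

/-- Given their sum, the mean of one of `n + 1` independent letters is the average. -/
theorem mul_sumProb_succ (hp : Integrable (fun a : ℕ => (a : ℝ)) p.toMeasure) (n : ℕ) (j : ℤ) :
    (j : ℝ) * sumProb p (n + 1) j =
      (n + 1) * ∫ a : ℕ, (a : ℝ) * sumProb p n (j - a) ∂p.toMeasure := by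
  induction n generalizing j with
  | zero =>
    rw [sumProb_succ, ← integral_const_mul]
    simp only [sumProb_zero, Nat.cast_zero, zero_add, one_mul]
    refine integral_congr_ae (.of_forall fun a => ?_)
    dsimp only
    split_ifs with h
    · have : j = a := by omega
      simp [this]
    · simp
  | succ n ih =>
    have hi : ∀ m (g : ℕ → ℤ), Integrable (fun a : ℕ => sumProb p m (g a)) p.toMeasure :=
      fun m g => integrable_of_abs_le 1 fun a => abs_sumProb_le_one _ _
    -- Write `j = a + (j - a)` with `a` the first letter. The induction hypothesis handles `j - a`
    -- by singling out a second letter `b`; exchanging `a` and `b` turns that integral into `n + 1`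
    -- copies of the first.
    have h1 : (j : ℝ) * sumProb p (n + 1 + 1) j =
        (∫ a : ℕ, (a : ℝ) * sumProb p (n + 1) (j - a) ∂p.toMeasure) +
        ∫ a : ℕ, ((j - a : ℤ) : ℝ) * sumProb p (n + 1) (j - a) ∂p.toMeasure := by
      have e : ∀ a : ℕ, ((j - a : ℤ) : ℝ) * sumProb p (n + 1) (j - a) =
          j * sumProb p (n + 1) (j - a) - a * sumProb p (n + 1) (j - a) := by
        intro a; push_cast; ring
      simp only [e]
      rw [integral_sub ((hi _ _).const_mul _) (integrable_mul_sumProb hp _ _),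
        integral_const_mul, ← sumProb_succ]
      ring
    have h2 : ∫ a : ℕ, ((j - a : ℤ) : ℝ) * sumProb p (n + 1) (j - a) ∂p.toMeasure =
        (n + 1) * ∫ b : ℕ, (b : ℝ) * sumProb p (n + 1) (j - b) ∂p.toMeasure := by
      simp only [ih]
      rw [integral_const_mul, integral_integral_swap]
      · congr 1
        refine integral_congr_ae (.of_forall fun b => ?_)
        dsimp only
        rw [integral_const_mul, sumProb_succ]
        congr 2
        funext a
        congr 1
        ring
      · refine (hp.comp_snd p.toMeasure).mono (by fun_prop) (.of_forall fun x => ?_)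
        simp only [Function.uncurry, norm_mul]
        exact mul_le_of_le_one_right (norm_nonneg _) (abs_sumProb_le_one _ _)
    rw [h1, h2]
    push_cast
    ring

theorem forestProb_nonneg (d n : ℕ) : 0 ≤ forestProb p d n :=
  iidMean_nonneg fun l _ => by split_ifs <;> norm_num

theorem abs_forestProb_le_one (d n : ℕ) : |forestProb p d n| ≤ 1 :=
  abs_iidMean_le fun l _ => by split_ifs <;> norm_num

theorem forestProb_succ (d n : ℕ) :
    forestProb p (d + 1) (n + 1) = ∫ a : ℕ, forestProb p (d + a) n ∂p.toMeasure := by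
  rw [forestProb, iidMean]
  refine integral_congr_ae (.of_forall fun a => iidMean_congr fun l _ => ?_)
  simp [pass_succ_cons]

/-- The Otter–Dwass formula: `n ℙ(d trees have n nodes in total) = d ℙ(S_n = n - d)`. -/
theorem mul_forestProb (hp : Integrable (fun a : ℕ => (a : ℝ)) p.toMeasure) (d n : ℕ) :
    ((n + 1 : ℕ) : ℝ) * forestProb p d (n + 1) = d * sumProb p (n + 1) ((n + 1 : ℕ) - d) := by
  have h0 : ∀ n, forestProb p 0 (n + 1) = 0 := fun n => by
    simpa [forestProb] using iidMean_const (p := p) 0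
  induction n generalizing d with
  | zero =>
    cases d with
    | zero => simp [h0]
    | succ d =>
      rw [forestProb_succ, sumProb_succ]
      cases d with
      | zero =>
        simp only [forestProb, iidMean, sumProb_zero]
        simp only [zero_add, Nat.cast_one, one_mul]
        refine integral_congr_ae (.of_forall fun a => ?_)
        cases a with
        | zero => simp
        | succ a =>
          simp
          omega
      | succ d =>
        have e1 : ∀ a, forestProb p (d + 1 + a) 0 = 0 := by
          intro a
          rw [show d + 1 + a = d + a + 1 by ring]
          simp [forestProb, iidMean]
        have e2 : ∀ a : ℕ, sumProb p 0 (((0 + 1 : ℕ) : ℤ) - (d + 1 + 1 : ℕ) - a) = 0 := by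
          intro a
          rw [sumProb_zero, if_neg]
          push_cast
          omega
        simp only [e1, e2]
        simp
  | succ n ih =>
    cases d with
    | zero => simp [h0]
    | succ d =>
      have hn : ((n + 1 : ℕ) : ℝ) ≠ 0 := by positivity
      -- A first letter `a` leaves `d + a` trees to be read. The part with factor `d` integrates to
      -- `sumProb`, the part with factor `a` is evaluated by `mul_sumProb_succ`.
      have e1 : ∀ a : ℕ, forestProb p (d + a) (n + 1) = ((n + 1 : ℕ) : ℝ)⁻¹ *
          (d * sumProb p (n + 1) ((n + 1 : ℕ) - d - a) +
            a * sumProb p (n + 1) ((n + 1 : ℕ) - d - a)) := by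
        intro a
        rw [eq_inv_mul_iff_mul_eq₀ hn, ih]
        push_cast
        rw [sub_add_eq_sub_sub]
        ring
      rw [forestProb_succ]
      simp only [e1]
      rw [integral_const_mul, integral_add
        ((integrable_of_abs_le 1 fun a => abs_sumProb_le_one _ _).const_mul _)
        (integrable_mul_sumProb hp _ _), integral_const_mul, ← sumProb_succ]
      have := mul_sumProb_succ hp (n + 1) ((n + 1 : ℕ) - d)
      have h3 : ∫ a : ℕ, (a : ℝ) * sumProb p (n + 1) ((n + 1 : ℕ) - d - a) ∂p.toMeasure =
          (((n + 1 : ℕ) - d : ℤ) : ℝ) * sumProb p (n + 1 + 1) ((n + 1 : ℕ) - d) / (n + 1 + 1) := by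
        rw [this]
        push_cast
        field_simp
      rw [h3]
      have h4 : ((n + 1 + 1 : ℕ) : ℤ) - (d + 1 : ℕ) = (n + 1 : ℕ) - d := by push_cast; ring
      rw [h4]
      push_cast
      field_simp
      ring

theorem treeSum_one_eq_forestProb (k : ℕ) : treeSum p k (fun _ => 1) = forestProb p 1 k :=
  (iidMean_pass_eq_treeSum k fun _ => 1).symm

theorem treeSum_rootDegree (n : ℕ) : treeSum p (n + 1) (fun T => (T.rootDegree : ℝ)) =
    ∫ a : ℕ, (a : ℝ) * forestProb p a n ∂p.toMeasure := by
  have := iidMean_pass_eq_treeSum (p := p) (n + 1) fun l => (l.headI : ℝ)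
  have e : treeSum p (n + 1) (fun T => (T.rootDegree : ℝ)) =
      treeSum p (n + 1) fun T => ((word T).headI : ℝ) :=
    treeSum_congr fun T _ => by cases T; rfl
  rw [e, ← this, iidMean]
  refine integral_congr_ae (.of_forall fun a => ?_)
  dsimp only
  rw [forestProb, ← iidMean_const_mul]
  exact iidMean_congr fun l _ => by simp [pass_succ_cons]

/-- Decomposition of independent letters after the first complete tree. -/
theorem iidMean_pass_append (k m : ℕ) (Φ : List ℕ → ℝ) :
    iidMean p (k + m) (fun l => if pass 1 l = some k then Φ l else 0) =
      treeSum p k fun T => iidMean p m fun v => Φ (word T ++ v) := by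
  rw [iidMean_append, ← iidMean_pass_eq_treeSum k fun u => iidMean p m fun v => Φ (u ++ v)]
  refine iidMean_congr fun u hu => ?_
  subst hu
  simp only [pass_append_iff]
  split_ifs
  · rfl
  · exact iidMean_const 0

/-! ### Sums over the complete trees in a word -/

/-- `μ k` if `l` starts with a complete tree with `k` nodes, and `0` if `l` is too short. -/
def toll (μ : ℕ → ℝ) (l : List ℕ) : ℝ := (pass 1 l).elim 0 μ

/-- The sum of `μ k` over all complete trees in `l`, where `k` is the size of the tree. -/
def wordSum (μ : ℕ → ℝ) : List ℕ → ℝ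
  | [] => 0
  | a :: l => toll μ (a :: l) + wordSum μ l

variable {μ h : ℕ → ℝ}

theorem toll_word_append (T : PlaneTree) (l : List ℕ) : toll μ (word T ++ l) = μ T.size := by
  simp [toll, pass_one_word_append]

theorem toll_nonneg (hh : ∀ k, 0 ≤ h k) (l : List ℕ) : 0 ≤ toll h l := by
  unfold toll
  cases pass 1 l with
  | none => exact le_rfl
  | some k => exact hh k

theorem abs_toll (l : List ℕ) : |toll μ l| = toll (fun k => |μ k|) l := by
  unfold toll
  cases pass 1 l with
  | none => simp
  | some k => rfl

theorem abs_toll_le {s : ℝ} (hs : ∀ k, |μ k| ≤ s) (l : List ℕ) : |toll μ l| ≤ s := by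
  unfold toll
  cases pass 1 l with
  | none => simpa using (abs_nonneg _).trans (hs 0)
  | some k => exact hs k

theorem toll_eq_sum {n : ℕ} {l : List ℕ} (hl : l.length = n) :
    toll μ l = ∑ k ∈ Finset.Icc 1 n, μ k * if pass 1 l = some k then 1 else 0 := by
  unfold toll
  cases hk : pass 1 l with
  | none => simp
  | some k =>
    have := pass_spec hk
    rw [Finset.sum_eq_single k]
    · simp
    · intro j _ hj
      rw [if_neg (by simpa using hj.symm), mul_zero]
    · intro hk'
      simp only [Finset.mem_Icc] at hk'
      omega

theorem bddOn_toll (n : ℕ) : BddOn n (toll μ) := by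
  refine ⟨∑ k ∈ Finset.Icc 1 n, |μ k|, fun l hl => ?_⟩
  rw [toll_eq_sum hl]
  refine (Finset.abs_sum_le_sum_abs _ _).trans (Finset.sum_le_sum fun k _ => ?_)
  rw [abs_mul]
  exact mul_le_of_le_one_right (abs_nonneg _) (by split_ifs <;> norm_num)

theorem wordSum_eq_sum (l : List ℕ) :
    wordSum μ l = ∑ c ∈ Finset.range l.length, toll μ (l.drop c) := by
  induction l with
  | nil => rfl
  | cons a l ih => rw [wordSum, List.length_cons, Finset.sum_range_succ', ih, add_comm]; rfl

theorem wordSum_forest_append (ts : List PlaneTree)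
    (hts : ∀ T ∈ ts, ∀ l, wordSum μ (word T ++ l) =
      additive (fun T => μ T.size) T + wordSum μ l) (l : List ℕ) :
    wordSum μ ((ts.map word).flatten ++ l) =
      (ts.map (additive fun T => μ T.size)).sum + wordSum μ l := by
  induction ts with
  | nil => simp
  | cons T ts ih =>
    rw [List.map_cons, List.flatten_cons, List.append_assoc, hts T (by simp),
      ih fun T hT => hts T (by simp [hT]), List.map_cons, List.sum_cons, add_assoc]

theorem wordSum_word_append (T : PlaneTree) (l : List ℕ) :
    wordSum μ (word T ++ l) = additive (fun T => μ T.size) T + wordSum μ l := by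
  induction T generalizing l with
  | node d c ih =>
    have h1 : toll μ (word (node d c) ++ l) = _ := toll_word_append (node d c) l
    have h2 := wordSum_forest_append (List.ofFn c) (fun T hT => by
      obtain ⟨i, rfl⟩ := List.mem_ofFn.1 hT
      exact ih i) l
    rw [word_node, List.cons_append] at h1 ⊢
    rw [wordSum, h1, h2, additive_node, List.map_ofFn, List.sum_ofFn]
    simp only [Function.comp]
    ring

theorem wordSum_word (T : PlaneTree) : wordSum μ (word T) = additive (fun T => μ T.size) T := by
  simpa [wordSum] using wordSum_word_append (μ := μ) T []

theorem toll_append_of_pass {u : List ℕ} (v : List ℕ) {j : ℕ} (hu : pass 1 u = some j) :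
    toll μ (u ++ v) = toll μ u := by
  rw [toll, toll, pass_append_of_some v hu, hu]

/-- The expected number of fringe subtrees of given size. -/
theorem treeSum_additive_size_le (hh : ∀ k, 0 ≤ h k) (n : ℕ) :
    treeSum p n (additive fun T => h T.size) ≤
      ∑ k ∈ Finset.Icc 1 n, h k * (forestProb p 1 k * sumProb p (n - k) (n - k : ℕ)) := by
  -- Each suffix of a tree word begins with a complete tree, so moving the preceding letters to the
  -- end does not change the toll at its start.
  have h1 : treeSum p n (additive fun T => h T.size) =
      treeSum p n fun T => ∑ c ∈ Finset.range n, toll h ((word T).rotate c) := by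
    refine treeSum_congr fun T hT => ?_
    rw [← wordSum_word, wordSum_eq_sum, length_word, hT]
    refine Finset.sum_congr rfl fun c hc => ?_
    have hc' : c < (word T).length := by simpa [hT] using hc
    rw [List.rotate_eq_drop_append_take hc'.le]
    obtain ⟨j, hj⟩ := pass_drop_of_pass (d := 1) (by simpa using pass_one_word T) hc'
    rw [toll_append_of_pass _ hj]
  rw [h1]
  refine (treeSum_rotate_le (bddOn_toll n) fun l _ => toll_nonneg hh l).trans_eq ?_
  have h2 : ∀ l : List ℕ, l.length = n → (if l.sum + 1 = n then toll h l else 0) =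
      ∑ k ∈ Finset.Icc 1 n, h k *
        if pass 1 l = some k then (if l.sum + 1 = n then 1 else 0) else 0 := by
    intro l hl
    rw [toll_eq_sum hl]
    split_ifs <;> simp
  rw [iidMean_congr h2, iidMean_finsetSum _ fun k _ => (bddOn_const _).mul
    (.ite _ (bddOn_ite_one _ _) (bddOn_const _))]
  refine Finset.sum_congr rfl fun k hk => ?_
  rw [iidMean_const_mul]
  congr 1
  obtain ⟨m, rfl⟩ := Nat.exists_eq_add_of_le (Finset.mem_Icc.1 hk).2
  rw [iidMean_pass_append, add_tsub_cancel_left, ← treeSum_one_eq_forestProb, ← treeSum_mul_const]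
  refine treeSum_congr fun T hT => ?_
  rw [one_mul]
  refine iidMean_congr fun v _ => ?_
  congr 1
  have := sum_word T
  rw [List.sum_append, eq_iff_iff]
  omega

end sums

end PlaneTree

/-! ### The characteristic function of the offspring law and Fourier inversion -/

namespace PlaneTree

section fourier
open Complex
variable {p : PMF ℕ}

theorem ae_ne_zero (p : PMF ℕ) : ∀ᵐ a ∂p.toMeasure, p a ≠ 0 := by
  rw [ae_iff, PMF.toMeasure_apply_eq_zero_iff _ (by trivial)]
  rw [Set.disjoint_left]
  intro a ha
  simpa using ha

/-- The characteristic function of the offspring distribution. -/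
noncomputable def offspringChar (p : PMF ℕ) (t : ℝ) : ℂ :=
  charFun (p.toMeasure.map fun a : ℕ => (a : ℝ)) t

theorem offspringChar_eq (t : ℝ) :
    offspringChar p t = ∫ a : ℕ, cexp (t * a * I) ∂p.toMeasure := by
  rw [offspringChar, charFun_apply_real, integral_map (by fun_prop) (by fun_prop)]
  simp

theorem continuous_offspringChar : Continuous (offspringChar p) := by
  have : IsProbabilityMeasure (p.toMeasure.map fun a : ℕ => (a : ℝ)) :=
    Measure.isProbabilityMeasure_map (by fun_prop)
  exact continuous_charFun

theorem norm_offspringChar_le_one (t : ℝ) : ‖offspringChar p t‖ ≤ 1 := by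
  have : IsProbabilityMeasure (p.toMeasure.map fun a : ℕ => (a : ℝ)) :=
    Measure.isProbabilityMeasure_map (by fun_prop)
  exact norm_charFun_le_one _

theorem norm_cexp_mul_I (x : ℝ) (a : ℕ) : ‖cexp (x * a * I)‖ = 1 := by
  have := norm_exp_ofReal_mul_I (x * a)
  push_cast at this
  exact this

/-- Let `u` be the direction of the characteristic function `φ(t)`. Then `exp (i t ξ)` has mean
square distance `2 (1 - |φ(t)|)` from `u`, and a single atom contributes no more than the whole
mean. -/
theorem exists_norm_cexp_sub_le (t : ℝ) : ∃ u : ℂ, ∀ a : ℕ,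
    (p a).toReal * ‖cexp (t * a * I) - u‖ ^ 2 ≤ 2 * (1 - ‖offspringChar p t‖) := by
  set z := offspringChar p t with hz
  obtain ⟨u, hu1, hu2⟩ : ∃ u : ℂ, ‖u‖ = 1 ∧ (starRingEnd ℂ u * z).re = ‖z‖ := by
    by_cases h0 : z = 0
    · exact ⟨1, by simp, by simp [h0]⟩
    · have hne : ‖z‖ ≠ 0 := norm_ne_zero_iff.2 h0
      refine ⟨z / ‖z‖, by simp [h0], ?_⟩
      rw [map_div₀, conj_ofReal, div_mul_eq_mul_div, mul_comm, mul_conj, normSq_eq_norm_sq,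
        ← ofReal_div, ofReal_re]
      field_simp
  refine ⟨u, fun a => ?_⟩
  have hint : ∀ b : ℕ, ‖cexp (t * b * I) - u‖ ^ 2 =
      2 - 2 * (starRingEnd ℂ u * cexp (t * b * I)).re := by
    intro b
    rw [← normSq_eq_norm_sq, normSq_sub, normSq_eq_norm_sq, normSq_eq_norm_sq, hu1,
      norm_cexp_mul_I, mul_comm (starRingEnd ℂ u)]
    ring
  have hi : Integrable (fun b : ℕ => cexp (t * b * I)) p.toMeasure :=
    Integrable.of_bound (by fun_prop) 1 (.of_forall fun b => (norm_cexp_mul_I t b).le)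
  have hi' : Integrable (fun b : ℕ => (starRingEnd ℂ u * cexp (t * b * I)).re) p.toMeasure :=
    (hi.const_mul _).re
  have h1 : ∫ b : ℕ, ‖cexp (t * b * I) - u‖ ^ 2 ∂p.toMeasure = 2 * (1 - ‖z‖) := by
    simp only [hint]
    rw [integral_sub (integrable_const _) (hi'.const_mul _), integral_const_mul]
    have := integral_re (hi.const_mul (starRingEnd ℂ u))
    simp only [RCLike.re_eq_complex_re] at this
    rw [this, integral_const_mul, ← offspringChar_eq, ← hz, hu2]
    simp
    ring
  have hi2 : Integrable (fun b : ℕ => ‖cexp (t * b * I) - u‖ ^ 2) p.toMeasure := by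
    simp only [hint]
    exact (integrable_const _).sub (hi'.const_mul _)
  rw [← h1, ← integral_ite_eq (p := p) a]
  refine integral_mono (integrable_of_abs_le (‖cexp (t * a * I) - u‖ ^ 2) fun b => ?_) hi2
    fun b => ?_
  · split_ifs <;> simp
  · dsimp only
    split_ifs with h
    · rw [h]
    · positivity

/-- The integers `m` for which `exp (i t m)` is close to `1` whenever the characteristic function
at `t` has modulus close to `1`. -/
def resonance (p : PMF ℕ) : AddSubgroup ℤ where
  carrier := {m | ∃ K : ℝ, 0 ≤ K ∧ ∀ t : ℝ,
    ‖cexp (t * m * I) - 1‖ ≤ K * √(1 - ‖offspringChar p t‖)}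
  zero_mem' := ⟨0, le_rfl, fun t => by simp⟩
  add_mem' := by
    rintro m m' ⟨K, hK, h⟩ ⟨K', hK', h'⟩
    refine ⟨K + K', by positivity, fun t => ?_⟩
    have e : cexp (t * (m + m' : ℤ) * I) - 1 =
        cexp (t * m * I) * (cexp (t * m' * I) - 1) + (cexp (t * m * I) - 1) := by
      push_cast
      rw [mul_sub, ← Complex.exp_add]
      ring_nf
    have hn : ‖cexp (t * m * I)‖ = 1 := by
      have := norm_exp_ofReal_mul_I (t * m)
      push_cast at this
      exact this
    rw [e]
    refine (norm_add_le _ _).trans ?_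
    rw [norm_mul, hn, one_mul, add_mul, add_comm]
    exact add_le_add (h t) (h' t)
  neg_mem' := by
    rintro m ⟨K, hK, h⟩
    refine ⟨K, hK, fun t => ?_⟩
    have e : cexp (t * (-m : ℤ) * I) - 1 = - (cexp (-(t * m * I)) * (cexp (t * m * I) - 1)) := by
      push_cast
      rw [mul_sub, ← Complex.exp_add]
      ring_nf
      simp
      ring
    have hn : ‖cexp (-(t * m * I))‖ = 1 := by
      have := norm_exp_ofReal_mul_I (-(t * m))
      push_cast at this
      rw [← this]
      ring_nf
    rw [e, norm_neg, norm_mul, hn, one_mul]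
    exact h t

/-- The values of the exponential at the atoms `a` and `0` are close to the same `u`, and the value
at `0` is `1`. -/
theorem mem_resonance (h0 : p 0 ≠ 0) {a : ℕ} (ha : p a ≠ 0) : (a : ℤ) ∈ resonance p := by
  have hpos : ∀ b, p b ≠ 0 → 0 < (p b).toReal := fun b hb =>
    ENNReal.toReal_pos hb (p.apply_ne_top b)
  refine ⟨√(2 / (p a).toReal) + √(2 / (p 0).toReal), by positivity, fun t => ?_⟩
  obtain ⟨u, hu⟩ := exists_norm_cexp_sub_le (p := p) t
  have key : ∀ b, p b ≠ 0 → ‖cexp (t * b * I) - u‖ ≤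
      √(2 / (p b).toReal) * √(1 - ‖offspringChar p t‖) := by
    intro b hb
    rw [← Real.sqrt_mul (by positivity)]
    refine Real.le_sqrt_of_sq_le ?_
    rw [div_mul_eq_mul_div, le_div_iff₀ (hpos b hb), mul_comm]
    exact hu b
  have h1 := key a ha
  have h2 := key 0 h0
  simp only [Nat.cast_zero, mul_zero, zero_mul, Complex.exp_zero] at h2
  have e : cexp (t * (a : ℤ) * I) - 1 = (cexp (t * a * I) - u) - (1 - u) := by push_cast; ring
  rw [e, add_mul]
  exact (norm_sub_le _ _).trans (add_le_add h1 h2)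

/-- The span of the offspring distribution, with a Gaussian bound for the characteristic function
on the corresponding period. -/
theorem exists_span (h0 : p 0 ≠ 0) (h1 : ∃ a, a ≠ 0 ∧ p a ≠ 0) : ∃ d : ℕ, 0 < d ∧
    (∀ a, p a ≠ 0 → d ∣ a) ∧ ∃ c : ℝ, 0 < c ∧ ∀ t : ℝ, |t| ≤ Real.pi / d →
      ‖offspringChar p t‖ ≤ Real.exp (-c * t ^ 2) := by
  set S : AddSubgroup ℤ := AddSubgroup.closure {m : ℤ | ∃ a : ℕ, p a ≠ 0 ∧ m = a} with hS
  obtain ⟨g, hg⟩ := Int.subgroup_cyclic S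
  have hdvd : ∀ a : ℕ, p a ≠ 0 → g ∣ (a : ℤ) := by
    intro a ha
    have : (a : ℤ) ∈ S := AddSubgroup.subset_closure ⟨a, ha, rfl⟩
    rw [hg, ← AddSubgroup.zmultiples_eq_closure, Int.mem_zmultiples_iff] at this
    exact this
  have hg0 : g ≠ 0 := by
    rintro rfl
    obtain ⟨a, ha, ha'⟩ := h1
    have := hdvd a ha'
    rw [zero_dvd_iff] at this
    exact ha (by exact_mod_cast this)
  -- The span need not be an atom, but it lies in the subgroup generated by the atoms.
  have hgmem : (g.natAbs : ℤ) ∈ resonance p := by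
    have hle : S ≤ resonance p := by
      rw [hS, AddSubgroup.closure_le]
      rintro m ⟨a, ha, rfl⟩
      exact mem_resonance h0 ha
    have : g ∈ resonance p := hle (by rw [hg]; exact AddSubgroup.subset_closure rfl)
    rcases Int.natAbs_eq g with h | h
    · rwa [← h]
    · rw [← neg_mem_iff, ← h]; exact this
  obtain ⟨K, hK, hres⟩ := hgmem
  have hd : 0 < g.natAbs := Int.natAbs_pos.2 hg0
  refine ⟨g.natAbs, hd, fun a ha => Int.natAbs_dvd_natAbs.2 (hdvd a ha), ?_⟩
  set d := g.natAbs
  have hd' : (0 : ℝ) < d := by exact_mod_cast hd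
  -- On one period `|exp (i t d) - 1| = 2 |sin (t d / 2)| ≥ (2 / π) d |t|`; with the resonance bound
  -- this gives `c t² ≤ 1 - |φ(t)|`. The denominator `K + 1` covers `K = 0`.
  refine ⟨(2 / Real.pi * d / (K + 1)) ^ 2, by positivity, fun t ht => ?_⟩
  have hle1 := norm_offspringChar_le_one (p := p) t
  have h2 := hres t
  have h3 : 2 / Real.pi * (d * |t|) ≤ ‖cexp (t * (d : ℤ) * I) - 1‖ := by
    have e : cexp (t * (d : ℤ) * I) - 1 = cexp (I * ((t * d : ℝ) : ℂ)) - 1 := by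
      push_cast; ring_nf
    rw [e, norm_exp_I_mul_ofReal_sub_one, norm_mul, Real.norm_eq_abs, Real.norm_eq_abs,
      abs_of_pos (zero_lt_two' ℝ)]
    have hb : |t * d / 2| ≤ Real.pi / 2 := by
      rw [abs_div, abs_mul, Nat.abs_cast, abs_of_pos (zero_lt_two' ℝ)]
      rw [le_div_iff₀ hd'] at ht
      linarith
    have := Real.mul_abs_le_abs_sin hb
    rw [abs_div, abs_mul, Nat.abs_cast, abs_of_pos (zero_lt_two' ℝ)] at this
    linarith
  have h4 : 2 / Real.pi * d / (K + 1) * |t| ≤ √(1 - ‖offspringChar p t‖) := by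
    rw [div_mul_eq_mul_div, div_le_iff₀ (by positivity)]
    have h5 := Real.sqrt_nonneg (1 - ‖offspringChar p t‖)
    nlinarith
  have h6 : (2 / Real.pi * d / (K + 1)) ^ 2 * t ^ 2 ≤ 1 - ‖offspringChar p t‖ := by
    have := pow_le_pow_left₀ (by positivity) h4 2
    rwa [Real.sq_sqrt (by linarith), mul_pow, sq_abs] at this
  have := Real.add_one_le_exp (-(2 / Real.pi * d / (K + 1)) ^ 2 * t ^ 2)
  linarith

theorem sumProb_eq_zero_of_not_dvd {d : ℕ} (hd : ∀ a, p a ≠ 0 → d ∣ a) (n : ℕ) (j : ℤ)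
    (hj : ¬ (d : ℤ) ∣ j) : sumProb p n j = 0 := by
  induction n generalizing j with
  | zero =>
    rw [sumProb_zero, if_neg]
    rintro rfl
    exact hj (dvd_zero _)
  | succ n ih =>
    rw [sumProb_succ]
    refine integral_eq_zero_of_ae ((ae_ne_zero p).mono fun a ha => ?_)
    refine ih _ fun h => hj ?_
    have := dvd_add h (Int.natCast_dvd_natCast.2 (hd a ha))
    simpa using this

/-- Fourier inversion for the distribution of the sum of independent letters. -/
theorem integral_offspringChar_pow {d : ℕ} (hd0 : 0 < d) (hd : ∀ a, p a ≠ 0 → d ∣ a) (n : ℕ)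
    (j : ℤ) (hj : (d : ℤ) ∣ j) :
    ∫ t in (-(Real.pi / d))..(Real.pi / d), offspringChar p t ^ n * cexp (-(t * j * I)) =
      2 * Real.pi / d * sumProb p n j := by
  have hdR : (d : ℝ) ≠ 0 := by positivity
  have hdC : (d : ℂ) ≠ 0 := by exact_mod_cast hdR
  induction n generalizing j with
  | zero =>
    rw [sumProb_zero]
    by_cases h0 : j = 0
    · subst h0
      simp
      ring
    · obtain ⟨i, rfl⟩ := hj
      have hi : (i : ℂ) ≠ 0 := by
        rintro h
        rw [Int.cast_eq_zero] at h
        simp [h] at h0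
      rw [if_neg h0]
      have e : ∀ t : ℝ, offspringChar p t ^ 0 * cexp (-(t * (d * i : ℤ) * I)) =
          cexp ((-(d * i) * I) * t) := by
        intro t
        push_cast
        ring_nf
      simp only [e]
      rw [integral_exp_mul_complex (by
        simp only [neg_mul, ne_eq, neg_eq_zero, mul_eq_zero, I_ne_zero, or_false, not_or]
        exact ⟨hdC, hi⟩)]
      have e1 : -(d * i : ℂ) * I * ((Real.pi / d : ℝ) : ℂ) = -(i * (Real.pi * I)) := by
        push_cast
        field_simp
      have e2 : -(d * i : ℂ) * I * ((-(Real.pi / d) : ℝ) : ℂ) =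
          -(i * (Real.pi * I)) + i * (2 * Real.pi * I) := by
        push_cast
        field_simp
        ring
      rw [e1, e2, Complex.exp_add, Complex.exp_int_mul_two_pi_mul_I]
      simp
  | succ n ih =>
    have hle : -(Real.pi / d) ≤ Real.pi / d := by
      have : 0 < Real.pi / d := by positivity
      linarith
    -- One factor is written as a mean over one letter `a`, and Fubini reduces to `n` letters with
    -- target `j - a`, still divisible by `d` since almost surely `d ∣ a`.
    have e1 : ∀ t : ℝ, offspringChar p t ^ (n + 1) * cexp (-(t * j * I)) =
        ∫ a : ℕ, offspringChar p t ^ n * cexp (-(t * (j - a : ℤ) * I)) ∂p.toMeasure := by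
      intro t
      rw [integral_const_mul, pow_succ, mul_assoc]
      congr 1
      rw [offspringChar_eq, ← integral_mul_const]
      congr 1
      funext a
      rw [← Complex.exp_add]
      push_cast
      ring_nf
    simp only [e1]
    rw [intervalIntegral.integral_of_le hle, integral_integral_swap]
    · rw [sumProb_succ, ← integral_complex_ofReal, ← integral_const_mul]
      refine integral_congr_ae ((ae_ne_zero p).mono fun a ha => ?_)
      dsimp only
      rw [← intervalIntegral.integral_of_le hle, ih]
      exact dvd_sub hj (Int.natCast_dvd_natCast.2 (hd a ha))
    · refine Integrable.of_bound ?_ 1 (.of_forall fun x => ?_)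
      · have := (continuous_offspringChar (p := p)).measurable
        refine Measurable.aestronglyMeasurable ?_
        simp only [Function.uncurry_def]
        refine ((this.comp measurable_fst).pow_const n).mul ?_
        refine Complex.measurable_exp.comp ?_
        refine ((((Complex.measurable_ofReal.comp measurable_fst)).mul ?_).mul_const _).neg
        exact (measurable_of_countable (fun a : ℕ => (((j - a : ℤ)) : ℂ))).comp measurable_snd
      · simp only [Function.uncurry_def]
        have hn : ‖cexp (-(x.1 * (j - x.2 : ℤ) * I))‖ = 1 := by
          have := norm_exp_ofReal_mul_I (-(x.1 * (j - x.2 : ℤ)))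
          rw [← this]
          push_cast
          ring_nf
        rw [norm_mul, hn, mul_one, norm_pow]
        exact pow_le_one₀ (norm_nonneg _) (norm_offspringChar_le_one _)

end fourier

end PlaneTree

/-! ### Local limit bounds -/

namespace PlaneTree

section local_limit
open Complex Filter Topology
variable {p : PMF ℕ}

/-- In the inversion formula the integrand has modulus at most `exp (-c n t²)`, whose integral over
the line is `√(π / (c n))`. The bound is uniform in `j`. -/
theorem exists_sumProb_le (h0 : p 0 ≠ 0) (h1 : ∃ a, a ≠ 0 ∧ p a ≠ 0) :
    ∃ C : ℝ, 0 < C ∧ ∀ n j, sumProb p n j ≤ C / √(n + 1) := by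
  obtain ⟨d, hd0, hd, c, hc, hφ⟩ := exists_span h0 h1
  have hdR : (0 : ℝ) < d := by exact_mod_cast hd0
  set D : ℝ := d / (2 * Real.pi) * √(Real.pi / c) with hD
  have hDpos : 0 < D := by positivity
  -- The factor `√2` passes from `√n` to `√(n + 1)`; the summand `1` covers `n = 0`.
  refine ⟨√2 * D + 1, by positivity, fun n j => ?_⟩
  rcases Nat.eq_zero_or_pos n with rfl | hn
  · have := sumProb_le_one (p := p) 0 j
    simp
    nlinarith [Real.sqrt_nonneg 2]
  by_cases hj : (d : ℤ) ∣ j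
  swap
  · rw [sumProb_eq_zero_of_not_dvd hd n j hj]; positivity
  have hnR : (1 : ℝ) ≤ n := by exact_mod_cast hn
  have hle : -(Real.pi / d) ≤ Real.pi / d := by
    have : 0 < Real.pi / d := by positivity
    linarith
  have hb : ‖∫ t in (-(Real.pi / d))..(Real.pi / d), offspringChar p t ^ n * cexp (-(t * j * I))‖ ≤
      √(Real.pi / (c * n)) := by
    have hg : Integrable fun t : ℝ => Real.exp (-(c * n) * t ^ 2) :=
      integrable_exp_neg_mul_sq (by positivity)
    refine (intervalIntegral.norm_integral_le_integral_norm hle).trans ?_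
    rw [intervalIntegral.integral_of_le hle, ← integral_gaussian]
    refine le_trans ?_ (setIntegral_le_integral (s := Set.Ioc (-(Real.pi / d)) (Real.pi / d)) hg
      (.of_forall fun t => (Real.exp_pos _).le))
    refine setIntegral_mono_on_ae ?_ hg.integrableOn measurableSet_Ioc (.of_forall fun t ht => ?_)
    · have : Continuous fun t : ℝ => ‖offspringChar p t ^ n * cexp (-(t * j * I))‖ := by
        have := continuous_offspringChar (p := p)
        fun_prop
      exact this.integrableOn_Ioc
    · have hn1 : ‖cexp (-(t * j * I))‖ = 1 := by
        have := norm_exp_ofReal_mul_I (-(t * j))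
        rw [← this]
        push_cast
        ring_nf
      rw [norm_mul, hn1, mul_one, norm_pow]
      refine (pow_le_pow_left₀ (norm_nonneg _) (hφ t (abs_le.2 ⟨ht.1.le, ht.2⟩)) n).trans_eq ?_
      rw [← Real.exp_nat_mul]
      ring_nf
  rw [integral_offspringChar_pow hd0 hd n j hj] at hb
  have h2 : sumProb p n j ≤ D / √n := by
    have e : ‖(2 * Real.pi / d * sumProb p n j : ℂ)‖ = 2 * Real.pi / d * sumProb p n j := by
      have : (2 * Real.pi / d * sumProb p n j : ℂ) = ((2 * Real.pi / d * sumProb p n j : ℝ) : ℂ) := by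
        push_cast; ring
      rw [this, norm_real, Real.norm_of_nonneg]
      have := sumProb_nonneg (p := p) n j
      positivity
    rw [e, ← div_div, Real.sqrt_div (by positivity)] at hb
    rw [hD, mul_div_assoc, ← div_le_iff₀' (by positivity)]
    refine le_trans (le_of_eq ?_) hb
    field_simp
  refine h2.trans ?_
  rw [div_le_div_iff₀ (by positivity) (by positivity)]
  have h3 : √((n : ℝ) + 1) ≤ √2 * √n := by
    rw [← Real.sqrt_mul (by norm_num)]
    exact Real.sqrt_le_sqrt (by linarith)
  nlinarith [Real.sqrt_nonneg (n : ℝ)]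

/-- Local limit theorem, lower bound. -/
theorem exists_le_sumProb (h0 : p 0 ≠ 0) (h1 : ∃ a, a ≠ 0 ∧ p a ≠ 0)
    (hp_sq : MemLp (fun k : ℕ => (k : ℝ)) 2 p.toMeasure)
    (hp_mean : ∫ k : ℕ, (k : ℝ) ∂p.toMeasure = 1)
    (hp_var : 0 < variance (fun k : ℕ => (k : ℝ)) p.toMeasure) :
    ∃ c : ℝ, 0 < c ∧ ∀ n : ℕ, 0 < n → 0 < sumProb p n (n - 1) → c / √n ≤ sumProb p n (n - 1) := by
  obtain ⟨d, hd0, hd, c, hc, hφ⟩ := exists_span h0 h1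
  have hdR : (0 : ℝ) < d := by exact_mod_cast hd0
  set v := variance (fun k : ℕ => (k : ℝ)) p.toMeasure with hv
  set σ := √v with hσ
  have hσ0 : 0 < σ := Real.sqrt_pos.2 hp_var
  have hσv : σ ^ 2 = v := Real.sq_sqrt hp_var.le
  set X : ℕ → ℝ := fun a => ((a : ℝ) - 1) / σ with hX
  have hi1 : Integrable (fun a : ℕ => (a : ℝ)) p.toMeasure := hp_sq.integrable one_le_two
  have hX0 : ∫ a, X a ∂p.toMeasure = 0 := by
    simp only [hX]
    rw [integral_div, integral_sub hi1 (integrable_const _), hp_mean]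
    simp
  have hX1 : ∫ a, (X ^ 2) a ∂p.toMeasure = 1 := by
    simp only [hX, Pi.pow_apply, div_pow]
    rw [integral_div, hσv, hv, variance_eq_integral (by fun_prop), hp_mean]
    exact div_self (by rw [← hp_mean, ← variance_eq_integral (by fun_prop)]; exact hp_var.ne')
  have hclt := fun t => tendsto_charFun_inv_sqrt_mul_pow (P := p.toMeasure) (X := X)
    (by fun_prop) hX0 hX1 t
  have hchar : ∀ s : ℝ, charFun (p.toMeasure.map X) s =
      offspringChar p (s / σ) * cexp (-((s / σ : ℝ) * I)) := by
    intro s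
    rw [charFun_apply_real, integral_map (by fun_prop) (by fun_prop), offspringChar_eq,
      ← integral_mul_const]
    congr 1
    funext a
    rw [← Complex.exp_add]
    congr 1
    simp only [hX]
    push_cast
    field_simp
    ring
  -- The substitution `t = s / (σ √n)` maps one period to `[-B n, B n]` and the inversion integrand
  -- to `F n`; its last exponential accounts for the target `n - 1` instead of the mean `n`. The `F
  -- n` are dominated by a fixed Gaussian, thanks to `exists_span`, and converge by the central
  -- limit theorem.
  set B : ℕ → ℝ := fun n => Real.pi / d * (σ * √n) with hB
  set F : ℕ → ℝ → ℂ := fun n s => (Set.Icc (-B n) (B n)).indicator (fun s : ℝ =>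
    (charFun (p.toMeasure.map X) ((√n)⁻¹ * s)) ^ n * cexp (((s / (σ * √n) : ℝ) : ℂ) * I)) s with hF
  have hprob : IsProbabilityMeasure (p.toMeasure.map X) :=
    Measure.isProbabilityMeasure_map (by fun_prop)
  have hlim : Tendsto (fun n => ∫ s, F n s) atTop (𝓝 (∫ s : ℝ, cexp (-(s : ℂ) ^ 2 / 2))) := by
    refine tendsto_integral_of_dominated_convergence
      (fun s => Real.exp (-(c / σ ^ 2) * s ^ 2)) ?_ ?_ ?_ ?_
    · intro n
      refine (Continuous.aestronglyMeasurable ?_).indicator measurableSet_Icc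
      have : Continuous (charFun (p.toMeasure.map X)) := continuous_charFun
      fun_prop
    · exact integrable_exp_neg_mul_sq (by positivity)
    · intro n
      refine .of_forall fun s => ?_
      simp only [hF]
      by_cases hs : s ∈ Set.Icc (-B n) (B n)
      swap
      · rw [Set.indicator_of_notMem hs, norm_zero]; positivity
      rw [Set.indicator_of_mem hs, norm_mul, norm_exp_ofReal_mul_I, mul_one, norm_pow, hchar]
      have hn1 : ∀ x : ℝ, ‖cexp (-((x : ℂ) * I))‖ = 1 := by
        intro x
        have := norm_exp_ofReal_mul_I (-x)
        rw [← this]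
        push_cast
        ring_nf
      rw [norm_mul, hn1, mul_one]
      rcases Nat.eq_zero_or_pos n with rfl | hn
      · simp only [hB] at hs
        simp at hs
        subst hs
        simp
      have hnR : (0 : ℝ) < n := by exact_mod_cast hn
      have hsn : 0 < √(n : ℝ) := Real.sqrt_pos.2 hnR
      have ht : |(√n)⁻¹ * s / σ| ≤ Real.pi / d := by
        rw [abs_div, abs_mul, abs_of_pos hσ0, abs_inv, abs_of_pos hsn, inv_mul_eq_div, div_div,
          div_le_iff₀ (by positivity), mul_comm (√(n : ℝ))]
        exact abs_le.2 hs
      refine (pow_le_pow_left₀ (norm_nonneg _) (hφ _ ht) n).trans_eq ?_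
      rw [← Real.exp_nat_mul]
      congr 1
      rw [div_pow, mul_pow, inv_pow, Real.sq_sqrt hnR.le]
      field_simp
    · refine .of_forall fun s => ?_
      have hsq : Tendsto (fun n : ℕ => √(n : ℝ)) atTop atTop :=
        Real.tendsto_sqrt_atTop.comp tendsto_natCast_atTop_atTop
      have hBt : Tendsto B atTop atTop :=
        (hsq.const_mul_atTop hσ0).const_mul_atTop (show (0 : ℝ) < Real.pi / d by positivity)
      have hev : ∀ᶠ n in atTop, F n s = (charFun (p.toMeasure.map X) ((√n)⁻¹ * s)) ^ n *
          cexp (((s / (σ * √n) : ℝ) : ℂ) * I) := by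
        filter_upwards [hBt.eventually_ge_atTop |s|] with n hn
        have hs : s ∈ Set.Icc (-B n) (B n) := abs_le.1 hn
        simp only [hF, Set.indicator_of_mem hs]
      refine Tendsto.congr' (EventuallyEq.symm hev) ?_
      have h3 : Tendsto (fun n : ℕ => cexp (((s / (σ * √n) : ℝ) : ℂ) * I)) atTop (𝓝 1) := by
        have h4 : Tendsto (fun n : ℕ => s / (σ * √(n : ℝ))) atTop (𝓝 0) :=
          (hsq.const_mul_atTop hσ0).const_div_atTop s
        have h5 : Continuous fun x : ℝ => cexp ((x : ℂ) * I) := by fun_prop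
        have := (h5.tendsto 0).comp h4
        rwa [ofReal_zero, zero_mul, Complex.exp_zero] at this
      simpa using (hclt s).mul h3
  have hgauss : ∫ s : ℝ, cexp (-(s : ℂ) ^ 2 / 2) = ((√(2 * Real.pi) : ℝ) : ℂ) := by
    have e : ∀ s : ℝ, cexp (-(s : ℂ) ^ 2 / 2) = ((Real.exp (-(1 / 2) * s ^ 2) : ℝ) : ℂ) := by
      intro s
      push_cast
      ring_nf
    simp only [e]
    rw [integral_complex_ofReal, integral_gaussian]
    congr 2
    ring
  rw [hgauss] at hlim
  have hre : Tendsto (fun n => (∫ s, F n s).re) atTop (𝓝 (√(2 * Real.pi))) := by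
    have := (continuous_re.tendsto _).comp hlim
    rwa [ofReal_re] at this
  have hval : ∀ n : ℕ, 0 < n → (d : ℤ) ∣ (n : ℤ) - 1 →
      (∫ s, F n s).re = σ * √n * (2 * Real.pi / d * sumProb p n (n - 1)) := by
    intro n hn hdvd
    have hnR : (0 : ℝ) < n := by exact_mod_cast hn
    have hsn : 0 < √(n : ℝ) := Real.sqrt_pos.2 hnR
    have hσn : σ * √(n : ℝ) ≠ 0 := by positivity
    have hBn : -B n ≤ B n := by
      have : 0 < B n := by simp only [hB]; positivity
      linarith
    have hint : ∫ s, F n s = (σ * √n : ℝ) * ∫ t in (-(Real.pi / d))..(Real.pi / d),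
        offspringChar p t ^ n * cexp (-(t * ((n : ℤ) - 1 : ℤ) * I)) := by
      simp only [hF]
      rw [integral_indicator measurableSet_Icc, integral_Icc_eq_integral_Ioc,
        ← intervalIntegral.integral_of_le hBn]
      have e : ∀ s : ℝ, charFun (p.toMeasure.map X) ((√n)⁻¹ * s) ^ n *
          cexp (((s / (σ * √n) : ℝ) : ℂ) * I) =
          (fun t : ℝ => offspringChar p t ^ n * cexp (-(t * ((n : ℤ) - 1 : ℤ) * I)))
            (s / (σ * √n)) := by
        intro s
        have e1 : (√n)⁻¹ * s / σ = s / (σ * √n) := by field_simp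
        rw [hchar, e1, mul_pow, mul_assoc, ← Complex.exp_nat_mul, ← Complex.exp_add]
        dsimp only
        congr 2
        push_cast
        ring
      rw [intervalIntegral.integral_congr fun s _ => e s,
        intervalIntegral.integral_comp_div (fun t : ℝ => offspringChar p t ^ n *
          cexp (-(t * ((n : ℤ) - 1 : ℤ) * I))) hσn]
      have e2 : B n / (σ * √n) = Real.pi / d := by simp only [hB]; field_simp
      rw [neg_div, e2, real_smul]
    rw [hint, integral_offspringChar_pow hd0 hd n _ hdvd]
    have e3 : ((σ * √n : ℝ) : ℂ) * (2 * Real.pi / d * sumProb p n ((n : ℤ) - 1)) =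
      ((σ * √n * (2 * Real.pi / d * sumProb p n (n - 1)) : ℝ) : ℂ) := by push_cast; ring
    rw [e3, ofReal_re]
  have hpi : 0 < √(2 * Real.pi) := by positivity
  have hev := hre.eventually (lt_mem_nhds (half_lt_self hpi))
  obtain ⟨N, hN⟩ := eventually_atTop.1 hev
  -- The limit only treats large `n`; the finitely many others with positive probability allow a
  -- common positive constant.
  have hfin : ∀ N : ℕ, ∃ c : ℝ, 0 < c ∧ ∀ n < N, 0 < n → 0 < sumProb p n (n - 1) →
      c / √n ≤ sumProb p n (n - 1) := by
    intro N
    induction N with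
    | zero => exact ⟨1, one_pos, fun n hn => absurd hn (Nat.not_lt_zero n)⟩
    | succ N ih =>
      obtain ⟨c, hc, ih⟩ := ih
      by_cases hpos : 0 < sumProb p N (N - 1) ∧ 0 < N
      · have hNR : (0 : ℝ) < N := by exact_mod_cast hpos.2
        have hsq := Real.sqrt_pos.2 hNR
        refine ⟨min c (sumProb p N (N - 1) * √N), lt_min hc (mul_pos hpos.1 hsq),
          fun n hn hn0 hn1 => ?_⟩
        rcases Nat.lt_succ_iff_lt_or_eq.1 hn with h | rfl
        · exact (div_le_div_of_nonneg_right (min_le_left _ _) (Real.sqrt_nonneg _)).trans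
            (ih n h hn0 hn1)
        · rw [div_le_iff₀ hsq]
          exact min_le_right _ _
      · refine ⟨c, hc, fun n hn hn0 hn1 => ?_⟩
        rcases Nat.lt_succ_iff_lt_or_eq.1 hn with h | rfl
        · exact ih n h hn0 hn1
        · exact (hpos ⟨hn1, hn0⟩).elim
  obtain ⟨c1, hc1, hc1'⟩ := hfin N
  -- Half of the limit `√(2π)`, divided by the factor in `hval`.
  set c2 := √(2 * Real.pi) / 2 / (σ * (2 * Real.pi / d)) with hc2
  have hc2pos : 0 < c2 := by positivity
  refine ⟨min c1 c2, lt_min hc1 hc2pos, fun n hn hpos => ?_⟩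
  by_cases hnN : n < N
  · exact (div_le_div_of_nonneg_right (min_le_left _ _) (Real.sqrt_nonneg _)).trans
      (hc1' n hnN hn hpos)
  · refine (div_le_div_of_nonneg_right (min_le_right _ _) (Real.sqrt_nonneg _)).trans ?_
    have hdvd : (d : ℤ) ∣ (n : ℤ) - 1 := by
      by_contra h
      rw [sumProb_eq_zero_of_not_dvd hd n _ h] at hpos
      exact lt_irrefl _ hpos
    have h5 := hN n (by omega)
    rw [hval n hn hdvd] at h5
    have hnR : (0 : ℝ) < n := by exact_mod_cast hn
    have hsn : 0 < √(n : ℝ) := Real.sqrt_pos.2 hnR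
    rw [hc2, div_div, div_le_iff₀ (by positivity)]
    refine h5.le.trans_eq ?_
    ring

end local_limit

end PlaneTree

namespace PlaneTree

/-! ### Estimates for conditioned trees with a common constant -/

/-- The estimates for the offspring distribution on which the variance bounds are based. -/
structure LocalBounds (p : PMF ℕ) (C : ℝ) : Prop where
  one_le : 1 ≤ C
  sumProb_le : ∀ n j, sumProb p n j ≤ C / √(n + 1)
  forestProb_le : ∀ d n, 0 < n → forestProb p d n ≤ C * d / (n * √n)
  le_treeProb : ∀ n, 0 < n → 0 < forestProb p 1 n → 1 ≤ C * (n * √n) * forestProb p 1 n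
  degree_le : ∀ n, treeSum p n (fun T => (T.rootDegree : ℝ)) ≤ C * treeSum p n fun _ => 1

theorem treeSum_eq_zero_of_forestProb {p : PMF ℕ} {n : ℕ} (h : forestProb p 1 n = 0)
    (Φ : PlaneTree → ℝ) : treeSum p n Φ = 0 := by
  rw [← treeSum_one_eq_forestProb] at h
  have := (Finset.sum_eq_zero_iff_of_nonneg fun T _ =>
    mul_nonneg (wt_nonneg p T) zero_le_one).1 h
  exact Finset.sum_eq_zero fun T hT => by
    have := this T hT
    rw [mul_one] at this
    rw [this, zero_mul]

/-- The bounds on forests and trees are the local limit bounds combined with the Otter–Dwass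
formula. For the root degree, the mean of `a ℙ(a trees have n nodes)` is at most `C n^(-3/2)` times
the second moment, which is where finite variance enters; it is then compared with `ℙ(|𝒯| = n + 1)`,
using `(n + 1)^(3/2) ≤ 4 n^(3/2)`. -/
theorem exists_localBounds (p : PMF ℕ)
    (hp_sq : MemLp (fun k : ℕ => (k : ℝ)) 2 p.toMeasure)
    (hp_mean : ∫ k : ℕ, (k : ℝ) ∂p.toMeasure = 1)
    (hp_var : 0 < variance (fun k : ℕ => (k : ℝ)) p.toMeasure) :
    ∃ C, LocalBounds p C := by
  have hi1 : Integrable (fun a : ℕ => (a : ℝ)) p.toMeasure := hp_sq.integrable one_le_two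
  have hi2 : Integrable (fun a : ℕ => (a : ℝ) ^ 2) p.toMeasure := hp_sq.integrable_sq
  -- Otherwise the offspring number is almost surely at least `1` with mean `1`, hence constant.
  have h0 : p 0 ≠ 0 := by
    intro h
    have hge : ∀ᵐ a : ℕ ∂p.toMeasure, 0 ≤ (a : ℝ) - 1 := (ae_ne_zero p).mono fun a ha => by
      have : a ≠ 0 := by rintro rfl; exact ha h
      have : (1 : ℝ) ≤ a := by exact_mod_cast Nat.one_le_iff_ne_zero.2 this
      linarith
    have hint : ∫ a : ℕ, ((a : ℝ) - 1) ∂p.toMeasure = 0 := by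
      rw [integral_sub hi1 (integrable_const _), hp_mean]; simp
    have hae := (integral_eq_zero_iff_of_nonneg_ae hge (hi1.sub (integrable_const _))).1 hint
    rw [variance_eq_integral (by fun_prop), hp_mean, integral_eq_zero_of_ae] at hp_var
    · exact lt_irrefl _ hp_var
    · filter_upwards [hae] with a ha
      simp only [Pi.zero_apply] at ha ⊢
      rw [ha]; norm_num
  have h1 : ∃ a, a ≠ 0 ∧ p a ≠ 0 := by
    by_contra! h
    rw [integral_eq_zero_of_ae] at hp_mean
    · exact zero_ne_one hp_mean
    · filter_upwards [ae_ne_zero p] with a ha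
      have : a = 0 := by
        by_contra h'
        exact ha (h a h')
      simp [this]
  obtain ⟨C, hC, hCle⟩ := exists_sumProb_le h0 h1
  obtain ⟨c, hc, hcle⟩ := exists_le_sumProb h0 h1 hp_sq hp_mean hp_var
  set m2 := ∫ a : ℕ, (a : ℝ) ^ 2 ∂p.toMeasure with hm2
  have hm2' : 0 ≤ m2 := integral_nonneg fun a => sq_nonneg _
  have hforest : ∀ d n, 0 < n → forestProb p d n ≤ C * d / (n * √n) := by
    intro d n hn
    obtain ⟨n, rfl⟩ := Nat.exists_eq_succ_of_ne_zero hn.ne'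
    have h2 := mul_forestProb hi1 d n
    have h3 := hCle (n + 1) ((n + 1 : ℕ) - d)
    have hnR : (0 : ℝ) < ((n + 1 : ℕ) : ℝ) := by positivity
    have h4 : C / √(((n + 1 : ℕ) : ℝ) + 1) ≤ C / √((n + 1 : ℕ) : ℝ) :=
      div_le_div_of_nonneg_left hC.le (Real.sqrt_pos.2 hnR) (Real.sqrt_le_sqrt (by linarith))
    have h5 : forestProb p d (n + 1) =
        d * sumProb p (n + 1) ((n + 1 : ℕ) - d) / ((n + 1 : ℕ) : ℝ) := by
      rw [← h2]; field_simp
    rw [Nat.succ_eq_add_one, h5, div_mul_eq_div_div_swap, mul_div_right_comm C, mul_comm _ (d : ℝ)]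
    exact div_le_div_of_nonneg_right (mul_le_mul_of_nonneg_left (h3.trans h4) (by positivity))
      hnR.le
  have htree : ∀ n, 0 < n → 0 < forestProb p 1 n → 1 ≤ c⁻¹ * (n * √n) * forestProb p 1 n := by
    intro n hn hpos
    obtain ⟨n, rfl⟩ := Nat.exists_eq_succ_of_ne_zero hn.ne'
    have h2 := mul_forestProb hi1 1 n
    simp only [Nat.cast_one, one_mul] at h2
    have hnR : (0 : ℝ) < ((n + 1 : ℕ) : ℝ) := by positivity
    have h3 := hcle (n + 1) hn (by rw [← h2]; positivity)
    rw [div_le_iff₀ (Real.sqrt_pos.2 hnR), ← h2] at h3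
    rw [Nat.succ_eq_add_one, mul_assoc, ← div_eq_inv_mul, le_div_iff₀ hc, one_mul]
    linarith
  set K := max (max 1 C) (max c⁻¹ (C * m2 * (4 * c⁻¹))) with hK
  have hKC : C ≤ K := (le_max_right _ _).trans (le_max_left _ _)
  have hKc : c⁻¹ ≤ K := (le_max_left _ _).trans (le_max_right _ _)
  have hKd : C * m2 * (4 * c⁻¹) ≤ K := (le_max_right _ _).trans (le_max_right _ _)
  refine ⟨K, (le_max_left _ _).trans (le_max_left _ _), ?_, ?_, ?_, ?_⟩
  · intro n j
    exact (hCle n j).trans (div_le_div_of_nonneg_right hKC (Real.sqrt_nonneg _))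
  · intro d n hn
    exact (hforest d n hn).trans (div_le_div_of_nonneg_right
      (mul_le_mul_of_nonneg_right hKC (by positivity)) (by positivity))
  · intro n hn hpos
    exact (htree n hn hpos).trans (mul_le_mul_of_nonneg_right
      (mul_le_mul_of_nonneg_right hKc (by positivity)) hpos.le)
  · intro n
    rw [treeSum_one_eq_forestProb]
    rcases (forestProb_nonneg (p := p) 1 n).eq_or_lt with h | hpos
    · rw [treeSum_eq_zero_of_forestProb h.symm, ← h, mul_zero]
    cases n with
    | zero => simp [← treeSum_one_eq_forestProb, treeSum_zero_size] at hpos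
    | succ n =>
      rw [treeSum_rootDegree]
      rcases Nat.eq_zero_or_pos n with rfl | hn
      · have : ∀ a : ℕ, (a : ℝ) * forestProb p a 0 = 0 := by
          intro a
          cases a with
          | zero => simp
          | succ a => simp [forestProb, iidMean]
        simp only [this, integral_zero]
        have : 0 ≤ K := zero_le_one.trans ((le_max_left _ _).trans (le_max_left _ _))
        positivity
      have hnR : (1 : ℝ) ≤ n := by exact_mod_cast hn
      have h2 : ∫ a : ℕ, (a : ℝ) * forestProb p a n ∂p.toMeasure ≤ C / (n * √n) * m2 := by
        rw [hm2, ← integral_const_mul]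
        refine integral_mono ?_ (hi2.const_mul _) fun a => ?_
        · exact hi1.mono (by fun_prop) (.of_forall fun a => by
            rw [norm_mul]
            exact mul_le_of_le_one_right (norm_nonneg _) (abs_forestProb_le_one _ _))
        · dsimp only
          refine (mul_le_mul_of_nonneg_left (hforest a n hn) (by positivity)).trans_eq ?_
          ring
      have h3 := htree (n + 1) (by omega) hpos
      have h4 : (((n + 1 : ℕ) : ℝ) * √((n + 1 : ℕ) : ℝ)) ≤ 4 * (n * √n) := by
        have e1 : ((n + 1 : ℕ) : ℝ) ≤ 2 * n := by push_cast; linarith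
        have e2 : √((n + 1 : ℕ) : ℝ) ≤ 2 * √n := by
          rw [show (2 : ℝ) = √4 by
            rw [show (4 : ℝ) = 2 ^ 2 by norm_num, Real.sqrt_sq (by norm_num)],
            ← Real.sqrt_mul (by norm_num)]
          exact Real.sqrt_le_sqrt (by linarith)
        calc (((n + 1 : ℕ) : ℝ) * √((n + 1 : ℕ) : ℝ)) ≤ (2 * n) * (2 * √n) := by gcongr
          _ = _ := by ring
      have h5 : 1 ≤ c⁻¹ * (4 * (n * √n)) * forestProb p 1 (n + 1) :=
        h3.trans (by gcongr)
      calc _ ≤ C / (n * √n) * m2 := h2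
        _ ≤ C / (n * √n) * m2 * (c⁻¹ * (4 * (n * √n)) * forestProb p 1 (n + 1)) :=
          le_mul_of_one_le_right (by positivity) h5
        _ = C * m2 * (4 * c⁻¹) * forestProb p 1 (n + 1) := by field_simp
        _ ≤ _ := by gcongr

/-! ### Elementary sums -/

theorem sum_one_div_sqrt_le (n : ℕ) : ∑ k ∈ Finset.range n, 1 / √((k : ℝ) + 1) ≤ 2 * √n := by
  induction n with
  | zero => simp
  | succ n ih =>
    rw [Finset.sum_range_succ]
    have h1 : (0 : ℝ) < √((n : ℝ) + 1) := by positivity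
    have h2 := Real.sq_sqrt (show (0 : ℝ) ≤ (n : ℝ) + 1 by positivity)
    have h3 := Real.sq_sqrt (show (0 : ℝ) ≤ (n : ℝ) by positivity)
    have h4 := Real.sqrt_nonneg (n : ℝ)
    have h5 : 1 / √((n : ℝ) + 1) ≤ 2 * √((n : ℝ) + 1) - 2 * √n := by
      rw [div_le_iff₀ h1]
      nlinarith [sq_nonneg (√((n : ℝ) + 1) - √n)]
    push_cast
    linarith

theorem sum_one_div_sqrt_sub_le (n : ℕ) :
    ∑ k ∈ Finset.Icc 1 n, 1 / √(((n - k : ℕ) : ℝ) + 1) ≤ 2 * √n := by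
  refine le_trans (le_of_eq ?_) (sum_one_div_sqrt_le n)
  refine Finset.sum_bij (fun k _ => n - k) ?_ ?_ ?_ ?_
  · intro k hk
    simp only [Finset.mem_Icc, Finset.mem_range] at *
    omega
  · intro k hk k' hk' h
    simp only [Finset.mem_Icc] at *
    omega
  · intro j hj
    simp only [Finset.mem_range] at hj
    exact ⟨n - j, by simp only [Finset.mem_Icc]; omega, by omega⟩
  · intro k _
    rfl

/-- The factor by which the number of fringe subtrees of size `k` in a conditioned tree of size
`n` may exceed its unconditioned order. -/
noncomputable def boundaryFactor (n k : ℕ) : ℝ := √n / √(((n - k : ℕ) : ℝ) + 1)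

theorem boundaryFactor_nonneg (n k : ℕ) : 0 ≤ boundaryFactor n k := by
  unfold boundaryFactor; positivity

theorem sum_boundaryFactor_le (n : ℕ) :
    ∑ k ∈ Finset.Icc 1 n, boundaryFactor n k ≤ 2 * n := by
  have h := mul_le_mul_of_nonneg_left (sum_one_div_sqrt_sub_le n) (Real.sqrt_nonneg n)
  rw [Finset.mul_sum] at h
  simp only [mul_one_div] at h
  refine h.trans_eq ?_
  rw [mul_left_comm, Real.mul_self_sqrt (by positivity)]

theorem boundaryFactor_le_two {n k : ℕ} (h : 2 * k ≤ n) : boundaryFactor n k ≤ 2 := by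
  unfold boundaryFactor
  rw [div_le_iff₀ (by positivity), show (2 : ℝ) = √4 by
    rw [show (4 : ℝ) = 2 ^ 2 by norm_num, Real.sqrt_sq (by norm_num)],
    ← Real.sqrt_mul (by norm_num)]
  refine Real.sqrt_le_sqrt ?_
  have h1 : (n : ℝ) ≤ 2 * ((n - k : ℕ) : ℝ) := by
    exact_mod_cast (by omega : n ≤ 2 * (n - k))
  have : (0 : ℝ) ≤ ((n - k : ℕ) : ℝ) := by positivity
  linarith

section sums
variable {a : ℕ → ℝ} {s S : ℝ}

/-- For `2 k ≤ n` the boundary factor is at most `2` and `a k ≤ n (a k / k)`; for larger `k` one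
uses `a k ≤ s` and the total of the boundary factors. -/
theorem sum_mul_boundaryFactor_le (ha : ∀ k, 0 ≤ a k) (hs : ∀ k, a k ≤ s) {n : ℕ}
    (hS : ∑ k ∈ Finset.Icc 1 n, a k / k ≤ S) :
    ∑ k ∈ Finset.Icc 1 n, a k * boundaryFactor n k ≤ 2 * n * (s + S) := by
  have hs0 : 0 ≤ s := (ha 0).trans (hs 0)
  have hpt : ∀ k ∈ Finset.Icc 1 n, a k * boundaryFactor n k ≤
      2 * n * (a k / k) + s * boundaryFactor n k := by
    intro k hk
    rw [Finset.mem_Icc] at hk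
    have hk0 : (0 : ℝ) < k := by exact_mod_cast hk.1
    have hkn : (k : ℝ) ≤ n := by exact_mod_cast hk.2
    have hb := boundaryFactor_nonneg n k
    have hak := ha k
    by_cases h : 2 * k ≤ n
    · have h1 := mul_le_mul_of_nonneg_left (boundaryFactor_le_two h) hak
      have h2 : a k ≤ n * (a k / k) := by
        rw [mul_div_left_comm]
        exact le_mul_of_one_le_right hak ((one_le_div hk0).2 hkn)
      have h3 := mul_nonneg hs0 hb
      linarith
    · have h1 := mul_le_mul_of_nonneg_right (hs k) hb
      have : 0 ≤ 2 * n * (a k / k) := by positivity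
      linarith
  refine (Finset.sum_le_sum hpt).trans ?_
  rw [Finset.sum_add_distrib, ← Finset.mul_sum, ← Finset.mul_sum]
  have h1 := mul_le_mul_of_nonneg_left (sum_boundaryFactor_le n) hs0
  have h2 := mul_le_mul_of_nonneg_left hS (show (0 : ℝ) ≤ 2 * n by positivity)
  linarith

/-- The same split at `n / 2`; the extra `1 / √k` gains a factor of order `√n` in both ranges. -/
theorem sum_div_sqrt_mul_boundaryFactor_le (ha : ∀ k, 0 ≤ a k) (hs : ∀ k, a k ≤ s) {n : ℕ}
    (hS : ∑ k ∈ Finset.Icc 1 n, a k / k ≤ S) :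
    ∑ k ∈ Finset.Icc 1 n, a k / √k * boundaryFactor n k ≤ 4 * √n * (s + S) := by
  have hs0 : 0 ≤ s := (ha 0).trans (hs 0)
  have hpt : ∀ k ∈ Finset.Icc 1 n, a k / √k * boundaryFactor n k ≤
      2 * √n * (a k / k) + 2 * s * (1 / √(((n - k : ℕ) : ℝ) + 1)) := by
    intro k hk
    rw [Finset.mem_Icc] at hk
    have hk0 : (0 : ℝ) < k := by exact_mod_cast hk.1
    have hkn : (k : ℝ) ≤ n := by exact_mod_cast hk.2
    have hsk : 0 < √(k : ℝ) := Real.sqrt_pos.2 hk0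
    have hak := ha k
    by_cases h : 2 * k ≤ n
    · have h1 := mul_le_mul_of_nonneg_left (boundaryFactor_le_two h)
        (show 0 ≤ a k / √k by positivity)
      have h2 : a k / √k ≤ √n * (a k / k) := by
        have e : a k / √k = √k * (a k / k) := by
          nth_rewrite 3 [← Real.mul_self_sqrt hk0.le]
          field_simp
        rw [e]
        exact mul_le_mul_of_nonneg_right (Real.sqrt_le_sqrt hkn) (by positivity)
      have h3 : 0 ≤ 2 * s * (1 / √(((n - k : ℕ) : ℝ) + 1)) := by positivity
      linarith
    · have h1 : √(n : ℝ) ≤ 2 * √k := by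
        rw [show (2 : ℝ) = √4 by
          rw [show (4 : ℝ) = 2 ^ 2 by norm_num, Real.sqrt_sq (by norm_num)],
          ← Real.sqrt_mul (by norm_num)]
        refine Real.sqrt_le_sqrt ?_
        have : (n : ℝ) ≤ 2 * k := by exact_mod_cast (by omega : n ≤ 2 * k)
        linarith
      have h2 : a k / √k * boundaryFactor n k =
          a k * (√n / √k) * (1 / √(((n - k : ℕ) : ℝ) + 1)) := by
        unfold boundaryFactor; ring
      have h3 : √(n : ℝ) / √k ≤ 2 := (div_le_iff₀ hsk).2 h1
      have h4 : a k * (√n / √k) ≤ s * 2 := mul_le_mul (hs k) h3 (by positivity) hs0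
      rw [h2]
      have h5 := mul_le_mul_of_nonneg_right h4
        (show 0 ≤ 1 / √(((n - k : ℕ) : ℝ) + 1) by positivity)
      have : 0 ≤ 2 * √n * (a k / k) := by positivity
      linarith
  refine (Finset.sum_le_sum hpt).trans ?_
  rw [Finset.sum_add_distrib, ← Finset.mul_sum, ← Finset.mul_sum]
  have h1 := mul_le_mul_of_nonneg_left (sum_one_div_sqrt_sub_le n) (show 0 ≤ 2 * s by positivity)
  have h2 := mul_le_mul_of_nonneg_left hS (show (0 : ℝ) ≤ 2 * √n by positivity)
  have h3 : 0 ≤ S * √n := mul_nonneg ((Finset.sum_nonneg fun k _ =>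
    div_nonneg (ha k) (by positivity)).trans hS) (Real.sqrt_nonneg _)
  linarith

/-- The expected number of fringe subtrees of given size in a conditioned tree. -/
theorem LocalBounds.treeSum_additive_size_le {p : PMF ℕ} {C : ℝ} (hC : LocalBounds p C)
    (ha : ∀ k, 0 ≤ a k) (n : ℕ) :
    treeSum p n (additive fun T => a T.size) ≤
      C ^ 3 * n * (∑ k ∈ Finset.Icc 1 n, a k / (k * √k) * boundaryFactor n k) *
        treeSum p n fun _ => 1 := by
  have hC0 : 0 ≤ C := zero_le_one.trans hC.one_le
  rw [treeSum_one_eq_forestProb]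
  rcases (forestProb_nonneg (p := p) 1 n).eq_or_lt with h | hpos
  · rw [treeSum_eq_zero_of_forestProb h.symm, ← h, mul_zero]
  rcases Nat.eq_zero_or_pos n with rfl | hn
  · simp [treeSum_zero_size]
  refine (PlaneTree.treeSum_additive_size_le ha n).trans ?_
  have h1 : ∑ k ∈ Finset.Icc 1 n, a k * (forestProb p 1 k * sumProb p (n - k) (n - k : ℕ)) ≤
      ∑ k ∈ Finset.Icc 1 n, a k * (C / (k * √k) * (C / √(((n - k : ℕ) : ℝ) + 1))) := by
    refine Finset.sum_le_sum fun k hk => mul_le_mul_of_nonneg_left ?_ (ha k)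
    have hk := (Finset.mem_Icc.1 hk).1
    refine mul_le_mul ?_ (hC.sumProb_le _ _) (sumProb_nonneg _ _) (by positivity)
    simpa using hC.forestProb_le 1 k hk
  refine h1.trans ?_
  -- The inserted factor `C n^(3/2) ℙ(|𝒯| = n) ≥ 1` supplies the total weight on the right-hand
  -- side.
  have h2 := le_mul_of_one_le_right (Finset.sum_nonneg fun k (_ : k ∈ Finset.Icc 1 n) =>
    mul_nonneg (ha k) (show 0 ≤ C / (k * √k) * (C / √(((n - k : ℕ) : ℝ) + 1)) by positivity))
    (hC.le_treeProb n hn hpos)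
  refine h2.trans_eq ?_
  simp only [Finset.mul_sum, Finset.sum_mul]
  refine Finset.sum_congr rfl fun k _ => ?_
  unfold boundaryFactor
  ring

/-- The terms are `k^(-5/4)`, which is summable, times a boundary factor that matters only for `2 k
> n`, where `k^(-5/4) ≤ 2 / n`. Any exponent below `1/2` in place of `1/4` would serve. -/
theorem exists_sum_rpow_mul_boundaryFactor_le : ∃ K : ℝ, 0 ≤ K ∧ ∀ n : ℕ,
    ∑ k ∈ Finset.Icc 1 n, (k : ℝ) ^ (1 / 4 : ℝ) / (k * √k) * boundaryFactor n k ≤ K := by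
  have hsum : Summable fun k : ℕ => 1 / (k : ℝ) ^ (5 / 4 : ℝ) :=
    Real.summable_one_div_nat_rpow.2 (by norm_num)
  refine ⟨2 * (∑' k : ℕ, 1 / (k : ℝ) ^ (5 / 4 : ℝ)) + 4, by positivity, fun n => ?_⟩
  have hpt : ∀ k ∈ Finset.Icc 1 n, (k : ℝ) ^ (1 / 4 : ℝ) / (k * √k) * boundaryFactor n k ≤
      2 * (1 / (k : ℝ) ^ (5 / 4 : ℝ)) + 2 / n * boundaryFactor n k := by
    intro k hk
    rw [Finset.mem_Icc] at hk
    have hk1 : (1 : ℝ) ≤ k := by exact_mod_cast hk.1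
    have hk0 : (0 : ℝ) < k := by linarith
    have hn0 : (0 : ℝ) < n := by
      have : 0 < n := by omega
      exact_mod_cast this
    have hb := boundaryFactor_nonneg n k
    have e : (k : ℝ) ^ (1 / 4 : ℝ) / (k * √k) = 1 / (k : ℝ) ^ (5 / 4 : ℝ) := by
      rw [Real.sqrt_eq_rpow, div_eq_div_iff (by positivity) (by positivity), one_mul,
        ← Real.rpow_add hk0]
      nth_rewrite 2 [← Real.rpow_one (k : ℝ)]
      rw [← Real.rpow_add hk0]
      norm_num
    rw [e]
    by_cases h : 2 * k ≤ n
    · have h1 := mul_le_mul_of_nonneg_left (boundaryFactor_le_two h)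
        (show 0 ≤ 1 / (k : ℝ) ^ (5 / 4 : ℝ) by positivity)
      have h3 : 0 ≤ 2 / n * boundaryFactor n k := by positivity
      linarith
    · have h1 : 1 / (k : ℝ) ^ (5 / 4 : ℝ) ≤ 1 / k := by
        refine one_div_le_one_div_of_le hk0 ?_
        nth_rewrite 1 [← Real.rpow_one (k : ℝ)]
        exact Real.rpow_le_rpow_of_exponent_le hk1 (by norm_num)
      have h2 : 1 / (k : ℝ) ≤ 2 / n := by
        rw [div_le_div_iff₀ hk0 hn0]
        have : (n : ℝ) ≤ 2 * k := by exact_mod_cast (by omega : n ≤ 2 * k)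
        linarith
      have h3 := mul_le_mul_of_nonneg_right (h1.trans h2) hb
      have : 0 ≤ 2 * (1 / (k : ℝ) ^ (5 / 4 : ℝ)) := by positivity
      linarith
  refine (Finset.sum_le_sum hpt).trans ?_
  rw [Finset.sum_add_distrib, ← Finset.mul_sum, ← Finset.mul_sum]
  have h1 : ∑ k ∈ Finset.Icc 1 n, 1 / (k : ℝ) ^ (5 / 4 : ℝ) ≤ ∑' k : ℕ, 1 / (k : ℝ) ^ (5 / 4 : ℝ) :=
    hsum.sum_le_tsum _ fun k _ => by positivity
  have h2 : 2 / (n : ℝ) * ∑ k ∈ Finset.Icc 1 n, boundaryFactor n k ≤ 4 := by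
    rcases Nat.eq_zero_or_pos n with rfl | hn
    · simp
    have hn0 : (0 : ℝ) < n := by exact_mod_cast hn
    refine (mul_le_mul_of_nonneg_left (sum_boundaryFactor_le n) (by positivity)).trans_eq ?_
    field_simp
    norm_num
  linarith

end sums

end PlaneTree

namespace PlaneTree

/-! ### Cutting words -/

section crossing
variable {μ h : ℕ → ℝ}

/-- The sum over the complete trees in `u ++ v` that begin in `u` and end in `v`. -/
def crossing (μ : ℕ → ℝ) (u v : List ℕ) : ℝ :=
  wordSum μ (u ++ v) - wordSum μ u - wordSum μ v

theorem crossing_nil_left (v : List ℕ) : crossing μ [] v = 0 := by simp [crossing, wordSum]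

theorem crossing_cons (a : ℕ) (u v : List ℕ) : crossing μ (a :: u) v =
    (toll μ (a :: (u ++ v)) - toll μ (a :: u)) + crossing μ u v := by
  simp only [crossing, List.cons_append, wordSum]; ring

/-- Appending letters changes nothing if the first tree is already complete in `u`; otherwise the
toll of `u` is zero. -/
theorem abs_toll_append_sub_le (u v : List ℕ) : |toll μ (u ++ v) - toll μ u| ≤
    toll (fun k => |μ k|) (u ++ v) - toll (fun k => |μ k|) u := by
  cases hu : pass 1 u with
  | none =>
    have : ∀ μ, toll μ u = 0 := fun μ => by rw [toll, hu]; rfl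
    rw [this, this, sub_zero, sub_zero, abs_toll]
  | some j => simp [toll_append_of_pass v hu]

theorem abs_crossing_le (u v : List ℕ) : |crossing μ u v| ≤ crossing (fun k => |μ k|) u v := by
  induction u with
  | nil => simp [crossing_nil_left]
  | cons a u ih =>
    rw [crossing_cons, crossing_cons]
    exact (abs_add_le _ _).trans (add_le_add (abs_toll_append_sub_le (a :: u) v) ih)

theorem toll_le_toll_append (hh : ∀ k, 0 ≤ h k) (u v : List ℕ) : toll h u ≤ toll h (u ++ v) := by
  cases hu : pass 1 u with
  | none =>
    have : toll h u = 0 := by rw [toll, hu]; rfl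
    rw [this]
    exact toll_nonneg hh _
  | some j => rw [toll_append_of_pass v hu]

/-- For nonnegative tolls this extends the left part back to the start of the word, so that both
cutting errors become values of one function of the cut position. -/
theorem crossing_le_crossing_append (hh : ∀ k, 0 ≤ h k) (u m v : List ℕ) :
    crossing h m v ≤ crossing h (u ++ m) v := by
  induction u with
  | nil => rfl
  | cons a u ih =>
    rw [List.cons_append, crossing_cons, List.append_assoc]
    have := toll_le_toll_append hh (a :: (u ++ m)) v
    simp only [List.cons_append, List.append_assoc] at this
    linarith

/-- No tree crosses the end of a suffix of the word of a tree. -/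
theorem crossing_eq_zero {v : List ℕ} (hv : ∀ c < v.length, ∃ j, pass 1 (v.drop c) = some j)
    (u : List ℕ) : crossing μ v u = 0 := by
  induction v with
  | nil => exact crossing_nil_left u
  | cons a v ih =>
    rw [crossing_cons, ih fun c hc => by
      have := hv (c + 1) (by simpa using hc)
      simpa using this]
    obtain ⟨j, hj⟩ := hv 0 (by simp)
    rw [List.drop_zero] at hj
    rw [← List.cons_append, toll_append_of_pass u hj]
    ring

theorem crossing_suffix_eq_zero {T : PlaneTree} {u v : List ℕ} (hT : word T = u ++ v)
    (w : List ℕ) : crossing μ v w = 0 := by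
  refine crossing_eq_zero (fun c hc => ?_) w
  have := pass_drop_of_pass (d := 1) (l := word T) (c := u.length + c)
    (by simpa using pass_one_word T) (by rw [hT]; simpa using hc)
  rwa [hT, List.drop_length_add_append] at this

/-- Joining `v` to `u` cyclically creates no new tree, as the trees starting in the suffix `v` are
complete. Hence only trees crossing the two ends of `m` are lost. -/
theorem abs_additive_sub_wordSum_le {T : PlaneTree} {u m v : List ℕ}
    (hT : word T = u ++ (m ++ v)) :
    |additive (fun T => μ T.size) T - wordSum μ m - wordSum μ (v ++ u)| ≤
      crossing (fun k => |μ k|) u (m ++ v) + crossing (fun k => |μ k|) (u ++ m) v := by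
  have h1 := crossing_suffix_eq_zero (μ := μ) (u := u ++ m) (v := v) (by rw [hT]; simp) u
  have h2 : additive (fun T => μ T.size) T - wordSum μ m - wordSum μ (v ++ u) =
      crossing μ u (m ++ v) + crossing μ m v := by
    rw [← wordSum_word, hT]
    simp only [crossing] at h1 ⊢
    linarith
  rw [h2]
  refine (abs_add_le _ _).trans (add_le_add (abs_crossing_le _ _) ((abs_crossing_le _ _).trans ?_))
  exact crossing_le_crossing_append (fun k => abs_nonneg _) u m v

/-- Cutting the cyclically rotated word of a tree into two parts. -/
theorem abs_additive_sub_wordSum_rotate_le (T : PlaneTree) {c L : ℕ} (hc : c < T.size)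
    (hL : L ≤ T.size) :
    |additive (fun T => μ T.size) T - wordSum μ (((word T).rotate c).take L) -
        wordSum μ (((word T).rotate c).drop L)| ≤
      crossing (fun k => |μ k|) ((word T).take c) ((word T).drop c) +
      crossing (fun k => |μ k|) ((word T).take ((c + L) % T.size))
        ((word T).drop ((c + L) % T.size)) := by
  have hlen := length_word T
  rw [List.rotate_eq_drop_append_take (by omega)]
  by_cases hcL : c + L < T.size
  · rw [Nat.mod_eq_of_lt hcL]
    obtain ⟨u, m, v, hw, hu, hm⟩ : ∃ u m v, word T = u ++ (m ++ v) ∧ u.length = c ∧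
        m.length = L := by
      refine ⟨(word T).take c, ((word T).drop c).take L, ((word T).drop c).drop L, by simp, ?_, ?_⟩
      · simp; omega
      · simp; omega
    have key := abs_additive_sub_wordSum_le (μ := μ) hw
    rw [hw]
    have e1 : (u ++ (m ++ v)).take c = u := by rw [List.take_left' hu]
    have e2 : (u ++ (m ++ v)).drop c = m ++ v := by rw [List.drop_left' hu]
    have e3 : (u ++ (m ++ v)).take (c + L) = u ++ m := by
      rw [← List.append_assoc, List.take_left' (by simp [hu, hm])]
    have e4 : (u ++ (m ++ v)).drop (c + L) = v := by
      rw [← List.append_assoc, List.drop_left' (by simp [hu, hm])]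
    rw [e1, e2, e3, e4, List.append_assoc, List.take_left' hm, List.drop_left' hm]
    exact key
  -- Here the block of length `L` wraps round the end of the word; its complement is the interval
  -- from `c'` to `c`, so block and complement exchange roles.
  · obtain ⟨c', hc'⟩ := Nat.exists_eq_add_of_le (not_lt.1 hcL)
    have hmod : (c + L) % T.size = c' := by
      rw [hc', Nat.add_mod_left, Nat.mod_eq_of_lt (by omega)]
    rw [hmod]
    obtain ⟨u, m, v, hw, hu, hm⟩ : ∃ u m v, word T = u ++ (m ++ v) ∧ u.length = c' ∧
        m.length = c - c' := by
      refine ⟨(word T).take c', ((word T).drop c').take (c - c'),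
        ((word T).drop c').drop (c - c'), by simp, ?_, ?_⟩
      · simp; omega
      · simp; omega
    have hv : c + v.length = T.size := by
      rw [← hlen, hw]
      simp
      omega
    have key := abs_additive_sub_wordSum_le (μ := μ) hw
    rw [hw]
    have e1 : (u ++ (m ++ v)).take c' = u := by rw [List.take_left' hu]
    have e2 : (u ++ (m ++ v)).drop c' = m ++ v := by rw [List.drop_left' hu]
    have e3 : (u ++ (m ++ v)).take c = u ++ m := by
      rw [← List.append_assoc, List.take_left' (by simp [hu, hm]; omega)]
    have e4 : (u ++ (m ++ v)).drop c = v := by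
      rw [← List.append_assoc, List.drop_left' (by simp [hu, hm]; omega)]
    have hL' : (v ++ u).length = L := by simp; omega
    rw [e1, e2, e3, e4, ← List.append_assoc, List.take_left' hL', List.drop_left' hL',
      sub_right_comm, add_comm]
    exact key

/-- The sum over all cuts of the word of `T` of a function of the contribution of the trees that
cross the cut. -/
noncomputable def cutSum (h : ℕ → ℝ) (φ : ℝ → ℝ) (T : PlaneTree) : ℝ :=
  ∑ c ∈ Finset.range T.size, φ (crossing h ((word T).take c) ((word T).drop c))

/-- A cut inside the word of one tree of a forest is crossed by no other tree of the forest. -/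
theorem sum_crossing_forest (φ : ℝ → ℝ) (ts : List PlaneTree) :
    ∑ c ∈ Finset.range (ts.map size).sum, φ (crossing h ((ts.map word).flatten.take c)
      ((ts.map word).flatten.drop c)) = (ts.map (cutSum h φ)).sum := by
  induction ts with
  | nil => simp
  | cons T ts ih =>
    simp only [List.map_cons, List.sum_cons, List.flatten_cons]
    rw [Finset.sum_range_add, ← ih, cutSum]
    set W := (ts.map word).flatten
    have hlen := length_word T
    congr 1
    · refine Finset.sum_congr rfl fun c hc => ?_
      have hc := Finset.mem_range.1 hc
      rw [List.take_append_of_le_length (by omega), List.drop_append_of_le_length (by omega)]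
      congr 1
      have h1 := crossing_suffix_eq_zero (μ := h) (List.take_append_drop c (word T)).symm W
      simp only [crossing, ← List.append_assoc, List.take_append_drop] at h1 ⊢
      rw [wordSum_word_append, wordSum_word]
      linarith
    · refine Finset.sum_congr rfl fun c hc => ?_
      rw [← hlen, List.take_length_add_append, List.drop_length_add_append]
      congr 1
      simp only [crossing, List.append_assoc, wordSum_word_append]
      ring

/-- Every cut except the one before the root crosses the whole tree, so in the branches the argument
of `φ` is shifted by the root toll. A general `φ` is carried along to allow this shift. -/
theorem cutSum_node (φ : ℝ → ℝ) (d : ℕ) (c : Fin d → PlaneTree) :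
    cutSum h φ (node d c) =
      φ 0 + ∑ i, cutSum h (fun x => φ (h (node d c).size + x)) (c i) := by
  have h1 := sum_crossing_forest (h := h) (fun x => φ (h (node d c).size + x)) (List.ofFn c)
  simp only [List.map_ofFn, List.sum_ofFn, Function.comp_apply] at h1
  have h2 : word (node d c) = _ := word_node d c
  have h3 := pass_one_word (node d c)
  have hlen := length_word (node d c)
  rw [List.map_ofFn] at h2
  set W := (List.ofFn (word ∘ c)).flatten with hW
  rw [← h1, cutSum]
  have h4 : (node d c).size = (∑ i, (c i).size) + 1 := by rw [size_node, add_comm]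
  rw [Finset.sum_congr (congrArg Finset.range h4) fun _ _ => rfl, Finset.sum_range_succ', add_comm]
  congr 1
  · simp [crossing_nil_left]
  · refine Finset.sum_congr rfl fun i hi => ?_
    have hi := Finset.mem_range.1 hi
    rw [h2, List.take_succ_cons, List.drop_succ_cons, crossing_cons, List.take_append_drop]
    congr 2
    have h5 : toll h (d :: W) = h (node d c).size := by rw [toll, ← h2, h3]; rfl
    have h6 : toll h (d :: W.take i) = 0 := by
      cases hp : pass 1 (d :: W.take i) with
      | none => rw [toll, hp]; rfl
      | some j =>
        exfalso
        have h7 := pass_append_of_some (W.drop i) hp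
        rw [List.cons_append, List.take_append_drop, ← h2, h3, Option.some_inj] at h7
        have h8 := (pass_spec hp).1
        simp only [List.length_cons, List.length_take] at h8
        omega
    rw [h5, h6, sub_zero]

/-- A fringe subtree with `k` nodes is crossed by `k - 1` cuts. -/
theorem cutSum_id_le (hh : ∀ k, 0 ≤ h k) (T : PlaneTree) :
    cutSum h (fun x => x) T ≤ additive (fun T => h T.size * T.size) T := by
  induction T with
  | node d c ih =>
    rw [cutSum_node, additive_node, zero_add]
    have h1 : ∀ i, cutSum h (fun x => h (node d c).size + x) (c i) =
        h (node d c).size * (c i).size + cutSum h (fun x => x) (c i) := by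
      intro i
      simp only [cutSum, Finset.sum_add_distrib, Finset.sum_const, Finset.card_range,
        nsmul_eq_mul, mul_comm]
    simp only [h1, Finset.sum_add_distrib]
    refine add_le_add ?_ (Finset.sum_le_sum fun i _ => ih i)
    rw [← Finset.mul_sum]
    refine mul_le_mul_of_nonneg_left ?_ (hh _)
    rw [size_node]
    push_cast
    linarith

/-- Trees crossing the same cut are nested. A pair consisting of an outer tree and a smaller one
inside it is counted at most as often as the size of the inner one; the outer tree is the node of
the outer sum. -/
theorem cutSum_sq_le (hh : ∀ k, 0 ≤ h k) (T : PlaneTree) :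
    cutSum h (fun x => x ^ 2) T ≤ additive (fun T => h T.size ^ 2 * T.size +
      2 * h T.size * additive (fun T => h T.size * T.size) T) T := by
  induction T with
  | node d c ih =>
    rw [cutSum_node, additive_node]
    set H := h (node d c).size with hH
    have hH0 : 0 ≤ H := hh _
    have h1 : ∀ i, cutSum h (fun x => (H + x) ^ 2) (c i) =
        H ^ 2 * (c i).size + 2 * H * cutSum h (fun x => x) (c i) +
          cutSum h (fun x => x ^ 2) (c i) := by
      intro i
      simp only [cutSum, add_sq, Finset.sum_add_distrib, Finset.sum_const, Finset.card_range,
        nsmul_eq_mul, Finset.mul_sum]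
      ring
    simp only [h1, Finset.sum_add_distrib]
    have h2 : H ^ 2 * ∑ i, ((c i).size : ℝ) ≤ H ^ 2 * ((node d c).size : ℝ) := by
      refine mul_le_mul_of_nonneg_left ?_ (sq_nonneg _)
      rw [size_node]
      push_cast
      linarith
    have h3 : 2 * H * ∑ i, cutSum h (fun x => x) (c i) ≤
        2 * H * additive (fun T => h T.size * T.size) (node d c) := by
      refine mul_le_mul_of_nonneg_left ?_ (by positivity)
      rw [additive_node]
      have h4 := Finset.sum_le_sum fun i (_ : i ∈ Finset.univ) => cutSum_id_le hh (c i)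
      have h5 : 0 ≤ h (node d c).size * ((node d c).size : ℝ) := mul_nonneg (hh _) (by positivity)
      linarith
    have h6 := Finset.sum_le_sum fun i (_ : i ∈ Finset.univ) => ih i
    rw [Finset.mul_sum] at h2 h3
    linarith

variable {s S : ℝ}

/-- The fringe count is applied twice. The inner functional has conditional mean at most `4 C³
k^(3/2) (s + S)` at size `k`, so the outer toll may be replaced by `(1 + 8) C³ (s + S) h k^(3/2)`,
and the outer sum contributes `2 C³ n² (s + S)`. -/
theorem LocalBounds.treeSum_cutSum_sq_le {p : PMF ℕ} {C : ℝ} (hC : LocalBounds p C)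
    (hh : ∀ k, 0 ≤ h k) (hs : ∀ k, h k ≤ s) (hS : ∀ n, ∑ k ∈ Finset.Icc 1 n, h k / k ≤ S) (n : ℕ) :
    treeSum p n (cutSum h fun x => x ^ 2) ≤
      18 * C ^ 6 * n ^ 2 * (s + S) ^ 2 * treeSum p n fun _ => 1 := by
  have hC1 := hC.one_le
  have hC0 : 0 ≤ C := zero_le_one.trans hC1
  have hs0 : 0 ≤ s := (hh 0).trans (hs 0)
  have hS0 : 0 ≤ S := by simpa using hS 0
  have hC3 : 1 ≤ C ^ 3 := one_le_pow₀ hC1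
  have h1 : ∀ k : ℕ, treeSum p k (additive fun T => h T.size * T.size) ≤
      4 * C ^ 3 * (k * √k) * (s + S) * treeSum p k fun _ => 1 := by
    intro k
    have h2 := hC.treeSum_additive_size_le (a := fun k => h k * k)
      (fun k => mul_nonneg (hh k) (by positivity)) k
    refine h2.trans (mul_le_mul_of_nonneg_right ?_ (treeSum_nonneg fun _ _ => zero_le_one))
    have h3 : ∑ j ∈ Finset.Icc 1 k, h j * j / (j * √j) * boundaryFactor k j =
        ∑ j ∈ Finset.Icc 1 k, h j / √j * boundaryFactor k j := by
      refine Finset.sum_congr rfl fun j hj => ?_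
      have : (0 : ℝ) < j := by exact_mod_cast (Finset.mem_Icc.1 hj).1
      congr 1
      field_simp
    rw [h3]
    have h4 := mul_le_mul_of_nonneg_left (sum_div_sqrt_mul_boundaryFactor_le hh hs (hS k))
      (show 0 ≤ C ^ 3 * (k : ℝ) by positivity)
    refine h4.trans_eq (by ring)
  have h2 : ∀ k : ℕ, treeSum p k (fun T => h T.size ^ 2 * T.size +
      2 * h T.size * additive (fun T => h T.size * T.size) T) ≤
      treeSum p k fun T => 9 * C ^ 3 * (s + S) * (h T.size * (T.size * √T.size)) := by
    intro k
    have e : treeSum p k (fun T => h T.size ^ 2 * T.size +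
        2 * h T.size * additive (fun T => h T.size * T.size) T) =
        (h k ^ 2 * k) * treeSum p k (fun _ => 1) +
          2 * h k * treeSum p k (additive fun T => h T.size * T.size) := by
      rw [← treeSum_const_mul, ← treeSum_const_mul, ← treeSum_add]
      exact treeSum_congr fun T hT => by rw [hT]; ring
    have e' : treeSum p k (fun T => 9 * C ^ 3 * (s + S) * (h T.size * (T.size * √T.size))) =
        9 * C ^ 3 * (s + S) * (h k * (k * √k)) * treeSum p k fun _ => 1 := by
      rw [← treeSum_const_mul]
      exact treeSum_congr fun T hT => by rw [hT]; ring
    rw [e, e']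
    have hhk := hh k
    have hπ : 0 ≤ treeSum p k fun _ => 1 := treeSum_nonneg fun _ _ => zero_le_one
    have h3 := mul_le_mul_of_nonneg_left (h1 k) (show 0 ≤ 2 * h k by positivity)
    have h4 : h k ^ 2 * k ≤ C ^ 3 * (s + S) * (h k * (k * √k)) := by
      rcases Nat.eq_zero_or_pos k with rfl | hk
      · simp
      have hk1 : 1 ≤ √(k : ℝ) := Real.one_le_sqrt.2 (by exact_mod_cast hk)
      calc h k ^ 2 * k = h k * (h k * (k * 1)) := by ring
        _ ≤ (C ^ 3 * (s + S)) * (h k * (k * √k)) := by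
          refine mul_le_mul ?_ ?_ (by positivity) (by positivity)
          · have := hs k
            nlinarith
          · gcongr
    have h5 := mul_le_mul_of_nonneg_right h4 hπ
    linarith
  refine (treeSum_mono fun T _ => cutSum_sq_le hh T).trans ((treeSum_additive_le h2 n).trans ?_)
  have h3 := hC.treeSum_additive_size_le (a := fun k => 9 * C ^ 3 * (s + S) * (h k * (k * √k)))
    (fun k => mul_nonneg (by positivity) (mul_nonneg (hh k) (by positivity))) n
  refine h3.trans (mul_le_mul_of_nonneg_right ?_ (treeSum_nonneg fun _ _ => zero_le_one))
  have h4 : ∑ k ∈ Finset.Icc 1 n, 9 * C ^ 3 * (s + S) * (h k * (k * √k)) / (k * √k) *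
      boundaryFactor n k = 9 * C ^ 3 * (s + S) * ∑ k ∈ Finset.Icc 1 n, h k * boundaryFactor n k := by
    rw [Finset.mul_sum]
    refine Finset.sum_congr rfl fun k hk => ?_
    have : (0 : ℝ) < k := by exact_mod_cast (Finset.mem_Icc.1 hk).1
    field_simp
  rw [h4]
  have h5 := mul_le_mul_of_nonneg_left (sum_mul_boundaryFactor_le hh hs (hS n))
    (show 0 ≤ C ^ 3 * (n : ℝ) * (9 * C ^ 3 * (s + S)) by positivity)
  refine le_trans (le_of_eq (by ring)) (h5.trans_eq (by ring))

end crossing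

end PlaneTree

namespace PlaneTree

/-! ### Comparison of conditioned trees with independent letters -/

section compare
variable {p : PMF ℕ} {μ : ℕ → ℝ} {C s S : ℝ}

theorem abs_wordSum_le (hs : ∀ k, |μ k| ≤ s) (l : List ℕ) : |wordSum μ l| ≤ l.length * s := by
  rw [wordSum_eq_sum]
  refine (Finset.abs_sum_le_sum_abs _ _).trans
    ((Finset.sum_le_sum fun c _ => abs_toll_le hs _).trans_eq ?_)
  simp

theorem bddOn_wordSum (hs : ∀ k, |μ k| ≤ s) (n : ℕ) : BddOn n (wordSum μ) :=
  ⟨n * s, fun l hl => by simpa [hl] using abs_wordSum_le hs l⟩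

/-- The mean of `wordSum` for independent letters. -/
noncomputable def wordMean (p : PMF ℕ) (μ : ℕ → ℝ) (n : ℕ) : ℝ := iidMean p n (wordSum μ)

/-- The variance of `wordSum` for independent letters. -/
noncomputable def wordVar (p : PMF ℕ) (μ : ℕ → ℝ) (n : ℕ) : ℝ :=
  iidMean p n fun l => (wordSum μ l - wordMean p μ n) ^ 2

theorem wordVar_nonneg (n : ℕ) : 0 ≤ wordVar p μ n := iidMean_nonneg fun _ _ => sq_nonneg _

theorem sum_range_add_mod {n L : ℕ} (hL : L ≤ n) (g : ℕ → ℝ) :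
    ∑ c ∈ Finset.range n, g ((c + L) % n) = ∑ c ∈ Finset.range n, g c := by
  obtain ⟨m, rfl⟩ := Nat.exists_eq_add_of_le hL
  rw [Finset.sum_range_add g L m, add_comm L m, Finset.sum_range_add, add_comm]
  congr 1
  · refine Finset.sum_congr rfl fun c hc => ?_
    have := Finset.mem_range.1 hc
    rw [show m + c + L = (m + L) + c by ring, Nat.add_mod_left, Nat.mod_eq_of_lt (by omega)]
  · refine Finset.sum_congr rfl fun c hc => ?_
    have := Finset.mem_range.1 hc
    rw [Nat.mod_eq_of_lt (by omega), add_comm]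

/-- A block of a uniformly rotated tree word is dominated by independent letters. -/
theorem LocalBounds.treeSum_take_rotate_le (hC : LocalBounds p C) {n L : ℕ} (hL : L ≤ n)
    {Ψ : List ℕ → ℝ} (hΨ : BddOn L Ψ) (h0 : ∀ l, 0 ≤ Ψ l) :
    treeSum p n (fun T => ∑ c ∈ Finset.range n, Ψ (((word T).rotate c).take L)) ≤
      iidMean p L Ψ * (C / √(((n - L : ℕ) : ℝ) + 1)) := by
  have hb : BddOn n fun l => Ψ (l.take L) := by
    obtain ⟨B, hB⟩ := hΨ
    exact ⟨B, fun l hl => hB _ (by simp [hl, hL])⟩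
  refine (treeSum_rotate_le hb fun l _ => h0 _).trans ?_
  obtain ⟨m, rfl⟩ := Nat.exists_eq_add_of_le hL
  rw [iidMean_append, add_tsub_cancel_left, ← iidMean_mul_const]
  have e : ∀ u : List ℕ, u.length = L → iidMean p m (fun v =>
      if (u ++ v).sum + 1 = L + m then Ψ ((u ++ v).take L) else 0) =
      Ψ u * sumProb p m ((L + m : ℕ) - 1 - u.sum) := by
    intro u hu
    rw [sumProb, ← iidMean_const_mul]
    refine iidMean_congr fun v _ => ?_
    rw [List.take_left' hu, mul_ite, mul_one, mul_zero, List.sum_append]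
    congr 1
    rw [eq_iff_iff]
    omega
  rw [iidMean_congr e]
  refine iidMean_mono ?_ (hΨ.mul (bddOn_const _)) fun u _ =>
    mul_le_mul_of_nonneg_left (hC.sumProb_le _ _) (h0 u)
  exact hΨ.mul ⟨1, fun u _ => abs_sumProb_le_one _ _⟩

/-- The final part of one rotation is the initial part of another, so both halves are treated as
initial blocks. -/
theorem sum_drop_rotate {T : PlaneTree} {n L : ℕ} (hT : T.size = n) (hL : L ≤ n)
    (Ψ : List ℕ → ℝ) :
    ∑ c ∈ Finset.range n, Ψ (((word T).rotate c).drop L) =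
      ∑ c ∈ Finset.range n, Ψ (((word T).rotate c).take (n - L)) := by
  rw [← sum_range_add_mod hL fun c => Ψ (((word T).rotate c).take (n - L))]
  refine Finset.sum_congr rfl fun c _ => ?_
  have hlen := length_word T
  have e : (word T).rotate ((c + L) % n) = ((word T).rotate c).rotate L := by
    rw [List.rotate_rotate, ← List.rotate_mod (word T) (c + L), hlen, hT]
  rw [e, List.rotate_eq_drop_append_take (l := (word T).rotate c) (n := L) (by simp; omega), List.take_left' (by simp; omega)]

/-- The price of conditioning on the letter sum is of order `n^(-1/2)`, as is `n ℙ(|𝒯| = n)`, with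
`n` the number of rotations. -/
theorem LocalBounds.div_sqrt_le (hC : LocalBounds p C) {n m : ℕ} (hn : 0 < n)
    (hpos : 0 < forestProb p 1 n) (hm : n ≤ 2 * (m + 1)) :
    C / √((m : ℝ) + 1) ≤ 2 * C ^ 2 * n * treeSum p n fun _ => 1 := by
  have hC0 : 0 ≤ C := zero_le_one.trans hC.one_le
  rw [treeSum_one_eq_forestProb]
  have h1 := hC.le_treeProb n hn hpos
  have h2 : √(n : ℝ) ≤ 2 * √((m : ℝ) + 1) := by
    rw [show (2 : ℝ) = √4 by
      rw [show (4 : ℝ) = 2 ^ 2 by norm_num, Real.sqrt_sq (by norm_num)],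
      ← Real.sqrt_mul (by norm_num)]
    refine Real.sqrt_le_sqrt ?_
    have : (n : ℝ) ≤ 2 * (m + 1) := by exact_mod_cast hm
    linarith
  have h3 : 0 < √((m : ℝ) + 1) := by positivity
  rw [div_le_iff₀ h3]
  calc C ≤ C * (C * (n * √n) * forestProb p 1 n) := le_mul_of_one_le_right hC0 h1
    _ ≤ C * (C * (n * (2 * √((m : ℝ) + 1))) * forestProb p 1 n) := by gcongr
    _ = _ := by ring

/-- The second moment of an additive functional of a conditioned tree whose toll depends only on
the size, compared with independent letters. -/
theorem LocalBounds.treeSum_sq_le (hC : LocalBounds p C) (hs : ∀ k, |μ k| ≤ s)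
    (hS : ∀ n, ∑ k ∈ Finset.Icc 1 n, |μ k| / k ≤ S) {n : ℕ} (hn : 0 < n) :
    treeSum p n (fun T => (additive (fun T => μ T.size) T - wordMean p μ (n / 2) -
        wordMean p μ (n - n / 2)) ^ 2) ≤
      (6 * C ^ 2 * (wordVar p μ (n / 2) + wordVar p μ (n - n / 2)) +
        216 * C ^ 6 * n * (s + S) ^ 2) * treeSum p n fun _ => 1 := by
  have hC0 : 0 ≤ C := zero_le_one.trans hC.one_le
  rcases (forestProb_nonneg (p := p) 1 n).eq_or_lt with h | hpos
  · rw [treeSum_eq_zero_of_forestProb h.symm, treeSum_one_eq_forestProb, ← h, mul_zero]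
  set L := n / 2 with hLdef
  have hL : L ≤ n := Nat.div_le_self n 2
  set e₁ := wordMean p μ L
  set e₂ := wordMean p μ (n - L)
  set Ψ₁ : List ℕ → ℝ := fun l => (wordSum μ l - e₁) ^ 2 with hΨ₁
  set Ψ₂ : List ℕ → ℝ := fun l => (wordSum μ l - e₂) ^ 2 with hΨ₂
  have hpt : ∀ T : PlaneTree, T.size = n →
      (n : ℝ) * (additive (fun T => μ T.size) T - e₁ - e₂) ^ 2 ≤
      3 * (∑ c ∈ Finset.range n, Ψ₁ (((word T).rotate c).take L)) +
      3 * (∑ c ∈ Finset.range n, Ψ₂ (((word T).rotate c).take (n - L))) +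
      12 * cutSum (fun k => |μ k|) (fun x => x ^ 2) T := by
    intro T hT
    set Z : ℕ → ℝ := fun c => crossing (fun k => |μ k|) ((word T).take c) ((word T).drop c)
    have hZ : cutSum (fun k => |μ k|) (fun x => x ^ 2) T = ∑ c ∈ Finset.range n, Z c ^ 2 := by
      rw [cutSum, hT]
    have hZ' := sum_range_add_mod hL fun c => Z c ^ 2
    rw [← sum_drop_rotate hT hL]
    -- `F - e₁ - e₂` is the sum of `x - e₁`, `y - e₂` and the cutting error, hence the `3`. The
    -- error is at most a sum of two crossings, hence `6` for each; both give the same sum over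
    -- rotations.
    have h1 : ∀ c ∈ Finset.range n, (additive (fun T => μ T.size) T - e₁ - e₂) ^ 2 ≤
        3 * Ψ₁ (((word T).rotate c).take L) + 3 * Ψ₂ (((word T).rotate c).drop L) +
        (6 * Z c ^ 2 + 6 * Z ((c + L) % n) ^ 2) := by
      intro c hc
      have h2 := abs_additive_sub_wordSum_rotate_le (μ := μ) T
        (c := c) (L := L) (by simpa [hT] using hc) (by omega)
      rw [hT] at h2
      simp only [hΨ₁, hΨ₂]
      set x := wordSum μ (((word T).rotate c).take L)
      set y := wordSum μ (((word T).rotate c).drop L)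
      set F := additive (fun T => μ T.size) T
      have h3 : (F - x - y) ^ 2 ≤ (Z c + Z ((c + L) % n)) ^ 2 := sq_le_sq' (by
        have := (abs_le.1 h2).1; linarith) (abs_le.1 h2).2
      nlinarith [sq_nonneg ((F - x - y) - (x - e₁)), sq_nonneg ((F - x - y) - (y - e₂)),
        sq_nonneg ((x - e₁) - (y - e₂)), sq_nonneg (Z c - Z ((c + L) % n))]
    have h2 := Finset.sum_le_sum h1
    simp only [Finset.sum_const, Finset.card_range, nsmul_eq_mul, Finset.sum_add_distrib,
      ← Finset.mul_sum] at h2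
    rw [hZ]
    rw [hZ'] at h2
    linarith
  have hsum := treeSum_mono (p := p) hpt
  rw [treeSum_const_mul, treeSum_add, treeSum_add, treeSum_const_mul, treeSum_const_mul,
    treeSum_const_mul] at hsum
  have hb : ∀ m e, BddOn m fun l => (wordSum μ l - e) ^ 2 := fun m e =>
    ((bddOn_wordSum hs m).sub (bddOn_const e)).pow_two
  have hd1 := hC.div_sqrt_le hn hpos (m := n - L) (by omega)
  have hd2 := hC.div_sqrt_le hn hpos (m := L) (by omega)
  have t1 := (hC.treeSum_take_rotate_le hL (hb L e₁) fun l => sq_nonneg _).trans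
    (mul_le_mul_of_nonneg_left hd1 (wordVar_nonneg (p := p) (μ := μ) L))
  have t2 := hC.treeSum_take_rotate_le (Nat.sub_le n L) (hb (n - L) e₂) fun l => sq_nonneg _
  rw [show n - (n - L) = L by omega] at t2
  have t2 := t2.trans (mul_le_mul_of_nonneg_left hd2 (wordVar_nonneg (p := p) (μ := μ) (n - L)))
  have t3 := hC.treeSum_cutSum_sq_le (h := fun k => |μ k|) (fun k => abs_nonneg _) hs hS n
  have hn0 : (0 : ℝ) < n := by exact_mod_cast hn
  refine le_of_mul_le_mul_left (hsum.trans ?_) hn0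
  calc _ ≤ 3 * (iidMean p L Ψ₁ * (2 * C ^ 2 * n * treeSum p n fun _ => 1)) +
        3 * (iidMean p (n - L) Ψ₂ * (2 * C ^ 2 * n * treeSum p n fun _ => 1)) +
        12 * (18 * C ^ 6 * n ^ 2 * (s + S) ^ 2 * treeSum p n fun _ => 1) := by
          gcongr
    _ = _ := by
      have v1 : iidMean p L Ψ₁ = wordVar p μ L := rfl
      have v2 : iidMean p (n - L) Ψ₂ = wordVar p μ (n - L) := rfl
      rw [v1, v2]
      ring

/-! ### The mean for independent letters -/

theorem iidMean_toll (n : ℕ) :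
    iidMean p n (toll μ) = ∑ k ∈ Finset.Icc 1 n, μ k * forestProb p 1 k := by
  rw [iidMean_congr fun l hl => toll_eq_sum hl,
    iidMean_finsetSum _ fun k _ => (bddOn_const _).mul (bddOn_ite_one _ _)]
  refine Finset.sum_congr rfl fun k hk => ?_
  rw [iidMean_const_mul, ← treeSum_one_eq_forestProb]
  obtain ⟨m, rfl⟩ := Nat.exists_eq_add_of_le (Finset.mem_Icc.1 hk).2
  rw [iidMean_pass_append]
  simp only [iidMean_const]

theorem iidMean_tail (n : ℕ) (Φ : List ℕ → ℝ) :
    iidMean p (n + 1) (fun l => Φ l.tail) = iidMean p n Φ := by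
  simp [iidMean]

theorem wordSum_eq_toll_add_tail {n : ℕ} {l : List ℕ} (hl : l.length = n + 1) :
    wordSum μ l = toll μ l + wordSum μ l.tail := by
  cases l with
  | nil => simp at hl
  | cons a l => rfl

theorem bddOn_tail {n : ℕ} {Φ : List ℕ → ℝ} (h : BddOn n Φ) :
    BddOn (n + 1) fun l => Φ l.tail := by
  obtain ⟨B, hB⟩ := h
  exact ⟨B, fun l hl => hB _ (by simp [hl])⟩

theorem wordMean_succ (hs : ∀ k, |μ k| ≤ s) (n : ℕ) :
    wordMean p μ (n + 1) = iidMean p (n + 1) (toll μ) + wordMean p μ n := by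
  rw [wordMean, iidMean_congr fun l hl => wordSum_eq_toll_add_tail hl,
    iidMean_add (bddOn_toll _) (bddOn_tail (bddOn_wordSum hs n)), iidMean_tail]
  rfl

/-- Each term is at most `4 / √m - 4 / √(m + 1)`, and the sum telescopes. The asymptotic constant
`2` would fail at `m = 1`. -/
theorem sum_one_div_mul_sqrt_le (i k : ℕ) :
    ∑ m ∈ Finset.Ioc i (i + k), 1 / ((m : ℝ) * √m) ≤ 4 / √((i : ℝ) + 1) := by
  have h : ∀ k, ∑ m ∈ Finset.Ioc i (i + k), 1 / ((m : ℝ) * √m) ≤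
      4 / √((i : ℝ) + 1) - 4 / √(((i + k : ℕ) : ℝ) + 1) := by
    intro k
    induction k with
    | zero => simp
    | succ k ih =>
      rw [← add_assoc, ← Finset.insert_Ioc_right_eq_Ioc_add_one (by omega), Finset.sum_insert (by simp)]
      set x : ℝ := ((i + k : ℕ) : ℝ) + 1 with hx
      have hx1 : (1 : ℝ) ≤ x := by
        have : (0 : ℝ) ≤ ((i + k : ℕ) : ℝ) := by positivity
        linarith
      have e1 : ((i + k + 1 : ℕ) : ℝ) = x := by rw [hx]; push_cast; ring
      rw [e1]
      have hs1 : 0 < √x := Real.sqrt_pos.2 (by linarith)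
      have hs2 : 0 < √(x + 1) := Real.sqrt_pos.2 (by linarith)
      have q1 := Real.sq_sqrt (show 0 ≤ x by linarith)
      have q2 := Real.sq_sqrt (show 0 ≤ x + 1 by linarith)
      have hle : √(x + 1) ≤ 3 / 2 * √x := by
        rw [show (3 / 2 : ℝ) = √(9 / 4) by
          rw [show (9 / 4 : ℝ) = (3 / 2) ^ 2 by norm_num, Real.sqrt_sq (by norm_num)],
          ← Real.sqrt_mul (by norm_num)]
        exact Real.sqrt_le_sqrt (by linarith)
      have key : 1 / (x * √x) ≤ 4 / √x - 4 / √(x + 1) := by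
        have e2 : 4 / √x - 4 / √(x + 1) = 4 / (√x * √(x + 1) * (√x + √(x + 1))) := by
          field_simp
          nlinarith
        rw [e2, div_le_div_iff₀ (by positivity) (by positivity), one_mul]
        have : √(x + 1) * (√x + √(x + 1)) ≤ 4 * x := by nlinarith
        nlinarith
      linarith
  exact (h k).trans (sub_le_self _ (by positivity))

/-- Only a first tree with size in `(i, i + k]` makes a difference, and size `m` has probability at
most `C m^(-3/2)`. -/
theorem LocalBounds.abs_iidMean_toll_sub_le (hC : LocalBounds p C) (hs : ∀ k, |μ k| ≤ s)
    (i k : ℕ) : |iidMean p (i + k) (toll μ) - iidMean p i (toll μ)| ≤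
      4 * C * s / √((i : ℝ) + 1) := by
  have hC0 : 0 ≤ C := zero_le_one.trans hC.one_le
  have hs0 : 0 ≤ s := (abs_nonneg _).trans (hs 0)
  have e : iidMean p (i + k) (toll μ) - iidMean p i (toll μ) =
      ∑ m ∈ Finset.Ioc i (i + k), μ m * forestProb p 1 m := by
    rw [iidMean_toll, iidMean_toll, sub_eq_iff_eq_add']
    have := Finset.sum_Ioc_consecutive (fun m => μ m * forestProb p 1 m)
      (Nat.zero_le i) (Nat.le_add_right i k)
    exact this.symm
  rw [e]
  refine (Finset.abs_sum_le_sum_abs _ _).trans ?_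
  have h1 : ∀ m ∈ Finset.Ioc i (i + k), |μ m * forestProb p 1 m| ≤
      C * s * (1 / ((m : ℝ) * √m)) := by
    intro m hm
    rw [Finset.mem_Ioc] at hm
    have h2 := hC.forestProb_le 1 m (by omega)
    rw [abs_mul, abs_of_nonneg (forestProb_nonneg _ _)]
    refine (mul_le_mul (hs m) h2 (forestProb_nonneg _ _) hs0).trans_eq ?_
    push_cast
    ring
  refine (Finset.sum_le_sum h1).trans ?_
  rw [← Finset.mul_sum]
  refine (mul_le_mul_of_nonneg_left (sum_one_div_mul_sqrt_le i k) (by positivity)).trans_eq ?_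
  ring

/-- The mean for independent letters is almost additive. -/
theorem LocalBounds.abs_wordMean_add_sub_le (hC : LocalBounds p C) (hs : ∀ k, |μ k| ≤ s)
    (x k : ℕ) : |wordMean p μ (x + k) - wordMean p μ x - wordMean p μ k| ≤ 8 * C * s * √k := by
  have hC0 : 0 ≤ C := zero_le_one.trans hC.one_le
  have hs0 : 0 ≤ s := (abs_nonneg _).trans (hs 0)
  have h : ∀ k : ℕ, |wordMean p μ (x + k) - wordMean p μ x - wordMean p μ k| ≤
      4 * C * s * ∑ j ∈ Finset.range k, 1 / √((j : ℝ) + 1) := by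
    intro k
    induction k with
    | zero => simp [wordMean, iidMean, wordSum]
    | succ k ih =>
      have h1 := hC.abs_iidMean_toll_sub_le hs (k + 1) x
      -- Raising `k` by one adds mean tolls for words of `x + k + 1` and `k + 1` letters, which
      -- nearly cancel.
      have e : wordMean p μ (x + (k + 1)) - wordMean p μ x - wordMean p μ (k + 1) =
          (wordMean p μ (x + k) - wordMean p μ x - wordMean p μ k) +
          (iidMean p (k + 1 + x) (toll μ) - iidMean p (k + 1) (toll μ)) := by
        rw [← add_assoc, wordMean_succ hs, wordMean_succ hs, show k + 1 + x = x + k + 1 by ring]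
        ring
      rw [e, Finset.sum_range_succ, mul_add]
      refine (abs_add_le _ _).trans (add_le_add ih (h1.trans ?_))
      rw [mul_one_div]
      refine div_le_div_of_nonneg_left (by positivity) (by positivity) (Real.sqrt_le_sqrt ?_)
      push_cast
      linarith
  refine (h k).trans ((mul_le_mul_of_nonneg_left (sum_one_div_sqrt_le k) (by positivity)).trans_eq ?_)
  ring

end compare

end PlaneTree

namespace PlaneTree

/-! ### The variance for independent letters -/

section variance
variable {p : PMF ℕ} {μ : ℕ → ℝ} {C s S : ℝ}

theorem wordVar_eq (hs : ∀ k, |μ k| ≤ s) (n : ℕ) :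
    wordVar p μ n = iidMean p n (fun l => wordSum μ l ^ 2) - wordMean p μ n ^ 2 := by
  have hb := bddOn_wordSum (n := n) hs
  have e : ∀ l, (wordSum μ l - wordMean p μ n) ^ 2 =
      (wordSum μ l ^ 2 - 2 * wordMean p μ n * wordSum μ l) + wordMean p μ n ^ 2 := by
    intro l; ring
  rw [wordVar]
  simp only [e]
  rw [iidMean_add (hb.pow_two.sub ((bddOn_const _).mul hb)) (bddOn_const _),
    iidMean_sub hb.pow_two ((bddOn_const _).mul hb), iidMean_const_mul, iidMean_const]
  change _ - _ * wordMean p μ n + _ = _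
  ring

/-- Given that the first tree has size `k`, it is a conditioned tree and the other `n - k` letters
remain independent. -/
theorem iidMean_toll_mul_wordSum (hs : ∀ k, |μ k| ≤ s) (n : ℕ) :
    iidMean p n (fun l => toll μ l * wordSum μ l) = ∑ k ∈ Finset.Icc 1 n, μ k *
      (treeSum p k (additive fun T => μ T.size) + forestProb p 1 k * wordMean p μ (n - k)) := by
  have h1 : ∀ l : List ℕ, l.length = n → toll μ l * wordSum μ l =
      ∑ k ∈ Finset.Icc 1 n, μ k * if pass 1 l = some k then wordSum μ l else 0 := by
    intro l hl
    rw [toll_eq_sum hl, Finset.sum_mul]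
    refine Finset.sum_congr rfl fun k _ => ?_
    split_ifs <;> ring
  rw [iidMean_congr h1, iidMean_finsetSum _ fun k _ => (bddOn_const _).mul
    (.ite _ (bddOn_wordSum hs n) (bddOn_const _))]
  refine Finset.sum_congr rfl fun k hk => ?_
  rw [iidMean_const_mul]
  congr 1
  obtain ⟨m, rfl⟩ := Nat.exists_eq_add_of_le (Finset.mem_Icc.1 hk).2
  rw [iidMean_pass_append, add_tsub_cancel_left, ← treeSum_one_eq_forestProb, mul_comm,
    ← treeSum_const, ← treeSum_add]
  refine treeSum_congr fun T _ => ?_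
  simp only [wordSum_word_append]
  rw [iidMean_add (bddOn_const _) (bddOn_wordSum hs m), iidMean_const]
  rfl

/-- With `W = toll + W'`, expand `W² = 2 toll W - toll² + W'²` and drop the negative squares. The
sum is the mean of `toll W` minus the product of the means of `toll` and `W'`. -/
theorem wordVar_succ_le (hs : ∀ k, |μ k| ≤ s) (n : ℕ) :
    wordVar p μ (n + 1) ≤ wordVar p μ n + 2 * ∑ k ∈ Finset.Icc 1 (n + 1), μ k *
      (treeSum p k (additive fun T => μ T.size) -
        forestProb p 1 k * (wordMean p μ n - wordMean p μ (n + 1 - k))) := by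
  have hb := bddOn_wordSum (n := n + 1) hs
  have hbt := (bddOn_toll (μ := μ) (n + 1))
  have hb' := bddOn_tail (bddOn_wordSum (n := n) hs)
  have e : ∀ l : List ℕ, l.length = n + 1 → wordSum μ l ^ 2 =
      (2 * (toll μ l * wordSum μ l) - toll μ l ^ 2) + wordSum μ l.tail ^ 2 := by
    intro l hl
    rw [wordSum_eq_toll_add_tail hl]
    ring
  have h1 : iidMean p (n + 1) (fun l => wordSum μ l ^ 2) =
      (2 * iidMean p (n + 1) (fun l => toll μ l * wordSum μ l) -
        iidMean p (n + 1) (fun l => toll μ l ^ 2)) + iidMean p n fun l => wordSum μ l ^ 2 := by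
    rw [iidMean_congr e, iidMean_add (((bddOn_const _).mul (hbt.mul hb)).sub hbt.pow_two)
      hb'.pow_two, iidMean_sub ((bddOn_const _).mul (hbt.mul hb)) hbt.pow_two, iidMean_const_mul,
      iidMean_tail n fun l => wordSum μ l ^ 2]
  have h2 : 0 ≤ iidMean p (n + 1) fun l => toll μ l ^ 2 := iidMean_nonneg fun _ _ => sq_nonneg _
  have h3 : ∑ k ∈ Finset.Icc 1 (n + 1), μ k * (treeSum p k (additive fun T => μ T.size) -
      forestProb p 1 k * (wordMean p μ n - wordMean p μ (n + 1 - k))) =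
      iidMean p (n + 1) (fun l => toll μ l * wordSum μ l) -
        iidMean p (n + 1) (toll μ) * wordMean p μ n := by
    rw [iidMean_toll_mul_wordSum hs, iidMean_toll, Finset.sum_mul, ← Finset.sum_sub_distrib]
    exact Finset.sum_congr rfl fun k _ => by ring
  rw [h3, wordVar_eq hs, wordVar_eq hs, h1, wordMean_succ hs]
  nlinarith [sq_nonneg (iidMean p (n + 1) (toll μ))]

theorem wordVar_le_of_abs_le (hs : ∀ k, |μ k| ≤ s) (n : ℕ) : wordVar p μ n ≤ (n * s) ^ 2 := by
  rw [wordVar_eq hs]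
  have h := abs_iidMean_le (p := p) (n := n) (Φ := fun l => wordSum μ l ^ 2) (B := (n * s) ^ 2)
    fun l hl => by
      have := abs_wordSum_le hs l
      rw [hl] at this
      rw [abs_of_nonneg (sq_nonneg _), ← sq_abs]
      exact pow_le_pow_left₀ (abs_nonneg _) this 2
  have := (abs_le.1 h).2
  linarith [sq_nonneg (wordMean p μ n)]

/-- The mean of an additive functional of a conditioned tree whose toll depends only on the size
differs from the mean for independent letters by `O(√k)`, given a linear bound for the variance
for fewer independent letters. -/
theorem LocalBounds.abs_treeSum_sub_le (hC : LocalBounds p C) (hs : ∀ k, |μ k| ≤ s)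
    (hS : ∀ n, ∑ k ∈ Finset.Icc 1 n, |μ k| / k ≤ S) {y : ℝ} (hy : 0 ≤ y) {k : ℕ} (hk : 0 < k)
    (hV : ∀ j ≤ k - k / 2, wordVar p μ j ≤ j * y ^ 2) :
    |treeSum p k (additive fun T => μ T.size) - forestProb p 1 k *
      (wordMean p μ (k / 2) + wordMean p μ (k - k / 2))| ≤
      forestProb p 1 k * (15 * C ^ 3 * √k * (y + (s + S))) := by
  have hC1 := hC.one_le
  have hC0 : 0 ≤ C := zero_le_one.trans hC1
  have hX0 : 0 ≤ s + S := add_nonneg ((abs_nonneg _).trans (hs 0)) (by simpa using hS 0)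
  have hk0 : (0 : ℝ) < k := by exact_mod_cast hk
  have hπ := forestProb_nonneg (p := p) 1 k
  set e₁ := wordMean p μ (k / 2)
  set e₂ := wordMean p μ (k - k / 2)
  have e : treeSum p k (additive fun T => μ T.size) - forestProb p 1 k * (e₁ + e₂) =
      treeSum p k fun T => additive (fun T => μ T.size) T - e₁ - e₂ := by
    rw [← treeSum_one_eq_forestProb, mul_comm, ← treeSum_const, ← treeSum_sub]
    exact treeSum_congr fun T _ => by ring
  rw [e]
  refine abs_le_of_sq_le_sq ?_ (by positivity)
  -- Cauchy–Schwarz reduces the mean to the second moment of the halving estimate, which needs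
  -- variances only up to `k - k / 2` letters.
  refine sq_treeSum_le.trans ?_
  have h1 := hC.treeSum_sq_le hs hS hk
  have v1 := hV (k / 2) (by omega)
  have v2 := hV (k - k / 2) le_rfl
  have v3 : wordVar p μ (k / 2) + wordVar p μ (k - k / 2) ≤ k * y ^ 2 := by
    have : ((k / 2 : ℕ) : ℝ) + ((k - k / 2 : ℕ) : ℝ) = k := by
      exact_mod_cast (by omega : k / 2 + (k - k / 2) = k)
    calc _ ≤ ((k / 2 : ℕ) : ℝ) * y ^ 2 + ((k - k / 2 : ℕ) : ℝ) * y ^ 2 := add_le_add v1 v2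
      _ = _ := by rw [← add_mul, this]
  have h2 : 6 * C ^ 2 * (wordVar p μ (k / 2) + wordVar p μ (k - k / 2)) +
      216 * C ^ 6 * k * (s + S) ^ 2 ≤ (15 * C ^ 3 * √k * (y + (s + S))) ^ 2 := by
    have e : (15 * C ^ 3 * √k * (y + (s + S))) ^ 2 = 225 * C ^ 6 * k * (y + (s + S)) ^ 2 := by
      rw [mul_pow, mul_pow, mul_pow, Real.sq_sqrt hk0.le]
      ring
    rw [e]
    have h3 : C ^ 2 ≤ C ^ 6 := pow_le_pow_right₀ hC1 (by norm_num)
    calc _ ≤ 6 * C ^ 6 * (k * y ^ 2) + 216 * C ^ 6 * k * (s + S) ^ 2 := by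
          gcongr
          exact add_nonneg (wordVar_nonneg _) (wordVar_nonneg _)
      _ = C ^ 6 * k * (6 * y ^ 2 + 216 * (s + S) ^ 2) := by ring
      _ ≤ C ^ 6 * k * (225 * (y + (s + S)) ^ 2) := by
          gcongr
          nlinarith [mul_nonneg hy hX0]
      _ = _ := by ring
  rw [treeSum_one_eq_forestProb] at h1 ⊢
  rw [mul_pow, sq (forestProb p 1 k), mul_assoc]
  refine mul_le_mul_of_nonneg_left ?_ hπ
  rw [mul_comm]
  exact h1.trans (mul_le_mul_of_nonneg_right h2 hπ)

/-- The variance for independent letters grows at most linearly. -/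
theorem LocalBounds.wordVar_le (hC : LocalBounds p C) (hs : ∀ k, |μ k| ≤ s)
    (hS : ∀ n, ∑ k ∈ Finset.Icc 1 n, |μ k| / k ≤ S) (n : ℕ) :
    wordVar p μ n ≤ n * (65 * C ^ 4 * (s + S)) ^ 2 := by
  have hC1 := hC.one_le
  have hC0 : 0 ≤ C := zero_le_one.trans hC1
  have hs0 : 0 ≤ s := (abs_nonneg _).trans (hs 0)
  have hS0 : 0 ≤ S := by simpa using hS 0
  set X := s + S with hX
  have hX0 : 0 ≤ X := add_nonneg hs0 hS0
  have hsX : s ≤ X := by linarith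
  have hSX : S ≤ X := by linarith
  -- Chosen so that `64 C⁴ (y + X) X ≤ y²`, which bounds the increment of the variance by `y²`.
  set y := 65 * C ^ 4 * X with hy
  have hy0 : 0 ≤ y := by positivity
  have hC4 : 1 ≤ C ^ 4 := one_le_pow₀ hC1
  have hXy : X ≤ y := by
    rw [hy]
    nlinarith
  induction n using Nat.strong_induction_on with
  | _ n ih =>
    -- From two letters on, each `k` up to the word length has `k - k / 2` strictly below that
    -- length, so the induction hypothesis applies.
    rcases Nat.lt_or_ge n 2 with hn | hn
    · refine (wordVar_le_of_abs_le hs n).trans ?_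
      have h1 : s ^ 2 ≤ y ^ 2 := pow_le_pow_left₀ hs0 (hsX.trans hXy) 2
      interval_cases n
      · simp
      · simpa using h1
    · obtain ⟨n, rfl⟩ : ∃ m, n = m + 1 := ⟨n - 1, by omega⟩
      have h1 := wordVar_succ_le (p := p) hs n
      have h2 := ih n (by omega)
      have hterm : ∀ k ∈ Finset.Icc 1 (n + 1), μ k *
          (treeSum p k (additive fun T => μ T.size) - forestProb p 1 k *
            (wordMean p μ n - wordMean p μ (n + 1 - k))) ≤
          32 * C ^ 4 * (y + X) * (|μ k| / k) := by
        intro k hk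
        rw [Finset.mem_Icc] at hk
        have hk0 : (0 : ℝ) < k := by exact_mod_cast hk.1
        have hsk : 0 < √(k : ℝ) := Real.sqrt_pos.2 hk0
        have hπ := forestProb_nonneg (p := p) 1 k
        have g1 := hC.abs_treeSum_sub_le hs hS hy0 hk.1 fun j hj => ih j (by omega)
        -- With `k = j + 1`, the mean is almost additive in the splittings of `n` with part `j` and
        -- of `j + 1` into halves, at cost `8` each; passing between `j` and `j + 1` costs one more.
        have g2 : |(wordMean p μ (k / 2) + wordMean p μ (k - k / 2)) -
            (wordMean p μ n - wordMean p μ (n + 1 - k))| ≤ 17 * C * s * √k := by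
          obtain ⟨j, rfl⟩ : ∃ j, k = j + 1 := ⟨k - 1, by omega⟩
          have b1 := hC.abs_wordMean_add_sub_le hs (n + 1 - (j + 1)) j
          rw [show n + 1 - (j + 1) + j = n by omega] at b1
          have b2 := hC.abs_wordMean_add_sub_le hs ((j + 1) / 2) (j + 1 - (j + 1) / 2)
          rw [show (j + 1) / 2 + (j + 1 - (j + 1) / 2) = j + 1 by omega] at b2
          have b3 : |wordMean p μ (j + 1) - wordMean p μ j| ≤ s := by
            rw [wordMean_succ hs, add_sub_cancel_right]
            exact abs_iidMean_le fun l _ => abs_toll_le hs l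
          have b4 : √(j : ℝ) ≤ √((j + 1 : ℕ) : ℝ) := Real.sqrt_le_sqrt (by push_cast; linarith)
          have b5 : √((j + 1 - (j + 1) / 2 : ℕ) : ℝ) ≤ √((j + 1 : ℕ) : ℝ) :=
            Real.sqrt_le_sqrt (by exact_mod_cast Nat.sub_le _ _)
          have b6 : 1 ≤ √((j + 1 : ℕ) : ℝ) := Real.one_le_sqrt.2 (by exact_mod_cast hk.1)
          have c1 := mul_le_mul_of_nonneg_left b4 (show 0 ≤ 8 * C * s by positivity)
          have c2 := mul_le_mul_of_nonneg_left b5 (show 0 ≤ 8 * C * s by positivity)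
          have c3 : s ≤ C * s * √((j + 1 : ℕ) : ℝ) := by
            have : 1 ≤ C * √((j + 1 : ℕ) : ℝ) := by nlinarith
            nlinarith
          have b1 := abs_le.1 (b1.trans c1)
          have b2 := abs_le.1 (b2.trans c2)
          have b3 := abs_le.1 (b3.trans c3)
          rw [abs_le]
          constructor <;> linarith [b1.1, b1.2, b2.1, b2.2, b3.1, b3.2]
        have g3 : 17 * C * s * √(k : ℝ) ≤ 17 * C ^ 3 * √k * (y + X) := by
          have : C ≤ C ^ 3 := le_self_pow₀ hC1 (by norm_num)
          calc 17 * C * s * √(k : ℝ) ≤ 17 * C ^ 3 * (y + X) * √k := by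
                gcongr
                linarith
            _ = _ := by ring
        have g4 : |treeSum p k (additive fun T => μ T.size) - forestProb p 1 k *
            (wordMean p μ n - wordMean p μ (n + 1 - k))| ≤
            forestProb p 1 k * (32 * C ^ 3 * √k * (y + X)) := by
          have e : treeSum p k (additive fun T => μ T.size) - forestProb p 1 k *
              (wordMean p μ n - wordMean p μ (n + 1 - k)) =
              (treeSum p k (additive fun T => μ T.size) - forestProb p 1 k *
                (wordMean p μ (k / 2) + wordMean p μ (k - k / 2))) + forestProb p 1 k *
              ((wordMean p μ (k / 2) + wordMean p μ (k - k / 2)) -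
                (wordMean p μ n - wordMean p μ (n + 1 - k))) := by ring
          rw [e]
          refine (abs_add_le _ _).trans ((add_le_add g1 ?_).trans_eq (b :=
            forestProb p 1 k * (15 * C ^ 3 * √k * (y + X)) +
              forestProb p 1 k * (17 * C ^ 3 * √k * (y + X))) (by ring))
          rw [abs_mul, abs_of_nonneg hπ]
          exact mul_le_mul_of_nonneg_left (g2.trans g3) hπ
        have g5 := hC.forestProb_le 1 k hk.1
        have g6 : forestProb p 1 k * (32 * C ^ 3 * √k * (y + X)) ≤
            32 * C ^ 4 * (y + X) * (1 / k) := by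
          refine (mul_le_mul_of_nonneg_right g5 (by positivity)).trans_eq ?_
          push_cast
          field_simp
        refine (le_abs_self _).trans ?_
        rw [abs_mul]
        refine (mul_le_mul_of_nonneg_left (g4.trans g6) (abs_nonneg _)).trans_eq ?_
        ring
      have h3 := Finset.sum_le_sum hterm
      rw [← Finset.mul_sum] at h3
      have h4 := mul_le_mul_of_nonneg_left ((hS (n + 1)).trans hSX)
        (show 0 ≤ 32 * C ^ 4 * (y + X) by positivity)
      have h5 : 64 * C ^ 4 * (y + X) * X ≤ y ^ 2 := by
        have e1 : 64 * C ^ 4 * (y + X) * X = 4160 * C ^ 8 * X ^ 2 + 64 * C ^ 4 * X ^ 2 := by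
          rw [hy]; ring
        have e2 : y ^ 2 = 4160 * C ^ 8 * X ^ 2 + 65 * C ^ 8 * X ^ 2 := by rw [hy]; ring
        have h6 : C ^ 4 ≤ C ^ 8 := pow_le_pow_right₀ hC1 (by norm_num)
        have h7 := mul_le_mul_of_nonneg_right h6 (sq_nonneg X)
        have h8 : 0 ≤ C ^ 8 * X ^ 2 := by positivity
        rw [e1, e2]
        linarith
      push_cast
      linarith

/-- The variance bound for tolls that depend only on the size. -/
theorem LocalBounds.exists_treeSum_sq_le (hC : LocalBounds p C) (hs : ∀ k, |μ k| ≤ s)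
    (hS : ∀ n, ∑ k ∈ Finset.Icc 1 n, |μ k| / k ≤ S) {n : ℕ} (hn : 0 < n) :
    ∃ κ, treeSum p n (fun T => (additive (fun T => μ T.size) T - κ) ^ 2) ≤
      26000 * C ^ 10 * n * (s + S) ^ 2 * treeSum p n fun _ => 1 := by
  have hC1 := hC.one_le
  have hC0 : 0 ≤ C := zero_le_one.trans hC1
  refine ⟨wordMean p μ (n / 2) + wordMean p μ (n - n / 2), ?_⟩
  have h1 := hC.treeSum_sq_le hs hS hn
  simp only [← sub_sub]
  refine h1.trans (mul_le_mul_of_nonneg_right ?_ (treeSum_nonneg fun _ _ => zero_le_one))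
  have v1 := hC.wordVar_le hs hS (n / 2)
  have v2 := hC.wordVar_le hs hS (n - n / 2)
  have hsum : ((n / 2 : ℕ) : ℝ) + ((n - n / 2 : ℕ) : ℝ) = n := by
    exact_mod_cast (by omega : n / 2 + (n - n / 2) = n)
  have v3 : wordVar p μ (n / 2) + wordVar p μ (n - n / 2) ≤ n * (65 * C ^ 4 * (s + S)) ^ 2 := by
    refine (add_le_add v1 v2).trans_eq ?_
    rw [← add_mul, hsum]
  have h6 : C ^ 6 ≤ C ^ 10 := pow_le_pow_right₀ hC1 (by norm_num)
  have h7 := mul_le_mul_of_nonneg_right h6 (show 0 ≤ n * (s + S) ^ 2 by positivity)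
  have h8 := mul_le_mul_of_nonneg_left v3 (show 0 ≤ 6 * C ^ 2 by positivity)
  have h9 : 0 ≤ C ^ 10 * (n * (s + S) ^ 2) := by positivity
  have e : 6 * C ^ 2 * (n * (65 * C ^ 4 * (s + S)) ^ 2) =
      25350 * (C ^ 10 * (n * (s + S) ^ 2)) := by ring
  rw [e] at h8
  linarith

/-- The variance bound for weakly local tolls, for weighted sums over trees. -/
theorem LocalBounds.exists_weaklyLocal (hC : LocalBounds p C) (M : ℕ) :
    ∃ K : ℝ, 0 ≤ K ∧ ∀ (f : PlaneTree → ℝ) (μ : ℕ → ℝ) (A₁ A₂ s S : ℝ), IsWeaklyLocal f M →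
      0 ≤ A₁ → 0 ≤ A₂ → (∀ T, 0 < wt p T → |f T| ≤ A₁) →
      (∀ T, 0 < wt p T → |f T| ≤ A₂ * (T.size : ℝ) ^ (1 / 4 : ℝ)) →
      (∀ k, treeSum p k f = μ k * treeSum p k fun _ => 1) → (∀ k, |μ k| ≤ s) →
      (∀ n, ∑ k ∈ Finset.Icc 1 n, |μ k| / k ≤ S) → ∀ n : ℕ, 0 < n →
      ∃ κ, treeSum p n (fun T => (additive f T - κ) ^ 2) ≤
        K * n * (A₁ * A₂ + (s + S) ^ 2) * treeSum p n fun _ => 1 := by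
  have hC0 : 0 ≤ C := zero_le_one.trans hC.one_le
  obtain ⟨D, hD0, hD⟩ := exists_treeSum_additiveLT_one_le hC0 hC.degree_le M
  obtain ⟨E, hE0, hE⟩ := exists_sum_rpow_mul_boundaryFactor_le
  refine ⟨16 * C ^ 3 * D * E + 52000 * C ^ 10, by positivity, ?_⟩
  intro f μ A₁ A₂ s S hf hA₁ hA₂ hf₁ hf₂ hμ hs hS n hn
  set g : PlaneTree → ℝ := fun T => f T - μ T.size with hg
  have hgc : ∀ k, treeSum p k g = 0 := by
    intro k
    rw [hg, treeSum_sub, hμ, ← treeSum_const, sub_eq_zero]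
    exact treeSum_congr fun T hT => by rw [hT]
  have hgw : IsWeaklyLocal g M := by
    intro T T' h1 h2
    simp only [hg, hf T T' h1 h2, h1]
  -- The conditional mean inherits any bound valid at its size, so `g` obeys the bounds on `f` with
  -- a factor `2`.
  have hμT : ∀ (T : PlaneTree) (B : ℝ), 0 < wt p T →
      (∀ T', T'.size = T.size → 0 < wt p T' → |f T'| ≤ B) → |μ T.size| ≤ B := by
    intro T B hT hB
    have hpos : 0 < treeSum p T.size fun _ => 1 := by
      refine Finset.sum_pos' (fun T' _ => mul_nonneg (wt_nonneg p T') zero_le_one)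
        ⟨T, mem_trees.2 rfl, by simpa using hT⟩
    have h1 : |treeSum p T.size f| ≤ B * treeSum p T.size fun _ => 1 := by
      rw [← treeSum_const]
      exact abs_treeSum_le.trans (treeSum_mono_of_pos hB)
    rw [hμ, abs_mul, abs_of_pos hpos] at h1
    exact le_of_mul_le_mul_right h1 hpos
  have hg₁ : ∀ T, 0 < wt p T → |g T| ≤ 2 * A₁ := by
    intro T hT
    have h1 := hμT T A₁ hT fun T' _ hT' => hf₁ T' hT'
    exact (abs_sub _ _).trans (by linarith [hf₁ T hT])
  have hg₂ : ∀ T, 0 < wt p T → |g T| ≤ 2 * A₂ * (T.size : ℝ) ^ (1 / 4 : ℝ) := by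
    intro T hT
    have h1 := hμT T (A₂ * (T.size : ℝ) ^ (1 / 4 : ℝ)) hT fun T' hTT' hT' => by
      rw [← hTT']; exact hf₂ T' hT'
    exact (abs_sub _ _).trans (by linarith [hf₂ T hT])
  have hpair : ∀ k, treeSum p k (fun T => 2 * (g T * additive g T) - g T ^ 2) ≤
      treeSum p k fun T => 8 * A₁ * A₂ * D * (T.size : ℝ) ^ (1 / 4 : ℝ) := by
    intro k
    have h1 : treeSum p k (fun T => 2 * (g T * additive g T) - g T ^ 2) ≤
        2 * treeSum p k fun T => g T * additive g T := by
      rw [← treeSum_const_mul]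
      exact treeSum_mono fun T _ => by linarith [sq_nonneg (g T)]
    refine h1.trans ?_
    rw [treeSum_mul_additive_of_isWeaklyLocal hgc M g hgw k]
    -- The root value takes the bound with `k^(1/4)`, the nodes near the root the uniform bound;
    -- this is the source of the product `A₁ A₂`.
    have h2 : treeSum p k (fun T => g T * additiveLT g M T) ≤
        treeSum p k fun T => (4 * A₁ * A₂ * (k : ℝ) ^ (1 / 4 : ℝ)) *
          additiveLT (fun _ => 1) M T := by
      refine treeSum_mono_of_pos fun T hT hpos => ?_
      have h3 := hg₂ T hpos
      have h4 := abs_additiveLT_le hg₁ M T hpos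
      rw [hT] at h3
      refine (le_abs_self _).trans ?_
      rw [abs_mul]
      refine (mul_le_mul h3 h4 (abs_nonneg _) (by positivity)).trans_eq ?_
      ring
    rw [treeSum_const_mul] at h2
    have h3 := mul_le_mul_of_nonneg_left (hD k)
      (show 0 ≤ 4 * A₁ * A₂ * (k : ℝ) ^ (1 / 4 : ℝ) by positivity)
    have h4 : treeSum p k (fun T => 8 * A₁ * A₂ * D * (T.size : ℝ) ^ (1 / 4 : ℝ)) =
        8 * A₁ * A₂ * D * (k : ℝ) ^ (1 / 4 : ℝ) * treeSum p k fun _ => 1 := by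
      rw [← treeSum_const]
      exact treeSum_congr fun T hT => by rw [hT]
    rw [h4]
    linarith
  have hcent : treeSum p n (fun T => additive g T ^ 2) ≤
      8 * A₁ * A₂ * D * C ^ 3 * n * E * treeSum p n fun _ => 1 := by
    rw [treeSum_additive_sq_of_centered hgc]
    refine (treeSum_additive_le hpair n).trans ?_
    have h1 := hC.treeSum_additive_size_le
      (a := fun k => 8 * A₁ * A₂ * D * (k : ℝ) ^ (1 / 4 : ℝ)) (fun k => by positivity) n
    refine h1.trans (mul_le_mul_of_nonneg_right ?_ (treeSum_nonneg fun _ _ => zero_le_one))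
    simp only [mul_div_assoc, mul_assoc, ← Finset.mul_sum]
    have h2 := mul_le_mul_of_nonneg_left (hE n)
      (show 0 ≤ 8 * A₁ * A₂ * D * C ^ 3 * n by positivity)
    simp only [mul_assoc] at h2
    linarith
  obtain ⟨κ, hκ⟩ := hC.exists_treeSum_sq_le hs hS hn
  refine ⟨κ, ?_⟩
  have hsplit : ∀ T, T.size = n → (additive f T - κ) ^ 2 ≤
      2 * additive g T ^ 2 + 2 * (additive (fun T => μ T.size) T - κ) ^ 2 := by
    intro T _
    have e : additive f T = additive g T + additive (fun T => μ T.size) T := by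
      rw [← additive_add]; simp [hg]
    rw [e]
    nlinarith [sq_nonneg (additive g T - (additive (fun T => μ T.size) T - κ))]
  refine (treeSum_mono hsplit).trans ?_
  rw [treeSum_add, treeSum_const_mul, treeSum_const_mul]
  have hπ : 0 ≤ treeSum p n fun _ => 1 := treeSum_nonneg fun _ _ => zero_le_one
  have h1 : 0 ≤ 16 * C ^ 3 * D * E * n * (s + S) ^ 2 * treeSum p n fun _ => 1 := by positivity
  have h2 : 0 ≤ 52000 * C ^ 10 * n * (A₁ * A₂) * treeSum p n fun _ => 1 := by positivity
  linarith

end variance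

end PlaneTree

namespace PlaneTree

/-! ### The law of the conditioned tree -/

section law
variable {p : PMF ℕ}

theorem gwLaw_singleton (T : PlaneTree) : gwLaw p {T} = gwProb p T := by
  rw [gwLaw, Measure.sum_apply _ (measurableSet_singleton T), tsum_eq_single T]
  · simp
  · intro T' hT'
    simp [hT']

theorem setOf_size_eq (n : ℕ) : {T : PlaneTree | T.size = n} = ↑(trees n) := by
  ext T; simp

theorem gwLaw_size (n : ℕ) :
    gwLaw p {T | T.size = n} = ENNReal.ofReal (treeSum p n fun _ => 1) := by
  rw [setOf_size_eq, ← sum_measure_singleton, treeSum,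
    ENNReal.ofReal_sum_of_nonneg fun T _ => mul_nonneg (wt_nonneg p T) zero_le_one]
  refine Finset.sum_congr rfl fun T _ => ?_
  rw [mul_one, wt, ENNReal.ofReal_toReal (gwProb_ne_top p T), gwLaw_singleton]

theorem mem_possibleSizes {n : ℕ} : n ∈ possibleSizes p ↔ 0 < treeSum p n fun _ => 1 := by
  rw [possibleSizes, Set.mem_ofPred_eq, gwLaw_size, ENNReal.ofReal_pos]

theorem pos_of_mem_possibleSizes {n : ℕ} (h : n ∈ possibleSizes p) : 0 < n := by
  rw [mem_possibleSizes] at h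
  rcases Nat.eq_zero_or_pos n with rfl | hn
  · rw [treeSum_zero_size] at h; exact absurd h (lt_irrefl _)
  · exact hn

theorem size_mem_possibleSizes {T : PlaneTree} (hT : 0 < wt p T) : T.size ∈ possibleSizes p :=
  mem_possibleSizes.2 <| Finset.sum_pos' (fun T' _ => mul_nonneg (wt_nonneg p T') zero_le_one)
    ⟨T, mem_trees.2 rfl, by simpa using hT⟩

theorem integral_condGWLaw (n : ℕ) (Φ : PlaneTree → ℝ) :
    ∫ T, Φ T ∂(condGWLaw p n) = (treeSum p n fun _ => 1)⁻¹ * treeSum p n Φ := by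
  rw [condGWLaw, ProbabilityTheory.cond, integral_smul_measure, gwLaw_size, ENNReal.toReal_inv,
    ENNReal.toReal_ofReal (treeSum_nonneg fun _ _ => zero_le_one), smul_eq_mul, setOf_size_eq,
    setIntegral_finset]
  · congr 1
    refine Finset.sum_congr rfl fun T _ => ?_
    rw [Measure.real, gwLaw_singleton, smul_eq_mul, wt]
  · rw [← (trees n : Set PlaneTree).biUnion_of_singleton]
    refine integrableOn_finset_iUnion.2 fun T _ => integrableOn_singleton (by simp) ?_
    rw [gwLaw_singleton]
    exact (gwProb_ne_top p T).lt_top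

/-- The variance is the least second moment about a constant; so the mean of the functional itself
is never needed, and `κ` can come from independent letters. -/
theorem variance_condGWLaw_le {n : ℕ} (hn : n ∈ possibleSizes p) (Φ : PlaneTree → ℝ) (κ : ℝ) :
    variance Φ (condGWLaw p n) ≤
      (treeSum p n fun _ => 1)⁻¹ * treeSum p n fun T => (Φ T - κ) ^ 2 := by
  have hπ := mem_possibleSizes.1 hn
  set π := treeSum p n fun _ => 1 with hπdef
  rw [variance_eq_integral (Measurable.of_discrete.aemeasurable), integral_condGWLaw]
  refine mul_le_mul_of_nonneg_left ?_ (inv_nonneg.2 hπ.le)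
  set m := ∫ T, Φ T ∂(condGWLaw p n) with hm
  have h1 : treeSum p n Φ = m * π := by
    rw [hm, integral_condGWLaw, ← hπdef]
    field_simp
  have h2 : ∀ a : ℝ, treeSum p n (fun T => (Φ T - a) ^ 2) =
      treeSum p n (fun T => Φ T ^ 2) - 2 * a * (m * π) + a ^ 2 * π := by
    intro a
    rw [← h1, hπdef, ← treeSum_const_mul, ← treeSum_const_mul, ← treeSum_sub, ← treeSum_add]
    exact treeSum_congr fun T _ => by ring
  rw [h2, h2]
  nlinarith [mul_nonneg hπ.le (sq_nonneg (m - κ))]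

end law

end PlaneTree

/-! ### Passage to the extended nonnegative statement -/

theorem mainTheorem8 (p : PMF ℕ)
    (hp_sq : MemLp (fun k : ℕ => (k : ℝ)) 2 p.toMeasure)
    (hp_mean : ∫ k : ℕ, (k : ℝ) ∂p.toMeasure = 1)
    (hp_var : 0 < variance (fun k : ℕ => (k : ℝ)) p.toMeasure)
    (M : ℕ) :
    ∃ C : ℝ≥0, 0 < C ∧
      ∀ f : PlaneTree → ℝ, (∃ B : ℝ, ∀ T, |f T| ≤ B) → PlaneTree.IsWeaklyLocal f M →
        ∀ n ∈ PlaneTree.possibleSizes p,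
          ENNReal.ofReal
              (Real.sqrt (variance (PlaneTree.additive f) (PlaneTree.condGWLaw p n))) ≤
            (C : ℝ≥0∞) * (n : ℝ≥0∞) ^ (1 / 2 : ℝ) *
              (((⨆ k ∈ PlaneTree.possibleSizes p, PlaneTree.supOfSize f k) *
                  (⨆ k ∈ PlaneTree.possibleSizes p,
                    (k : ℝ≥0∞) ^ (-1 / 4 : ℝ) * PlaneTree.supOfSize f k)) ^ (1 / 2 : ℝ) +
                (⨆ k ∈ PlaneTree.possibleSizes p,
                  ENNReal.ofReal |PlaneTree.condMean p f k|) +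
                ∑' k : PlaneTree.possibleSizes p,
                  ENNReal.ofReal |PlaneTree.condMean p f (k : ℕ)| / ((k : ℕ) : ℝ≥0∞)) := by
  open PlaneTree in
  obtain ⟨C, hC⟩ := exists_localBounds p hp_sq hp_mean hp_var
  obtain ⟨K, hK0, hK⟩ := hC.exists_weaklyLocal M
  have hc0 : 0 < (√K + 1).toNNReal := Real.toNNReal_pos.2 (by positivity)
  refine ⟨(√K + 1).toNNReal, hc0, ?_⟩
  rintro f ⟨B, hB⟩ hf n hn
  have hn0 := pos_of_mem_possibleSizes hn
  have hnR : (0 : ℝ) < n := by exact_mod_cast hn0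
  set A₁ := ⨆ k ∈ possibleSizes p, supOfSize f k with hA₁
  set A₂ := ⨆ k ∈ possibleSizes p, (k : ℝ≥0∞) ^ (-1 / 4 : ℝ) * supOfSize f k with hA₂
  set s := ⨆ k ∈ possibleSizes p, ENNReal.ofReal |condMean p f k| with hs
  set S := ∑' k : possibleSizes p, ENNReal.ofReal |condMean p f (k : ℕ)| / ((k : ℕ) : ℝ≥0∞) with hS
  -- Then the right-hand side is infinite. The other suprema are finite because `f` is bounded.
  by_cases hSfin : S = ∞
  · rw [hSfin, add_top, ENNReal.mul_top]
    · exact le_top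
    · refine mul_ne_zero ?_ ?_
      · exact ENNReal.coe_ne_zero.2 hc0.ne'
      · rw [ne_eq, ENNReal.rpow_eq_zero_iff]
        rintro (⟨h, -⟩ | ⟨h, -⟩)
        · exact hn0.ne' (by exact_mod_cast h)
        · exact ENNReal.natCast_ne_top n h
  have hsup : ∀ k, supOfSize f k ≤ ENNReal.ofReal B := fun k =>
    iSup_le fun T => ENNReal.ofReal_le_ofReal (hB T)
  have hA₁fin : A₁ ≠ ∞ := ne_top_of_le_ne_top ENNReal.ofReal_ne_top
    (iSup₂_le fun k _ => hsup k)
  have hkpow : ∀ k ∈ possibleSizes p, (k : ℝ≥0∞) ^ (-1 / 4 : ℝ) ≤ 1 := fun k hk =>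
    ENNReal.rpow_le_one_of_one_le_of_neg
      (by exact_mod_cast pos_of_mem_possibleSizes hk) (by norm_num)
  have hA₂fin : A₂ ≠ ∞ := ne_top_of_le_ne_top ENNReal.ofReal_ne_top
    (iSup₂_le fun k hk => (mul_le_of_le_one_left' (hkpow k hk)).trans (hsup k))
  have hmean : ∀ k, condMean p f k = (treeSum p k fun _ => 1)⁻¹ * treeSum p k f := fun k =>
    integral_condGWLaw k f
  -- The conditional law is zero at impossible sizes, so sums over all `k` agree with sums over
  -- possible sizes.
  have hmean0 : ∀ k, k ∉ possibleSizes p → condMean p f k = 0 := by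
    intro k hk
    rw [mem_possibleSizes, not_lt] at hk
    rw [hmean, le_antisymm hk (treeSum_nonneg fun _ _ => zero_le_one), inv_zero, zero_mul]
  have hmul : ∀ k, treeSum p k f = condMean p f k * treeSum p k fun _ => 1 := by
    intro k
    by_cases hk : k ∈ possibleSizes p
    · have := mem_possibleSizes.1 hk
      rw [hmean]
      field_simp
    · have h1 := hk
      rw [mem_possibleSizes, not_lt, treeSum_one_eq_forestProb] at h1
      rw [hmean0 k hk, zero_mul,
        treeSum_eq_zero_of_forestProb (le_antisymm h1 (forestProb_nonneg _ _))]
  have hmeanB : ∀ k ∈ possibleSizes p, |condMean p f k| ≤ B := by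
    intro k hk
    have hpos := mem_possibleSizes.1 hk
    have h1 : |treeSum p k f| ≤ B * treeSum p k fun _ => 1 := by
      rw [← treeSum_const]
      exact abs_treeSum_le.trans (treeSum_mono fun T _ => hB T)
    rw [hmul, abs_mul, abs_of_pos hpos] at h1
    exact le_of_mul_le_mul_right h1 hpos
  have hsfin : s ≠ ∞ := ne_top_of_le_ne_top ENNReal.ofReal_ne_top
    (iSup₂_le fun k hk => ENNReal.ofReal_le_ofReal (hmeanB k hk))
  have hf₁ : ∀ T, 0 < wt p T → |f T| ≤ A₁.toReal := by
    intro T hT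
    rw [← ENNReal.ofReal_le_iff_le_toReal hA₁fin]
    exact (le_iSup (fun T' : {T' : PlaneTree // T'.size = T.size} => ENNReal.ofReal |f T'|)
      ⟨T, rfl⟩).trans (le_iSup₂ (f := fun k _ => supOfSize f k) T.size (size_mem_possibleSizes hT))
  have hf₂ : ∀ T, 0 < wt p T → |f T| ≤ A₂.toReal * (T.size : ℝ) ^ (1 / 4 : ℝ) := by
    intro T hT
    have hk := size_mem_possibleSizes hT
    have hk0 : (0 : ℝ) < T.size := by exact_mod_cast pos_of_mem_possibleSizes hk
    have h1 : (T.size : ℝ≥0∞) ^ (-1 / 4 : ℝ) * ENNReal.ofReal |f T| ≤ A₂ :=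
      (mul_le_mul_right (le_iSup (fun T' : {T' : PlaneTree // T'.size = T.size} =>
        ENNReal.ofReal |f T'|) ⟨T, rfl⟩) _).trans (le_iSup₂
        (f := fun k (_ : k ∈ possibleSizes p) => (k : ℝ≥0∞) ^ (-1 / 4 : ℝ) * supOfSize f k)
        T.size hk)
    have h2 := ENNReal.toReal_mono hA₂fin h1
    rw [ENNReal.toReal_mul, ENNReal.toReal_ofReal (abs_nonneg _), ← ENNReal.toReal_rpow,
      ENNReal.toReal_natCast, show (-1 / 4 : ℝ) = -(1 / 4) by norm_num, Real.rpow_neg hk0.le,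
      inv_mul_le_iff₀ (by positivity)] at h2
    linarith
  have hs' : ∀ k, |condMean p f k| ≤ s.toReal := by
    intro k
    by_cases hk : k ∈ possibleSizes p
    · rw [← ENNReal.ofReal_le_iff_le_toReal hsfin]
      exact le_iSup₂ (f := fun k (_ : k ∈ possibleSizes p) => ENNReal.ofReal |condMean p f k|) k hk
    · rw [hmean0 k hk, abs_zero]
      exact ENNReal.toReal_nonneg
  have hS' : ∀ N, ∑ k ∈ Finset.Icc 1 N, |condMean p f k| / k ≤ S.toReal := by
    intro N
    rw [← ENNReal.ofReal_le_iff_le_toReal hSfin,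
      ENNReal.ofReal_sum_of_nonneg fun k _ => by positivity]
    have h1 : ∀ k ∈ Finset.Icc 1 N, ENNReal.ofReal (|condMean p f k| / k) =
        (possibleSizes p).indicator
          (fun k : ℕ => ENNReal.ofReal |condMean p f k| / (k : ℝ≥0∞)) k := by
      intro k hk
      have hk0 : (0 : ℝ) < k := by exact_mod_cast (Finset.mem_Icc.1 hk).1
      by_cases hk' : k ∈ possibleSizes p
      · rw [Set.indicator_of_mem hk', ENNReal.ofReal_div_of_pos hk0, ENNReal.ofReal_natCast]
      · rw [Set.indicator_of_notMem hk', hmean0 k hk']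
        simp
    rw [Finset.sum_congr rfl h1, hS, tsum_subtype (possibleSizes p)
      (fun k : ℕ => ENNReal.ofReal |condMean p f k| / (k : ℝ≥0∞))]
    exact ENNReal.sum_le_tsum _
  obtain ⟨κ, hκ⟩ := hK f (condMean p f) A₁.toReal A₂.toReal s.toReal S.toReal hf
    ENNReal.toReal_nonneg ENNReal.toReal_nonneg hf₁ hf₂ hmul hs' hS' n hn0
  have hπ := mem_possibleSizes.1 hn
  have hvar : variance (additive f) (condGWLaw p n) ≤
      K * n * (A₁.toReal * A₂.toReal + (s.toReal + S.toReal) ^ 2) := by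
    refine (variance_condGWLaw_le hn _ κ).trans ?_
    rw [inv_mul_le_iff₀ hπ, mul_comm (treeSum p n fun _ => 1)]
    exact hκ
  have ha₁ : 0 ≤ A₁.toReal := ENNReal.toReal_nonneg
  have ha₂ : 0 ≤ A₂.toReal := ENNReal.toReal_nonneg
  have hs0 : 0 ≤ s.toReal := ENNReal.toReal_nonneg
  have hS0 : 0 ≤ S.toReal := ENNReal.toReal_nonneg
  have hsqrt : √(variance (additive f) (condGWLaw p n)) ≤ (√K + 1) * (n : ℝ) ^ (1 / 2 : ℝ) *
      ((A₁.toReal * A₂.toReal) ^ (1 / 2 : ℝ) + s.toReal + S.toReal) := by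
    rw [← Real.sqrt_eq_rpow, ← Real.sqrt_eq_rpow]
    refine (Real.sqrt_le_sqrt hvar).trans ?_
    rw [Real.sqrt_mul (by positivity), Real.sqrt_mul hK0]
    refine mul_le_mul (mul_le_mul_of_nonneg_right (by linarith) (Real.sqrt_nonneg _)) ?_
      (Real.sqrt_nonneg _) (by positivity)
    rw [add_assoc]
    -- With `X = s + S`, this is `√(A₁ A₂ + X²) ≤ √(A₁ A₂) + X`.
    refine Real.sqrt_le_iff.2 ⟨by positivity, ?_⟩
    have h1 := Real.sq_sqrt (mul_nonneg ha₁ ha₂)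
    nlinarith [mul_nonneg (Real.sqrt_nonneg (A₁.toReal * A₂.toReal)) (add_nonneg hs0 hS0)]
  refine (ENNReal.ofReal_le_ofReal hsqrt).trans_eq ?_
  rw [ENNReal.ofReal_mul (by positivity), ENNReal.ofReal_mul (by positivity),
    ENNReal.ofReal_add (by positivity) hS0, ENNReal.ofReal_add (by positivity) hs0,
    ENNReal.ofReal_toReal hsfin, ENNReal.ofReal_toReal hSfin,
    ← ENNReal.ofReal_rpow_of_nonneg (by positivity) (by norm_num),
    ← ENNReal.ofReal_rpow_of_nonneg (by positivity) (by norm_num),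
    ENNReal.ofReal_mul ha₁, ENNReal.ofReal_toReal hA₁fin, ENNReal.ofReal_toReal hA₂fin,
    ENNReal.ofReal_natCast]
  rfl
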